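/- **Duality Theorem.** Let $k$ be a field, $B$ a Hopf algebra over $k$, and let $(\mathcal C,C)$ be one of the following braided tensor categories of $k$-vector spaces with additional structure, with the usual tensor product over $k$ and unit $k$ (Sweedler notation, sums suppressed): (i) the category ${}_B\mathcal M$ of left $B$-modules, $h(v\otimes w)=h_1v\otimes h_2w$, with the braiding $C^{\mathcal R}(v\otimes w)=\mathcal R^{(2)}w\otimes \mathcal R^{(1)}v$ of a quasi-triangular structure $\mathcal R$ on $B$, i.e. an invertible $\mathcal R\in B\otimes B$ with $(\Delta\otimes \mathrm{id})\mathcal R=\mathcal R_{13}\mathcal R_{23}$, $(\mathrm{id}\otimes\Delta)\mathcal R=\mathcal R_{13}\mathcal R_{12}$, $\Delta^{cop}(h)\mathcal R=\mathcal R\Delta(h)$; (ii) the category ${}^B\mathcal M$ of left $B$-comodules, $v\otimes w\mapsto v_{(-1)}w_{(-1)}\otimes (v_{(0)}\otimes w_{(0)})$, with the braiding $C^r(v\otimes w)=r(w_{(-1)},v_{(-1)})\,w_{(0)}\otimes v_{(0)}$ of a coquasi-triangular structure $r$ on $B$, i.e. a convolution-invertible bilinear form with $r(ab,c)=r(a,c_1)r(b,c_2)$,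 $r(a,bc)=r(a_1,c)r(a_2,b)$, $b_1a_1\,r(a_2,b_2)=r(a_1,b_1)\,a_2b_2$; (iii) the category ${}^B_B\mathcal{YD}$ of left-left Yetter–Drinfeld modules ($h_1v_{(-1)}\otimes h_2v_{(0)}=(h_1v)_{(-1)}h_2\otimes(h_1v)_{(0)}$), for $B$ with bijective antipode, with tensor products as in (i) and (ii) and $C(v\otimes w)=v_{(-1)}w\otimes v_{(0)}$; or the category ${}_B\mathcal{YD}^B$ of left-right Yetter–Drinfeld modules ($h_1v_{(0)}\otimes h_2v_{(1)}=(h_2v)_{(0)}\otimes(h_2v)_{(1)}h_1$), with the action on tensor products as in (i), the coaction $v\otimes w\mapsto (v_{(0)}\otimes w_{(0)})\otimes w_{(1)}v_{(1)}$ and $C(v\otimes w)=w_{(0)}\otimes w_{(1)}v$. Every finite-dimensional object of $\mathcal C$ has a left dual (in ${}_B\mathcal{YD}^B$: if the antipode of $B$ is bijective). Let $H$ be a Hopf algebra in $\mathcal C$ of finite dimension $n$ with $C_{H,H}=C_{H,H}^{-1}$, with a left dual $H^*$, evaluation $d:H^*\otimes H\to k$ and coevaluation $b:k\to H\otimes H^*$,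 and let $(R,\alpha)$ be a left $H$-module algebra in $\mathcal C$. Let $H^*$ carry the transposed structure maps ($f^*=(d\otimes\mathrm{id})(\mathrm{id}\otimes f\otimes\mathrm{id})(\mathrm{id}\otimes b)$, where $H^*\otimes H^*$ is the dual of $H\otimes H$ with evaluation $d(\mathrm{id}\otimes d\otimes\mathrm{id})$), and let $H^{\hat *}=((H^*)^{op})^{cop}$, with multiplication $m_{H^*}C_{H^*,H^*}$ and comultiplication $C_{H^*,H^*}\Delta_{H^*}$. For a bialgebra $K$ in $\mathcal C$ and a $K$-module algebra $(A,\beta)$, the smash product $A\#K$ is $A\otimes K$ with the multiplication $(m_A\otimes m_K)(\mathrm{id}\otimes\beta\otimes\mathrm{id}\otimes\mathrm{id})(\mathrm{id}\otimes\mathrm{id}\otimes C_{K,A}\otimes\mathrm{id})(\mathrm{id}\otimes\Delta_K\otimes\mathrm{id}\otimes\mathrm{id})$ and the unit $\eta_A\otimes\eta_K$. Let $H^{\hat *}$ act on $H$ by $\rightharpoonup\,=(\mathrm{id}\otimes d)(C_{H^{\hat *},H}\otimes\mathrm{id})(\mathrm{id}\otimes\Delta)$ and on $R\#H$ by $(\mathrm{id}\otimes\rightharpoonup)(C_{H^{\hat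 *},R}\otimes\mathrm{id})$. Let $H\bar\otimes H^{\hat *}$ be the algebra $H\otimes H^{*}$ with multiplication $\mathrm{id}\otimes d\otimes\mathrm{id}$ and unit $b$. Then, for every basis $e_1,\dots,e_n$ of $H$ with dual coordinates $e^1,\dots,e^n$, the space of matrices $M_n(R)$ carries a structure of an object of $\mathcal C$ such that $M_n(R)$, with the usual multiplication and unit of matrices over the ring $R$, is an algebra in $\mathcal C$, such that $M_n(R)\cong R\otimes(H\bar\otimes H^{\hat *})$ (braided tensor product) as algebras in $\mathcal C$ through an isomorphism that identifies $1\otimes v\otimes f$ with the matrix $(e^i(v)\,d(f\otimes e_j)\,1_R)_{i,j}$, and such that $$(R\#H)\#H^{\hat *}\;\cong\;M_n(R)\qquad\text{as algebras in }\mathcal C .$$ -/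

import Mathlib

namespace BraidedDuality

universe v₁ u₁ u

section Braided

open CategoryTheory MonoidalCategory
open scoped MonObj ComonObj

variable {C : Type u₁} [Category.{v₁} C] [MonoidalCategory C]

/-- An isomorphism of algebras: an isomorphism of objects that intertwines the multiplications and
the units. -/
structure IsAlgebraIso {A B : C} (mA : A ⊗ A ⟶ A) (uA : 𝟙_ C ⟶ A) (mB : B ⊗ B ⟶ B)
    (uB : 𝟙_ C ⟶ B) (Φ : A ≅ B) : Prop where
  mul : mA ≫ Φ.hom = (Φ.hom ⊗ₘ Φ.hom) ≫ mB
  one : uA ≫ Φ.hom = uB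

/-- The multiplication `id ⊗ d ⊗ id` of the algebra `H ⊗̄ H*`, where `Hd = H*` is a left dual of `H`
with evaluation `d : Hd ⊗ H ⟶ 𝟙_ C` and coevaluation `b : 𝟙_ C ⟶ H ⊗ Hd`. -/
def pairMul (H Hd : C) [ExactPairing H Hd] : (H ⊗ Hd) ⊗ (H ⊗ Hd) ⟶ H ⊗ Hd :=
  𝟙 _ ⊗≫ H ◁ (ε_ H Hd) ▷ Hd ⊗≫ 𝟙 _

/-- The unit `b` of `H ⊗̄ H*`. -/
def pairOne (H Hd : C) [ExactPairing H Hd] : 𝟙_ C ⟶ H ⊗ Hd := η_ H Hd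

/-- The multiplication of `H*`, the transpose of the comultiplication of `H`; the dual of `H ⊗ H` is
`H* ⊗ H*` with evaluation `d (id ⊗ d ⊗ id)`. -/
def dualMul (H Hd : C) [ComonObj H] [ExactPairing H Hd] : Hd ⊗ Hd ⟶ Hd :=
  𝟙 _ ⊗≫ (Hd ⊗ Hd) ◁ (η_ H Hd) ⊗≫ (Hd ⊗ Hd) ◁ Δ[H] ▷ Hd ⊗≫
    Hd ◁ (ε_ H Hd) ▷ (H ⊗ Hd) ⊗≫ (ε_ H Hd) ▷ Hd ⊗≫ 𝟙 _

/-- The unit of `H*`, the transpose of the counit of `H`. -/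
def dualOne (H Hd : C) [ComonObj H] [ExactPairing H Hd] : 𝟙_ C ⟶ Hd :=
  (η_ H Hd) ≫ ε[H] ▷ Hd ≫ (λ_ Hd).hom

/-- The comultiplication of `H*`, the transpose of the multiplication of `H`; the coevaluation of
`H ⊗ H` is `(id ⊗ b ⊗ id) b`. -/
def dualComul (H Hd : C) [MonObj H] [ExactPairing H Hd] : Hd ⟶ Hd ⊗ Hd :=
  𝟙 _ ⊗≫ Hd ◁ (η_ H Hd) ⊗≫ Hd ◁ (H ◁ (η_ H Hd) ▷ Hd) ⊗≫ Hd ◁ μ[H] ▷ (Hd ⊗ Hd) ⊗≫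
    (ε_ H Hd) ▷ (Hd ⊗ Hd) ⊗≫ 𝟙 _

variable [BraidedCategory C]

/-- The multiplication of `H^ = (H*)^{op cop}`. -/
def hatMul (H Hd : C) [ComonObj H] [ExactPairing H Hd] : Hd ⊗ Hd ⟶ Hd :=
  (β_ Hd Hd).hom ≫ dualMul H Hd

/-- The comultiplication of `H^ = (H*)^{op cop}`. -/
def hatComul (H Hd : C) [MonObj H] [ExactPairing H Hd] : Hd ⟶ Hd ⊗ Hd :=
  dualComul H Hd ≫ (β_ Hd Hd).hom

/-- The multiplication of the braided tensor product algebra `A ⊗ M`. -/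
def tensorMul {A M : C} (mA : A ⊗ A ⟶ A) (mM : M ⊗ M ⟶ M) : (A ⊗ M) ⊗ (A ⊗ M) ⟶ A ⊗ M :=
  tensorμ A M A M ≫ (mA ⊗ₘ mM)

/-- The unit of a tensor product of two algebras. -/
def tensorOne {A M : C} (uA : 𝟙_ C ⟶ A) (uM : 𝟙_ C ⟶ M) : 𝟙_ C ⟶ A ⊗ M :=
  (λ_ (𝟙_ C)).inv ≫ (uA ⊗ₘ uM)

/-- The map `act : K ⊗ A ⟶ A` makes the algebra `A` a left `K`-module algebra, for a bialgebra `K`. -/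
structure IsModuleAlgebra {K A : C} (mK : K ⊗ K ⟶ K) (uK : 𝟙_ C ⟶ K) (dK : K ⟶ K ⊗ K)
    (eK : K ⟶ 𝟙_ C) (mA : A ⊗ A ⟶ A) (uA : 𝟙_ C ⟶ A) (act : K ⊗ A ⟶ A) : Prop where
  mul_act : mK ▷ A ≫ act = (α_ K K A).hom ≫ K ◁ act ≫ act
  one_act : uK ▷ A ≫ act = (λ_ A).hom
  act_mul : K ◁ mA ≫ act = dK ▷ (A ⊗ A) ≫ tensorμ K K A A ≫ (act ⊗ₘ act) ≫ mA
  act_one : K ◁ uA ≫ act = (ρ_ K).hom ≫ eK ≫ uA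

/-- The multiplication `(m ⊗ m)(id ⊗ act ⊗ id ⊗ id)(id ⊗ id ⊗ β ⊗ id)(id ⊗ Δ ⊗ id ⊗ id)` of the smash
product `A # K`, whose underlying object is `A ⊗ K`. -/
def smashMul {A K : C} (mA : A ⊗ A ⟶ A) (mK : K ⊗ K ⟶ K) (dK : K ⟶ K ⊗ K) (act : K ⊗ A ⟶ A) :
    (A ⊗ K) ⊗ (A ⊗ K) ⟶ A ⊗ K :=
  𝟙 _ ⊗≫ A ◁ dK ▷ (A ⊗ K) ⊗≫ (A ⊗ K) ◁ (β_ K A).hom ▷ K ⊗≫ A ◁ act ▷ (K ⊗ K) ⊗≫ (mA ⊗ₘ mK)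

/-- The action `(id ⊗ d)(β ⊗ id)(id ⊗ Δ)` of `H^ = (H*)^{op cop}` on `H`. -/
def hatAct (H Hd : C) [ComonObj H] [ExactPairing H Hd] : Hd ⊗ H ⟶ H :=
  Hd ◁ Δ[H] ⊗≫ (β_ Hd H).hom ▷ H ⊗≫ H ◁ (ε_ H Hd) ⊗≫ 𝟙 _

/-- The action of `H^` on `R # H` through the tensor factor `H`. -/
def hatActSmash (R H Hd : C) [ComonObj H] [ExactPairing H Hd] : Hd ⊗ (R ⊗ H) ⟶ R ⊗ H :=
  𝟙 _ ⊗≫ (β_ Hd R).hom ▷ H ⊗≫ R ◁ hatAct H Hd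

/-- The multiplication of `(R # H) # H^`, where `act` is the action of `H` on `R`. -/
def doubleSmashMul (R H Hd : C) [MonObj R] [MonObj H] [ComonObj H] [ExactPairing H Hd]
    (act : H ⊗ R ⟶ R) : ((R ⊗ H) ⊗ Hd) ⊗ ((R ⊗ H) ⊗ Hd) ⟶ (R ⊗ H) ⊗ Hd :=
  smashMul (smashMul μ[R] μ[H] Δ[H] act) (hatMul H Hd) (hatComul H Hd) (hatActSmash R H Hd)

/-- The unit of `(R # H) # H^`. -/
def doubleSmashOne (R H Hd : C) [MonObj R] [MonObj H] [ComonObj H] [ExactPairing H Hd] :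
    𝟙_ C ⟶ (R ⊗ H) ⊗ Hd :=
  tensorOne (tensorOne η[R] η[H]) (dualOne H Hd)

end Braided

end BraidedDuality

namespace BraidedDuality

universe u v

section Actions
open scoped TensorProduct
open TensorProduct Coalgebra LinearMap
attribute [local simp] LinearMap.map_zero LinearEquiv.map_zero LinearMap.map_add
  LinearEquiv.map_add LinearMap.map_smul LinearEquiv.map_smul

variable {k : Type u} [Field k] {B : Type v} [Ring B] [HopfAlgebra k B]
variable {V W U : Type u} [AddCommGroup V] [Module k V] [AddCommGroup W] [Module k W]
  [AddCommGroup U] [Module k U]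

/-- The action `(x ⊗ y) (v ⊗ w) = x v ⊗ y w` of `B ⊗ B` on `V ⊗ W`. -/
noncomputable def twoAct (a : B →ₐ[k] Module.End k V) (b : B →ₐ[k] Module.End k W) :
    B ⊗[k] B →ₐ[k] Module.End k (V ⊗[k] W) :=
  Module.endTensorEndAlgHom.comp (Algebra.TensorProduct.map a b)

@[simp] theorem twoAct_tmul (a : B →ₐ[k] Module.End k V) (b : B →ₐ[k] Module.End k W) (x y : B) :
    twoAct a b (x ⊗ₜ y) = map (a x) (b y) := by
  simp [twoAct, Module.endTensorEndAlgHom_apply]; rfl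

/-- The diagonal action of `B` on `V ⊗ W`. -/
noncomputable def tensorAct (a : B →ₐ[k] Module.End k V) (b : B →ₐ[k] Module.End k W) :
    B →ₐ[k] Module.End k (V ⊗[k] W) :=
  (twoAct a b).comp (Bialgebra.comulAlgHom k B)

theorem tensorAct_apply (a : B →ₐ[k] Module.End k V) (b : B →ₐ[k] Module.End k W) (h : B) :
    tensorAct a b h = twoAct a b (comul h) := rfl

variable (k B) in
/-- The trivial action of `B` on `k`, through the counit. -/
noncomputable def trivAct : B →ₐ[k] Module.End k k :=
  (Algebra.lsmul k k k).comp (Bialgebra.counitAlgHom k B)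

theorem trivAct_apply (h : B) (c : k) : trivAct k B h c = Coalgebra.counit (R := k) h * c := rfl

theorem twoAct_map {V' W' : Type u} [AddCommGroup V'] [Module k V'] [AddCommGroup W'] [Module k W']
    {a : B →ₐ[k] Module.End k V} {b : B →ₐ[k] Module.End k W}
    {a' : B →ₐ[k] Module.End k V'} {b' : B →ₐ[k] Module.End k W'}
    {f : V →ₗ[k] V'} {g : W →ₗ[k] W'} (hf : ∀ h v, f (a h v) = a' h (f v))
    (hg : ∀ h w, g (b h w) = b' h (g w)) (z : B ⊗[k] B) (x : V ⊗[k] W) :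
    map f g (twoAct a b z x) = twoAct a' b' z (map f g x) := by
  induction z with
  | zero => simp
  | add z z' hz hz' => simp [hz, hz']
  | tmul p q =>
    induction x with
    | zero => simp
    | add x x' hx hx' => simp only [LinearMap.map_add, hx, hx']
    | tmul v w => simp [hf, hg]

theorem tensorAct_map {V' W' : Type u} [AddCommGroup V'] [Module k V'] [AddCommGroup W']
    [Module k W'] {a : B →ₐ[k] Module.End k V} {b : B →ₐ[k] Module.End k W}
    {a' : B →ₐ[k] Module.End k V'} {b' : B →ₐ[k] Module.End k W'}
    {f : V →ₗ[k] V'} {g : W →ₗ[k] W'} (hf : ∀ h v, f (a h v) = a' h (f v))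
    (hg : ∀ h w, g (b h w) = b' h (g w)) (h : B) (x : V ⊗[k] W) :
    map f g (tensorAct a b h x) = tensorAct a' b' h (map f g x) :=
  twoAct_map hf hg _ x

/-- The action of `B ⊗ (B ⊗ B)` on `V ⊗ (W ⊗ U)`. -/
noncomputable def threeAct (a : B →ₐ[k] Module.End k V) (b : B →ₐ[k] Module.End k W)
    (c : B →ₐ[k] Module.End k U) : B ⊗[k] (B ⊗[k] B) →ₐ[k] Module.End k (V ⊗[k] (W ⊗[k] U)) :=
  Module.endTensorEndAlgHom.comp (Algebra.TensorProduct.map a (twoAct b c))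

@[simp] theorem threeAct_tmul (a : B →ₐ[k] Module.End k V) (b : B →ₐ[k] Module.End k W)
    (c : B →ₐ[k] Module.End k U) (x : B) (y : B ⊗[k] B) :
    threeAct a b c (x ⊗ₜ y) = map (a x) (twoAct b c y) := by
  simp [threeAct, Module.endTensorEndAlgHom_apply]; rfl

theorem twoAct_tensorAct_right (a : B →ₐ[k] Module.End k V) (b : B →ₐ[k] Module.End k W)
    (c : B →ₐ[k] Module.End k U) (z : B ⊗[k] B) :
    twoAct a (tensorAct b c) z = threeAct a b c (comul.lTensor B z) := by
  induction z with
  | zero => simp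
  | add z z' hz hz' => simp [hz, hz']
  | tmul p q => simp [tensorAct_apply]

theorem assoc_twoAct_tensorAct_left (a : B →ₐ[k] Module.End k V) (b : B →ₐ[k] Module.End k W)
    (c : B →ₐ[k] Module.End k U) (z : B ⊗[k] B) (x : (V ⊗[k] W) ⊗[k] U) :
    TensorProduct.assoc k V W U (twoAct (tensorAct a b) c z x) =
      threeAct a b c (TensorProduct.assoc k B B B (comul.rTensor B z))
        (TensorProduct.assoc k V W U x) := by
  induction z with
  | zero => simp
  | add z z' hz hz' => simp [hz, hz']
  | tmul p q =>
    simp only [twoAct_tmul, tensorAct_apply, rTensor_tmul]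
    generalize (comul (R := k) p) = y
    induction y with
    | zero => simp
    | add z z' hz hz' => simp [hz, hz', map_add_left, add_tmul]
    | tmul r s =>
      induction x with
      | zero => simp
      | add x x' hx hx' => simp only [LinearMap.map_add, LinearEquiv.map_add, hx, hx']
      | tmul v w =>
        induction v with
        | zero => simp
        | add x x' hx hx' => simp only [LinearMap.map_add, LinearEquiv.map_add, add_tmul, hx, hx']
        | tmul v w => simp

theorem tensorAct_assoc (a : B →ₐ[k] Module.End k V) (b : B →ₐ[k] Module.End k W)
    (c : B →ₐ[k] Module.End k U) (h : B) (x : (V ⊗[k] W) ⊗[k] U) :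
    TensorProduct.assoc k V W U (tensorAct (tensorAct a b) c h x) =
      tensorAct a (tensorAct b c) h (TensorProduct.assoc k V W U x) := by
  rw [tensorAct_apply, assoc_twoAct_tensorAct_left, tensorAct_apply, twoAct_tensorAct_right,
    Coalgebra.coassoc_apply]

theorem tensorAct_lid (a : B →ₐ[k] Module.End k V) (h : B) (x : k ⊗[k] V) :
    TensorProduct.lid k V (tensorAct (trivAct k B) a h x) = a h (TensorProduct.lid k V x) := by
  have key : ∀ z : B ⊗[k] B, TensorProduct.lid k V (twoAct (trivAct k B) a z x) =
      a (TensorProduct.lid k B (Coalgebra.counit.rTensor B z)) (TensorProduct.lid k V x) := by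
    intro z
    induction z with
    | zero => simp
    | add z z' hz hz' => simp [hz, hz']
    | tmul p q =>
      induction x with
      | zero => simp
      | add x x' hx hx' => simp only [LinearMap.map_add, LinearEquiv.map_add, hx, hx']
      | tmul v w => simp [trivAct_apply, mul_smul, smul_comm v]
  rw [tensorAct_apply, key, Coalgebra.rTensor_counit_comul]; simp

theorem tensorAct_rid (a : B →ₐ[k] Module.End k V) (h : B) (x : V ⊗[k] k) :
    TensorProduct.rid k V (tensorAct a (trivAct k B) h x) = a h (TensorProduct.rid k V x) := by
  have key : ∀ z : B ⊗[k] B, TensorProduct.rid k V (twoAct a (trivAct k B) z x) =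
      a (TensorProduct.rid k B (Coalgebra.counit.lTensor B z)) (TensorProduct.rid k V x) := by
    intro z
    induction z with
    | zero => simp
    | add z z' hz hz' => simp [hz, hz']
    | tmul p q =>
      induction x with
      | zero => simp
      | add x x' hx hx' => simp only [LinearMap.map_add, LinearEquiv.map_add, hx, hx']
      | tmul v w => simp [trivAct_apply, mul_smul, smul_comm w]
  rw [tensorAct_apply, key, Coalgebra.lTensor_counit_comul]; simp

end Actions

section Quasi
open scoped TensorProduct
open TensorProduct Coalgebra LinearMap
attribute [local simp] LinearMap.map_zero LinearEquiv.map_zero LinearMap.map_add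
  LinearEquiv.map_add LinearMap.map_smul LinearEquiv.map_smul

/-- A quasi-triangular structure on a Hopf algebra `B`. -/
structure QuasiTriangular (k : Type u) [Field k] (B : Type v) [Ring B] [HopfAlgebra k B] where
  /-- the universal R-matrix, an invertible element of the algebra `B ⊗ B` -/
  R : (B ⊗[k] B)ˣ
  /-- `(Δ ⊗ id) R = R₁₃ R₂₃` -/
  comul_left : TensorProduct.assoc k B B B (comul.rTensor B (R : B ⊗[k] B)) =
    Algebra.TensorProduct.map (AlgHom.id k B) Algebra.TensorProduct.includeRight (R : B ⊗[k] B) *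
      Algebra.TensorProduct.includeRight (R : B ⊗[k] B)
  /-- `(id ⊗ Δ) R = R₁₃ R₁₂` -/
  comul_right : comul.lTensor B (R : B ⊗[k] B) =
    Algebra.TensorProduct.map (AlgHom.id k B) Algebra.TensorProduct.includeRight (R : B ⊗[k] B) *
      Algebra.TensorProduct.map (AlgHom.id k B) Algebra.TensorProduct.includeLeft (R : B ⊗[k] B)
  /-- `Δ^cop(h) R = R Δ(h)` -/
  comm_comul : ∀ h : B, TensorProduct.comm k B B (comul (R := k) h) * (R : B ⊗[k] B) =
    (R : B ⊗[k] B) * comul (R := k) h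

variable {k : Type u} [Field k] {B : Type v} [Ring B] [HopfAlgebra k B]
variable {V W U : Type u} [AddCommGroup V] [Module k V] [AddCommGroup W] [Module k W]
  [AddCommGroup U] [Module k U]

theorem comm_twoAct (a : B →ₐ[k] Module.End k V) (b : B →ₐ[k] Module.End k W) (z : B ⊗[k] B)
    (x : V ⊗[k] W) : TensorProduct.comm k V W (twoAct a b z x) =
      twoAct b a (TensorProduct.comm k B B z) (TensorProduct.comm k V W x) := by
  induction z with
  | zero => simp
  | add z z' hz hz' => simp [hz, hz']
  | tmul p q =>
    induction x with
    | zero => simp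
    | add x x' hx hx' => simp only [LinearMap.map_add, LinearEquiv.map_add, hx, hx']
    | tmul v w => simp

namespace QuasiTriangular

variable (Q : QuasiTriangular k B)

/-- The action of the R-matrix on `V ⊗ W`. -/
noncomputable def actR (a : B →ₐ[k] Module.End k V) (b : B →ₐ[k] Module.End k W) :
    V ⊗[k] W ≃ₗ[k] V ⊗[k] W :=
  { twoAct a b (Q.R : B ⊗[k] B) with
    invFun := twoAct a b ((Q.R⁻¹ : (B ⊗[k] B)ˣ) : B ⊗[k] B)
    left_inv := fun x => by
      change twoAct a b _ (twoAct a b _ x) = x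
      rw [← Module.End.mul_apply, ← map_mul, Units.inv_mul, map_one]; rfl
    right_inv := fun x => by
      change twoAct a b _ (twoAct a b _ x) = x
      rw [← Module.End.mul_apply, ← map_mul, Units.mul_inv, map_one]; rfl }

/-- The braiding `v ⊗ w ↦ ∑ R⁽²⁾ w ⊗ R⁽¹⁾ v`. -/
noncomputable def braid (a : B →ₐ[k] Module.End k V) (b : B →ₐ[k] Module.End k W) :
    V ⊗[k] W ≃ₗ[k] W ⊗[k] V :=
  (Q.actR a b).trans (TensorProduct.comm k V W)

theorem braid_apply (a : B →ₐ[k] Module.End k V) (b : B →ₐ[k] Module.End k W) (x : V ⊗[k] W) :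
    Q.braid a b x = TensorProduct.comm k V W (twoAct a b (Q.R : B ⊗[k] B) x) := rfl

theorem braid_act (a : B →ₐ[k] Module.End k V) (b : B →ₐ[k] Module.End k W) (h : B)
    (x : V ⊗[k] W) : Q.braid a b (tensorAct a b h x) = tensorAct b a h (Q.braid a b x) := by
  simp only [braid_apply, tensorAct_apply]
  rw [← Module.End.mul_apply, ← map_mul, ← Q.comm_comul, map_mul, Module.End.mul_apply,
    comm_twoAct]
  congr 2
  exact (TensorProduct.comm k B B).symm_apply_apply _

theorem threeAct_23 (a : B →ₐ[k] Module.End k V) (b : B →ₐ[k] Module.End k W)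
    (c : B →ₐ[k] Module.End k U) (z : B ⊗[k] B) :
    threeAct a b c (Algebra.TensorProduct.includeRight z) = (twoAct b c z).lTensor V := by
  simp [LinearMap.lTensor, Module.End.one_eq_id]

theorem threeAct_12 (a : B →ₐ[k] Module.End k V) (b : B →ₐ[k] Module.End k W)
    (c : B →ₐ[k] Module.End k U) (z : B ⊗[k] B) (x : (V ⊗[k] W) ⊗[k] U) :
    threeAct a b c (Algebra.TensorProduct.map (AlgHom.id k B) Algebra.TensorProduct.includeLeft z)
      (TensorProduct.assoc k V W U x) =
      TensorProduct.assoc k V W U ((twoAct a b z).rTensor U x) := by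
  induction z with
  | zero => simp
  | add z z' hz hz' => simp [hz, hz', LinearMap.rTensor_add]
  | tmul p q =>
    induction x with
    | zero => simp
    | add x x' hx hx' => simp only [LinearMap.map_add, LinearEquiv.map_add, hx, hx']
    | tmul v u =>
      induction v with
      | zero => simp
      | add x x' hx hx' => simp only [LinearMap.map_add, LinearEquiv.map_add, add_tmul, hx, hx']
      | tmul v w => simp

theorem threeAct_13 (a : B →ₐ[k] Module.End k V) (b : B →ₐ[k] Module.End k W)
    (c : B →ₐ[k] Module.End k U) (z : B ⊗[k] B) (x : (W ⊗[k] V) ⊗[k] U) :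
    threeAct a b c (Algebra.TensorProduct.map (AlgHom.id k B) Algebra.TensorProduct.includeRight z)
      (leftComm k W V U (TensorProduct.assoc k W V U x)) =
      leftComm k W V U ((twoAct a c z).lTensor W (TensorProduct.assoc k W V U x)) := by
  induction z with
  | zero => simp
  | add z z' hz hz' => simp [hz, hz', LinearMap.lTensor_add]
  | tmul p q =>
    induction x with
    | zero => simp
    | add x x' hx hx' => simp only [LinearMap.map_add, LinearEquiv.map_add, hx, hx']
    | tmul v u =>
      induction v with
      | zero => simp
      | add x x' hx hx' => simp only [LinearMap.map_add, LinearEquiv.map_add, add_tmul, hx, hx']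
      | tmul v w => simp

theorem hexagon_forward (a : B →ₐ[k] Module.End k V) (b : B →ₐ[k] Module.End k W)
    (c : B →ₐ[k] Module.End k U) (x : (V ⊗[k] W) ⊗[k] U) :
    TensorProduct.assoc k W U V (Q.braid a (tensorAct b c) (TensorProduct.assoc k V W U x)) =
      (Q.braid a c).toLinearMap.lTensor W
        (TensorProduct.assoc k W V U ((Q.braid a b).toLinearMap.rTensor U x)) := by
  rw [braid_apply, twoAct_tensorAct_right, Q.comul_right, map_mul, Module.End.mul_apply,
    threeAct_12]
  have h1 : ∀ y : (V ⊗[k] W) ⊗[k] U, TensorProduct.assoc k V W U y =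
      leftComm k W V U (TensorProduct.assoc k W V U
        ((TensorProduct.comm k V W).toLinearMap.rTensor U y)) := by
    intro y
    induction y with
    | zero => simp
    | add x x' hx hx' => simp only [LinearMap.map_add, LinearEquiv.map_add, hx, hx']
    | tmul v u =>
      induction v with
      | zero => simp
      | add x x' hx hx' => simp only [LinearMap.map_add, LinearEquiv.map_add, add_tmul, hx, hx']
      | tmul v w => simp
  have h2 : ∀ y : W ⊗[k] (V ⊗[k] U), TensorProduct.assoc k W U V (TensorProduct.comm k V (W ⊗[k] U)
      (leftComm k W V U y)) =
        (TensorProduct.comm k V U).toLinearMap.lTensor W y := by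
    intro y
    induction y with
    | zero => simp
    | add x x' hx hx' => simp only [LinearMap.map_add, LinearEquiv.map_add, hx, hx']
    | tmul v u =>
      induction u with
      | zero => simp
      | add x x' hx hx' => simp only [LinearMap.map_add, LinearEquiv.map_add, tmul_add, hx, hx']
      | tmul v w => simp
  rw [h1, threeAct_13, h2, ← comp_apply, ← lTensor_comp,
    ← comp_apply (LinearMap.rTensor _ _), ← rTensor_comp]
  rfl

theorem hexagon_reverse (a : B →ₐ[k] Module.End k V) (b : B →ₐ[k] Module.End k W)
    (c : B →ₐ[k] Module.End k U) (x : V ⊗[k] (W ⊗[k] U)) :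
    (TensorProduct.assoc k U V W).symm (Q.braid (tensorAct a b) c
        ((TensorProduct.assoc k V W U).symm x)) =
      (Q.braid a c).toLinearMap.rTensor W
        ((TensorProduct.assoc k V U W).symm ((Q.braid b c).toLinearMap.lTensor V x)) := by
  obtain ⟨x, rfl⟩ := (TensorProduct.assoc k V W U).surjective x
  rw [LinearEquiv.symm_apply_apply, LinearEquiv.symm_apply_eq, braid_apply]
  have h1 : ∀ y : V ⊗[k] (W ⊗[k] U), TensorProduct.comm k (V ⊗[k] W) U
      ((TensorProduct.assoc k V W U).symm y) = TensorProduct.assoc k U V W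
        ((TensorProduct.comm k V U).toLinearMap.rTensor W
          ((TensorProduct.assoc k V U W).symm
            ((TensorProduct.comm k W U).toLinearMap.lTensor V y))) := by
    intro y
    induction y with
    | zero => simp
    | add x x' hx hx' => simp only [LinearMap.map_add, LinearEquiv.map_add, hx, hx']
    | tmul v u =>
      induction u with
      | zero => simp
      | add x x' hx hx' => simp only [LinearMap.map_add, LinearEquiv.map_add, tmul_add, hx, hx']
      | tmul v w => simp
  have h2 : ∀ (z : B ⊗[k] B) (y : V ⊗[k] (U ⊗[k] W)),
      threeAct a b c (Algebra.TensorProduct.map (AlgHom.id k B)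
        Algebra.TensorProduct.includeRight z)
        ((TensorProduct.comm k U W).toLinearMap.lTensor V y) =
      (TensorProduct.comm k U W).toLinearMap.lTensor V (TensorProduct.assoc k V U W
        ((twoAct a c z).rTensor W ((TensorProduct.assoc k V U W).symm y))) := by
    intro z y
    induction z with
    | zero => simp
    | add z z' hz hz' => simp [hz, hz', LinearMap.rTensor_add]
    | tmul p q =>
      induction y with
      | zero => simp
      | add x x' hx hx' => simp only [LinearMap.map_add, LinearEquiv.map_add, hx, hx']
      | tmul v u =>
        induction u with
        | zero => simp
        | add x x' hx hx' => simp only [LinearMap.map_add, LinearEquiv.map_add, tmul_add, hx, hx']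
        | tmul v w => simp
  have h3 : ∀ y : V ⊗[k] (W ⊗[k] U), y = (TensorProduct.comm k U W).toLinearMap.lTensor V
      ((TensorProduct.comm k W U).toLinearMap.lTensor V y) := by
    intro y
    rw [← comp_apply, ← lTensor_comp]
    simp
  have h4 : ∀ y : V ⊗[k] (U ⊗[k] W), (TensorProduct.comm k W U).toLinearMap.lTensor V
      ((TensorProduct.comm k U W).toLinearMap.lTensor V y) = y := by
    intro y
    rw [← comp_apply, ← lTensor_comp]
    simp
  have h5 := assoc_twoAct_tensorAct_left a b c (Q.R : B ⊗[k] B) x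
  rw [← LinearEquiv.eq_symm_apply] at h5
  rw [h5, h1, Q.comul_left, map_mul, Module.End.mul_apply, threeAct_23,
    h3 (LinearMap.lTensor _ _ _), h2, h4, LinearEquiv.symm_apply_apply]
  congr 1
  have e1 : (Q.braid a c).toLinearMap = (TensorProduct.comm k V U).toLinearMap ∘ₗ
    twoAct a c (Q.R : B ⊗[k] B) := rfl
  have e2 : (Q.braid b c).toLinearMap = (TensorProduct.comm k W U).toLinearMap ∘ₗ
    twoAct b c (Q.R : B ⊗[k] B) := rfl
  rw [e1, e2, rTensor_comp, lTensor_comp]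
  rfl
end QuasiTriangular
end Quasi
end BraidedDuality

namespace BraidedDuality

universe u v

section Coactions
open scoped TensorProduct
open TensorProduct Coalgebra LinearMap
attribute [local simp] LinearMap.map_zero LinearEquiv.map_zero LinearMap.map_add
  LinearEquiv.map_add LinearMap.map_smul LinearEquiv.map_smul

variable {k : Type u} [Field k] {B : Type v} [Ring B] [HopfAlgebra k B]
variable {V W U : Type u} [AddCommGroup V] [Module k V] [AddCommGroup W] [Module k W]
  [AddCommGroup U] [Module k U]

/-- `ρ : V → B ⊗ V` is a left coaction of the coalgebra `B`. -/
structure IsLeftCoaction (ρ : V →ₗ[k] B ⊗[k] V) : Prop where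
  coassoc : ∀ v, TensorProduct.assoc k B B V (comul.rTensor V (ρ v)) =
    ρ.lTensor B (ρ v)
  counit : ∀ v, Coalgebra.counit.rTensor V (ρ v) = (1 : k) ⊗ₜ[k] v

/-- The bilinear map `(p ⊗ v, q ⊗ w) ↦ p q ⊗ (v ⊗ w)`. -/
noncomputable def mulCo : B ⊗[k] V →ₗ[k] B ⊗[k] W →ₗ[k] B ⊗[k] (V ⊗[k] W) :=
  map₂ (LinearMap.mul k B) (TensorProduct.mk k V W)

@[simp] theorem mulCo_tmul (p q : B) (v : V) (w : W) :
    mulCo (k := k) (p ⊗ₜ[k] v) (q ⊗ₜ[k] w) = (p * q) ⊗ₜ[k] (v ⊗ₜ[k] w) := rfl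

/-- The coaction `v ⊗ w ↦ v₍₋₁₎ w₍₋₁₎ ⊗ (v₍₀₎ ⊗ w₍₀₎)` on `V ⊗ W`. -/
noncomputable def tensorCoact (ρ : V →ₗ[k] B ⊗[k] V) (σ : W →ₗ[k] B ⊗[k] W) :
    V ⊗[k] W →ₗ[k] B ⊗[k] (V ⊗[k] W) :=
  lift (mulCo.compl₁₂ ρ σ)

@[simp] theorem tensorCoact_tmul (ρ : V →ₗ[k] B ⊗[k] V) (σ : W →ₗ[k] B ⊗[k] W) (v : V) (w : W) :
    tensorCoact ρ σ (v ⊗ₜ[k] w) = mulCo (ρ v) (σ w) := rfl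

variable (k B) in
/-- The trivial coaction `c ↦ 1 ⊗ c` on `k`. -/
noncomputable def trivCoact : k →ₗ[k] B ⊗[k] k := TensorProduct.mk k B k 1

@[simp] theorem trivCoact_apply (c : k) : trivCoact k B c = 1 ⊗ₜ[k] c := rfl

theorem isLeftCoaction_triv : IsLeftCoaction (trivCoact k B) where
  coassoc v := by simp [Bialgebra.comul_one, Algebra.TensorProduct.one_def]
  counit v := by simp

theorem IsLeftCoaction.tensor {ρ : V →ₗ[k] B ⊗[k] V} {σ : W →ₗ[k] B ⊗[k] W}
    (hρ : IsLeftCoaction ρ) (hσ : IsLeftCoaction σ) : IsLeftCoaction (tensorCoact ρ σ) where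
  coassoc x := by
    have h1 : ∀ (x : B ⊗[k] V) (y : B ⊗[k] W),
        TensorProduct.assoc k B B (V ⊗[k] W) (comul.rTensor (V ⊗[k] W) (mulCo x y)) =
        map₂ (LinearMap.mul k B) mulCo
          (TensorProduct.assoc k B B V (comul.rTensor V x))
          (TensorProduct.assoc k B B W (comul.rTensor W y)) := by
      intro x y
      induction x with
      | zero => simp
      | add x x' hx hx' => simp only [LinearMap.map_add, LinearEquiv.map_add, hx, hx', LinearMap.add_apply]
      | tmul p v =>
        induction y with
        | zero => simp
        | add x x' hx hx' => simp only [LinearMap.map_add, LinearEquiv.map_add, hx, hx']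
        | tmul q w =>
          simp only [mulCo_tmul, rTensor_tmul, Bialgebra.comul_mul]
          generalize (comul (R := k) p) = x
          generalize (comul (R := k) q) = y
          induction x with
          | zero => simp
          | add x x' hx hx' =>
            simp only [LinearMap.map_add, LinearEquiv.map_add, hx, hx', LinearMap.add_apply, add_mul, add_tmul]
          | tmul p p' =>
            induction y with
            | zero => simp
            | add x x' hx hx' =>
              simp only [LinearMap.map_add, LinearEquiv.map_add, hx, hx', mul_add, add_tmul]
            | tmul q q' => simp
    have h2 : ∀ (x : B ⊗[k] V) (y : B ⊗[k] W),
        (tensorCoact ρ σ).lTensor B (mulCo x y) =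
        map₂ (LinearMap.mul k B) mulCo (ρ.lTensor B x) (σ.lTensor B y) := by
      intro x y
      induction x with
      | zero => simp
      | add x x' hx hx' => simp only [LinearMap.map_add, hx, hx', LinearMap.add_apply]
      | tmul p v =>
        induction y with
        | zero => simp
        | add x x' hx hx' => simp only [LinearMap.map_add, hx, hx']
        | tmul q w => simp
    induction x with
    | zero => simp
    | add x x' hx hx' => simp only [LinearMap.map_add, LinearEquiv.map_add, hx, hx']
    | tmul v w => rw [tensorCoact_tmul, h1, h2, hρ.coassoc, hσ.coassoc]
  counit x := by
    have h1 : ∀ (x : B ⊗[k] V) (y : B ⊗[k] W),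
        Coalgebra.counit.rTensor (V ⊗[k] W) (mulCo x y) =
        map₂ (LinearMap.mul k k) (TensorProduct.mk k V W)
          (Coalgebra.counit.rTensor V x) (Coalgebra.counit.rTensor W y) := by
      intro x y
      induction x with
      | zero => simp
      | add x x' hx hx' => simp only [LinearMap.map_add, hx, hx', LinearMap.add_apply]
      | tmul p v =>
        induction y with
        | zero => simp
        | add x x' hx hx' => simp only [LinearMap.map_add, hx, hx']
        | tmul q w => simp
    induction x with
    | zero => simp
    | add x x' hx hx' => simp only [LinearMap.map_add, hx, hx', tmul_add]
    | tmul v w => rw [tensorCoact_tmul, h1, hρ.counit, hσ.counit]; simp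

theorem tensorCoact_assoc (ρ : V →ₗ[k] B ⊗[k] V) (σ : W →ₗ[k] B ⊗[k] W) (τ : U →ₗ[k] B ⊗[k] U)
    (x : (V ⊗[k] W) ⊗[k] U) :
    (TensorProduct.assoc k V W U).toLinearMap.lTensor B (tensorCoact (tensorCoact ρ σ) τ x) =
      tensorCoact ρ (tensorCoact σ τ) (TensorProduct.assoc k V W U x) := by
  induction x with
  | zero => simp
  | add x x' hx hx' => simp only [LinearMap.map_add, LinearEquiv.map_add, hx, hx']
  | tmul y u =>
    induction y with
    | zero => simp
    | add x x' hx hx' => simp only [LinearMap.map_add, LinearEquiv.map_add, add_tmul, hx, hx']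
    | tmul v w =>
      simp only [tensorCoact_tmul, assoc_tmul]
      generalize ρ v = x
      generalize σ w = y
      generalize τ u = z
      induction x with
      | zero => simp
      | add x x' hx hx' => simp only [LinearMap.map_add, hx, hx', LinearMap.add_apply]
      | tmul p v =>
        induction y with
        | zero => simp
        | add x x' hx hx' => simp only [LinearMap.map_add, hx, hx', LinearMap.add_apply]
        | tmul q w =>
          induction z with
          | zero => simp
          | add x x' hx hx' => simp only [LinearMap.map_add, hx, hx']
          | tmul r u => simp [mul_assoc]

theorem tensorCoact_lid (ρ : V →ₗ[k] B ⊗[k] V) (x : k ⊗[k] V) :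
    (TensorProduct.lid k V).toLinearMap.lTensor B (tensorCoact (trivCoact k B) ρ x) =
      ρ (TensorProduct.lid k V x) := by
  induction x with
  | zero => simp
  | add x x' hx hx' => simp only [LinearMap.map_add, LinearEquiv.map_add, hx, hx']
  | tmul c v =>
    simp only [tensorCoact_tmul, lid_tmul, map_smul]
    generalize ρ v = x
    induction x with
    | zero => simp
    | add x x' hx hx' => simp only [LinearMap.map_add, hx, hx', smul_add]
    | tmul p v => simp

theorem tensorCoact_rid (ρ : V →ₗ[k] B ⊗[k] V) (x : V ⊗[k] k) :
    (TensorProduct.rid k V).toLinearMap.lTensor B (tensorCoact ρ (trivCoact k B) x) =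
      ρ (TensorProduct.rid k V x) := by
  induction x with
  | zero => simp
  | add x x' hx hx' => simp only [LinearMap.map_add, LinearEquiv.map_add, hx, hx']
  | tmul v c =>
    simp only [tensorCoact_tmul, rid_tmul, map_smul]
    generalize ρ v = x
    induction x with
    | zero => simp
    | add x x' hx hx' => simp only [LinearMap.map_add, hx, hx', smul_add, LinearMap.add_apply]
    | tmul p v => simp

theorem tensorCoact_map {V' W' : Type u} [AddCommGroup V'] [Module k V'] [AddCommGroup W']
    [Module k W'] {ρ : V →ₗ[k] B ⊗[k] V} {σ : W →ₗ[k] B ⊗[k] W}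
    {ρ' : V' →ₗ[k] B ⊗[k] V'} {σ' : W' →ₗ[k] B ⊗[k] W'}
    {f : V →ₗ[k] V'} {g : W →ₗ[k] W'} (hf : ∀ v, f.lTensor B (ρ v) = ρ' (f v))
    (hg : ∀ w, g.lTensor B (σ w) = σ' (g w)) (x : V ⊗[k] W) :
    (map f g).lTensor B (tensorCoact ρ σ x) =
      tensorCoact ρ' σ' (map f g x) := by
  induction x with
  | zero => simp
  | add x x' hx hx' => simp only [LinearMap.map_add, hx, hx']
  | tmul v w =>
    simp only [tensorCoact_tmul, map_tmul, ← hf, ← hg]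
    generalize ρ v = x
    generalize σ w = y
    induction x with
    | zero => simp
    | add x x' hx hx' => simp only [LinearMap.map_add, hx, hx', LinearMap.add_apply]
    | tmul p v =>
      induction y with
      | zero => simp
      | add x x' hx hx' => simp only [LinearMap.map_add, hx, hx']
      | tmul q w => simp

/-- `ρ : V → V ⊗ B` is a right coaction of the coalgebra `B`. -/
structure IsRightCoaction (ρ : V →ₗ[k] V ⊗[k] B) : Prop where
  coassoc : ∀ v, TensorProduct.assoc k V B B (ρ.rTensor B (ρ v)) =
    comul.lTensor V (ρ v)
  counit : ∀ v, Coalgebra.counit.lTensor V (ρ v) = v ⊗ₜ[k] (1 : k)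

/-- The bilinear map `(v ⊗ p, w ⊗ q) ↦ (v ⊗ w) ⊗ q p`. -/
noncomputable def mulCoR : V ⊗[k] B →ₗ[k] W ⊗[k] B →ₗ[k] (V ⊗[k] W) ⊗[k] B :=
  map₂ (TensorProduct.mk k V W) (LinearMap.mul k B).flip

@[simp] theorem mulCoR_tmul (p q : B) (v : V) (w : W) :
    mulCoR (k := k) (v ⊗ₜ[k] p) (w ⊗ₜ[k] q) = (v ⊗ₜ[k] w) ⊗ₜ[k] (q * p) := rfl

/-- The coaction `v ⊗ w ↦ (v₍₀₎ ⊗ w₍₀₎) ⊗ w₍₁₎ v₍₁₎` on `V ⊗ W`. -/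
noncomputable def tensorCoactR (ρ : V →ₗ[k] V ⊗[k] B) (σ : W →ₗ[k] W ⊗[k] B) :
    V ⊗[k] W →ₗ[k] (V ⊗[k] W) ⊗[k] B :=
  lift (mulCoR.compl₁₂ ρ σ)

@[simp] theorem tensorCoactR_tmul (ρ : V →ₗ[k] V ⊗[k] B) (σ : W →ₗ[k] W ⊗[k] B) (v : V) (w : W) :
    tensorCoactR ρ σ (v ⊗ₜ[k] w) = mulCoR (ρ v) (σ w) := rfl

variable (k B) in
/-- The trivial coaction `c ↦ c ⊗ 1` on `k`. -/
noncomputable def trivCoactR : k →ₗ[k] k ⊗[k] B := (TensorProduct.mk k k B).flip 1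

@[simp] theorem trivCoactR_apply (c : k) : trivCoactR k B c = c ⊗ₜ[k] 1 := rfl

theorem isRightCoaction_triv : IsRightCoaction (trivCoactR k B) where
  coassoc v := by simp [Bialgebra.comul_one, Algebra.TensorProduct.one_def]
  counit v := by simp

theorem IsRightCoaction.tensor {ρ : V →ₗ[k] V ⊗[k] B} {σ : W →ₗ[k] W ⊗[k] B}
    (hρ : IsRightCoaction ρ) (hσ : IsRightCoaction σ) : IsRightCoaction (tensorCoactR ρ σ) where
  coassoc x := by
    have h1 : ∀ (x : V ⊗[k] B) (y : W ⊗[k] B),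
        comul.lTensor (V ⊗[k] W) (mulCoR x y) =
        TensorProduct.assoc k (V ⊗[k] W) B B
          (map₂ mulCoR (LinearMap.mul k B).flip
            ((TensorProduct.assoc k V B B).symm (comul.lTensor V x))
            ((TensorProduct.assoc k W B B).symm (comul.lTensor W y))) := by
      intro x y
      induction x with
      | zero => simp
      | add x x' hx hx' => simp only [LinearMap.map_add, LinearEquiv.map_add, hx, hx', LinearMap.add_apply]
      | tmul v p =>
        induction y with
        | zero => simp
        | add x x' hx hx' => simp only [LinearMap.map_add, LinearEquiv.map_add, hx, hx']
        | tmul w q =>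
          simp only [mulCoR_tmul, lTensor_tmul, Bialgebra.comul_mul]
          generalize (comul (R := k) p) = x
          generalize (comul (R := k) q) = y
          induction x with
          | zero => simp
          | add x x' hx hx' =>
            simp only [LinearMap.map_add, LinearEquiv.map_add, hx, hx', LinearMap.add_apply, mul_add, tmul_add]
          | tmul p p' =>
            induction y with
            | zero => simp
            | add x x' hx hx' =>
              simp only [LinearMap.map_add, LinearEquiv.map_add, hx, hx', add_mul, tmul_add]
            | tmul q q' => simp
    have h2 : ∀ (x : V ⊗[k] B) (y : W ⊗[k] B),
        (tensorCoactR ρ σ).rTensor B (mulCoR x y) =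
        map₂ mulCoR (LinearMap.mul k B).flip (ρ.rTensor B x) (σ.rTensor B y) := by
      intro x y
      induction x with
      | zero => simp
      | add x x' hx hx' => simp only [LinearMap.map_add, hx, hx', LinearMap.add_apply]
      | tmul p v =>
        induction y with
        | zero => simp
        | add x x' hx hx' => simp only [LinearMap.map_add, hx, hx']
        | tmul q w => simp
    induction x with
    | zero => simp
    | add x x' hx hx' => simp only [LinearMap.map_add, LinearEquiv.map_add, hx, hx']
    | tmul v w =>
      rw [tensorCoactR_tmul, h1, h2, ← hρ.coassoc, ← hσ.coassoc, LinearEquiv.symm_apply_apply,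
        LinearEquiv.symm_apply_apply]
  counit x := by
    have h1 : ∀ (x : V ⊗[k] B) (y : W ⊗[k] B),
        Coalgebra.counit.lTensor (V ⊗[k] W) (mulCoR x y) =
        map₂ (TensorProduct.mk k V W) (LinearMap.mul k k)
          (Coalgebra.counit.lTensor V x) (Coalgebra.counit.lTensor W y) := by
      intro x y
      induction x with
      | zero => simp
      | add x x' hx hx' => simp only [LinearMap.map_add, hx, hx', LinearMap.add_apply]
      | tmul p v =>
        induction y with
        | zero => simp
        | add x x' hx hx' => simp only [LinearMap.map_add, hx, hx']
        | tmul q w => simp [mul_comm]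
    induction x with
    | zero => simp
    | add x x' hx hx' => simp only [LinearMap.map_add, hx, hx', add_tmul]
    | tmul v w => rw [tensorCoactR_tmul, h1, hρ.counit, hσ.counit]; simp

theorem tensorCoactR_assoc (ρ : V →ₗ[k] V ⊗[k] B) (σ : W →ₗ[k] W ⊗[k] B) (τ : U →ₗ[k] U ⊗[k] B)
    (x : (V ⊗[k] W) ⊗[k] U) :
    (TensorProduct.assoc k V W U).toLinearMap.rTensor B (tensorCoactR (tensorCoactR ρ σ) τ x) =
      tensorCoactR ρ (tensorCoactR σ τ) (TensorProduct.assoc k V W U x) := by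
  induction x with
  | zero => simp
  | add x x' hx hx' => simp only [LinearMap.map_add, LinearEquiv.map_add, hx, hx']
  | tmul y u =>
    induction y with
    | zero => simp
    | add x x' hx hx' => simp only [LinearMap.map_add, LinearEquiv.map_add, add_tmul, hx, hx']
    | tmul v w =>
      simp only [tensorCoactR_tmul, assoc_tmul]
      generalize ρ v = x
      generalize σ w = y
      generalize τ u = z
      induction x with
      | zero => simp
      | add x x' hx hx' => simp only [LinearMap.map_add, hx, hx', LinearMap.add_apply]
      | tmul p v =>
        induction y with
        | zero => simp
        | add x x' hx hx' => simp only [LinearMap.map_add, hx, hx', LinearMap.add_apply]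
        | tmul q w =>
          induction z with
          | zero => simp
          | add x x' hx hx' => simp only [LinearMap.map_add, hx, hx']
          | tmul r u => simp [mul_assoc]

theorem tensorCoactR_lid (ρ : V →ₗ[k] V ⊗[k] B) (x : k ⊗[k] V) :
    (TensorProduct.lid k V).toLinearMap.rTensor B (tensorCoactR (trivCoactR k B) ρ x) =
      ρ (TensorProduct.lid k V x) := by
  induction x with
  | zero => simp
  | add x x' hx hx' => simp only [LinearMap.map_add, LinearEquiv.map_add, hx, hx']
  | tmul c v =>
    simp only [tensorCoactR_tmul, lid_tmul, map_smul]
    generalize ρ v = x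
    induction x with
    | zero => simp
    | add x x' hx hx' => simp only [LinearMap.map_add, hx, hx', smul_add]
    | tmul p v => simp [smul_tmul']

theorem tensorCoactR_rid (ρ : V →ₗ[k] V ⊗[k] B) (x : V ⊗[k] k) :
    (TensorProduct.rid k V).toLinearMap.rTensor B (tensorCoactR ρ (trivCoactR k B) x) =
      ρ (TensorProduct.rid k V x) := by
  induction x with
  | zero => simp
  | add x x' hx hx' => simp only [LinearMap.map_add, LinearEquiv.map_add, hx, hx']
  | tmul v c =>
    simp only [tensorCoactR_tmul, rid_tmul, map_smul]
    generalize ρ v = x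
    induction x with
    | zero => simp
    | add x x' hx hx' => simp only [LinearMap.map_add, hx, hx', smul_add, LinearMap.add_apply]
    | tmul p v => simp [smul_tmul']

theorem tensorCoactR_map {V' W' : Type u} [AddCommGroup V'] [Module k V'] [AddCommGroup W']
    [Module k W'] {ρ : V →ₗ[k] V ⊗[k] B} {σ : W →ₗ[k] W ⊗[k] B}
    {ρ' : V' →ₗ[k] V' ⊗[k] B} {σ' : W' →ₗ[k] W' ⊗[k] B}
    {f : V →ₗ[k] V'} {g : W →ₗ[k] W'} (hf : ∀ v, f.rTensor B (ρ v) = ρ' (f v))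
    (hg : ∀ w, g.rTensor B (σ w) = σ' (g w)) (x : V ⊗[k] W) :
    (map f g).rTensor B (tensorCoactR ρ σ x) =
      tensorCoactR ρ' σ' (map f g x) := by
  induction x with
  | zero => simp
  | add x x' hx hx' => simp only [LinearMap.map_add, hx, hx']
  | tmul v w =>
    simp only [tensorCoactR_tmul, map_tmul, ← hf, ← hg]
    generalize ρ v = x
    generalize σ w = y
    induction x with
    | zero => simp
    | add x x' hx hx' => simp only [LinearMap.map_add, hx, hx', LinearMap.add_apply]
    | tmul p v =>
      induction y with
      | zero => simp
      | add x x' hx hx' => simp only [LinearMap.map_add, hx, hx']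
      | tmul q w => simp

end Coactions
end BraidedDuality

namespace BraidedDuality

universe u v

section Coquasi
open scoped TensorProduct
open TensorProduct Coalgebra LinearMap
attribute [local simp] LinearMap.map_zero LinearEquiv.map_zero LinearMap.map_add
  LinearEquiv.map_add LinearMap.map_smul LinearEquiv.map_smul

/-- A coquasi-triangular structure on a Hopf algebra `B`: a convolution-invertible bilinear form `r`.
The multiplication maps `map₂ f g` below send `(a₁ ⊗ a₂, b₁ ⊗ b₂)` to `f a₁ b₁ ⊗ g a₂ b₂`. -/
structure CoquasiTriangular (k : Type u) [Field k] (B : Type v) [Ring B] [HopfAlgebra k B] where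
  /-- the bilinear form -/
  r : B →ₗ[k] B →ₗ[k] k
  /-- its convolution inverse -/
  rinv : B →ₗ[k] B →ₗ[k] k
  /-- `r(a₁, b₁) r⁻¹(a₂, b₂) = ε(a) ε(b)` -/
  r_rinv : ∀ a b : B, LinearMap.mul' k k (map₂ r rinv (comul (R := k) a)
    (comul (R := k) b)) = Coalgebra.counit (R := k) a * Coalgebra.counit (R := k) b
  /-- `r⁻¹(a₁, b₁) r(a₂, b₂) = ε(a) ε(b)` -/
  rinv_r : ∀ a b : B, LinearMap.mul' k k (map₂ rinv r (comul (R := k) a)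
    (comul (R := k) b)) = Coalgebra.counit (R := k) a * Coalgebra.counit (R := k) b
  /-- `r(a b, c) = r(a, c₁) r(b, c₂)` -/
  mul_left : ∀ a b c : B, r (a * b) c =
    LinearMap.mul' k k (map (r a) (r b) (comul (R := k) c))
  /-- `r(a, b c) = r(a₁, c) r(a₂, b)` -/
  mul_right : ∀ a b c : B, r a (b * c) =
    LinearMap.mul' k k (map (r.flip c) (r.flip b) (comul (R := k) a))
  /-- `b₁ a₁ r(a₂, b₂) = r(a₁, b₁) a₂ b₂` -/
  comm_mul : ∀ a b : B,
    TensorProduct.rid k B (map₂ (LinearMap.mul k B).flip r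
      (comul (R := k) a) (comul (R := k) b)) =
    TensorProduct.lid k B (map₂ r (LinearMap.mul k B)
      (comul (R := k) a) (comul (R := k) b))

variable {k : Type u} [Field k] {B : Type v} [Ring B] [HopfAlgebra k B]
variable {V W U : Type u} [AddCommGroup V] [Module k V] [AddCommGroup W] [Module k W]
  [AddCommGroup U] [Module k U]

/-- The bilinear map `(p ⊗ v, q ⊗ w) ↦ s(q, p) w ⊗ v`. -/
noncomputable def contract (s : B →ₗ[k] B →ₗ[k] k) :
    B ⊗[k] V →ₗ[k] B ⊗[k] W →ₗ[k] W ⊗[k] V :=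
  (map₂ s.flip (TensorProduct.mk k W V).flip).compr₂
    (TensorProduct.lid k (W ⊗[k] V)).toLinearMap

@[simp] theorem contract_tmul (s : B →ₗ[k] B →ₗ[k] k) (p q : B) (v : V) (w : W) :
    contract s (p ⊗ₜ[k] v) (q ⊗ₜ[k] w) = s q p • (w ⊗ₜ[k] v) := rfl

/-- The map `v ⊗ w ↦ s(w₍₋₁₎, v₍₋₁₎) w₍₀₎ ⊗ v₍₀₎`. -/
noncomputable def swapBy (s : B →ₗ[k] B →ₗ[k] k) (ρ : V →ₗ[k] B ⊗[k] V) (σ : W →ₗ[k] B ⊗[k] W) :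
    V ⊗[k] W →ₗ[k] W ⊗[k] V :=
  lift ((contract s).compl₁₂ ρ σ)

@[simp] theorem swapBy_tmul (s : B →ₗ[k] B →ₗ[k] k) (ρ : V →ₗ[k] B ⊗[k] V)
    (σ : W →ₗ[k] B ⊗[k] W) (v : V) (w : W) :
    swapBy s ρ σ (v ⊗ₜ[k] w) = contract s (ρ v) (σ w) := rfl

theorem swapBy_map {V' W' : Type u} [AddCommGroup V'] [Module k V'] [AddCommGroup W']
    [Module k W'] (s : B →ₗ[k] B →ₗ[k] k) {ρ : V →ₗ[k] B ⊗[k] V} {σ : W →ₗ[k] B ⊗[k] W}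
    {ρ' : V' →ₗ[k] B ⊗[k] V'} {σ' : W' →ₗ[k] B ⊗[k] W'}
    {f : V →ₗ[k] V'} {g : W →ₗ[k] W'} (hf : ∀ v, f.lTensor B (ρ v) = ρ' (f v))
    (hg : ∀ w, g.lTensor B (σ w) = σ' (g w)) (x : V ⊗[k] W) :
    swapBy s ρ' σ' (map f g x) = map g f (swapBy s ρ σ x) := by
  induction x with
  | zero => simp
  | add x x' hx hx' => simp only [LinearMap.map_add, hx, hx']
  | tmul v w =>
    simp only [swapBy_tmul, map_tmul, ← hf, ← hg]
    generalize ρ v = x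
    generalize σ w = y
    induction x with
    | zero => simp
    | add x x' hx hx' => simp only [LinearMap.map_add, hx, hx', LinearMap.add_apply]
    | tmul p v =>
      induction y with
      | zero => simp
      | add x x' hx hx' => simp only [LinearMap.map_add, hx, hx']
      | tmul q w => simp

theorem swapBy_swapBy (s s' : B →ₗ[k] B →ₗ[k] k)
    (hs : ∀ a b : B, LinearMap.mul' k k (map₂ s s' (comul (R := k) a)
      (comul (R := k) b)) = Coalgebra.counit (R := k) a * Coalgebra.counit (R := k) b)
    {ρ : V →ₗ[k] B ⊗[k] V} {σ : W →ₗ[k] B ⊗[k] W}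
    (hρ : IsLeftCoaction ρ) (hσ : IsLeftCoaction σ) (x : V ⊗[k] W) :
    swapBy s'.flip σ ρ (swapBy s ρ σ x) = x := by
  induction x with
  | zero => simp
  | add x x' hx hx' => simp only [LinearMap.map_add, hx, hx']
  | tmul v w =>
    let G : B ⊗[k] (B ⊗[k] V) →ₗ[k] B ⊗[k] (B ⊗[k] W) →ₗ[k] V ⊗[k] W :=
      (map₂ s.flip (contract s'.flip).flip).compr₂
        (TensorProduct.lid k (V ⊗[k] W)).toLinearMap
    have hG : ∀ p p' q q' v w, G (p ⊗ₜ (p' ⊗ₜ v)) (q ⊗ₜ (q' ⊗ₜ w)) =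
      s q p • s' q' p' • (v ⊗ₜ[k] w) := fun _ _ _ _ _ _ => rfl
    have h1 : ∀ (x : B ⊗[k] V) (y : B ⊗[k] W), swapBy s'.flip σ ρ (contract s x y) =
        G (ρ.lTensor B x) (σ.lTensor B y) := by
      intro x y
      induction x with
      | zero => simp
      | add x x' hx hx' => simp only [LinearMap.map_add, hx, hx', LinearMap.add_apply]
      | tmul p v =>
        induction y with
        | zero => simp
        | add x x' hx hx' => simp only [LinearMap.map_add, hx, hx']
        | tmul q w =>
          simp only [contract_tmul, map_smul, swapBy_tmul, lTensor_tmul]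
          rfl
    have h2 : ∀ (x : B ⊗[k] V) (y : B ⊗[k] W),
        G (TensorProduct.assoc k B B V (comul.rTensor V x))
          (TensorProduct.assoc k B B W (comul.rTensor W y)) =
        TensorProduct.lid k (V ⊗[k] W)
          (map₂ (LinearMap.mul k k) (TensorProduct.mk k V W)
            (Coalgebra.counit.rTensor V x) (Coalgebra.counit.rTensor W y)) := by
      intro x y
      induction x with
      | zero => simp
      | add x x' hx hx' => simp only [LinearMap.map_add, LinearEquiv.map_add, hx, hx', LinearMap.add_apply]
      | tmul p v =>
        induction y with
        | zero => simp
        | add x x' hx hx' => simp only [LinearMap.map_add, LinearEquiv.map_add, hx, hx']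
        | tmul q w =>
          have h3 : ∀ (P Q : B ⊗[k] B), G (TensorProduct.assoc k B B V (P ⊗ₜ v))
              (TensorProduct.assoc k B B W (Q ⊗ₜ w)) =
              LinearMap.mul' k k (map₂ s s' Q P) • (v ⊗ₜ[k] w) := by
            intro P Q
            induction P with
            | zero => simp
            | add x x' hx hx' =>
              simp only [LinearMap.map_add, LinearEquiv.map_add, hx, hx', LinearMap.add_apply, add_tmul, add_smul]
            | tmul p p' =>
              induction Q with
              | zero => simp
              | add x x' hx hx' =>
                simp only [LinearMap.map_add, LinearEquiv.map_add, hx, hx', LinearMap.add_apply, add_tmul, add_smul]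
              | tmul q q' => simp [hG, mul_smul]
          simp only [rTensor_tmul, h3, hs]
          simp [mul_comm]
    rw [swapBy_tmul, h1, ← hρ.coassoc, ← hσ.coassoc, h2, hρ.counit, hσ.counit]
    simp

namespace CoquasiTriangular

variable (r : CoquasiTriangular k B)

/-- The braiding `v ⊗ w ↦ r(w₍₋₁₎, v₍₋₁₎) w₍₀₎ ⊗ v₍₀₎`. -/
noncomputable def braid {ρ : V →ₗ[k] B ⊗[k] V} {σ : W →ₗ[k] B ⊗[k] W}
    (hρ : IsLeftCoaction ρ) (hσ : IsLeftCoaction σ) : V ⊗[k] W ≃ₗ[k] W ⊗[k] V :=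
  { swapBy r.r ρ σ with
    invFun := swapBy r.rinv.flip σ ρ
    left_inv := fun x => swapBy_swapBy r.r r.rinv r.r_rinv hρ hσ x
    right_inv := fun x => by
      refine swapBy_swapBy r.rinv.flip r.r.flip (fun a b => ?_) hσ hρ x
      rw [mul_comm, ← r.rinv_r]
      generalize (comul (R := k) a) = P
      generalize (comul (R := k) b) = Q
      induction P with
      | zero => simp
      | add x x' hx hx' => simp only [LinearMap.map_add, hx, hx', LinearMap.add_apply]
      | tmul p p' =>
        induction Q with
        | zero => simp
        | add x x' hx hx' => simp only [LinearMap.map_add, hx, hx', LinearMap.add_apply]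
        | tmul q q' => simp }

theorem braid_coact (ρ : V →ₗ[k] B ⊗[k] V) (σ : W →ₗ[k] B ⊗[k] W)
    (hρ : IsLeftCoaction ρ) (hσ : IsLeftCoaction σ) (x : V ⊗[k] W) :
    (swapBy r.r ρ σ).lTensor B (tensorCoact ρ σ x) = tensorCoact σ ρ (swapBy r.r ρ σ x) := by
  induction x with
  | zero => simp
  | add x x' hx hx' => simp only [LinearMap.map_add, hx, hx']
  | tmul v w =>
    let G₁ : B ⊗[k] (B ⊗[k] V) →ₗ[k] B ⊗[k] (B ⊗[k] W) →ₗ[k] B ⊗[k] (W ⊗[k] V) :=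
      (map₂ r.r.flip mulCo.flip).compr₂
        (TensorProduct.lid k (B ⊗[k] (W ⊗[k] V))).toLinearMap
    let G₂ : B ⊗[k] (B ⊗[k] V) →ₗ[k] B ⊗[k] (B ⊗[k] W) →ₗ[k] B ⊗[k] (W ⊗[k] V) :=
      map₂ (LinearMap.mul k B) (contract r.r)
    have hG₁ : ∀ p p' q q' v w, G₁ (p ⊗ₜ (p' ⊗ₜ v)) (q ⊗ₜ (q' ⊗ₜ w)) =
      r.r q p • ((q' * p') ⊗ₜ[k] (w ⊗ₜ[k] v)) := fun _ _ _ _ _ _ => rfl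
    have hG₂ : ∀ p p' q q' v w, G₂ (p ⊗ₜ (p' ⊗ₜ v)) (q ⊗ₜ (q' ⊗ₜ w)) =
      (p * q) ⊗ₜ[k] (r.r q' p' • (w ⊗ₜ[k] v)) := fun _ _ _ _ _ _ => rfl
    have h1 : ∀ (x : B ⊗[k] V) (y : B ⊗[k] W), tensorCoact σ ρ (contract r.r x y) =
        G₁ (ρ.lTensor B x) (σ.lTensor B y) := by
      intro x y
      induction x with
      | zero => simp
      | add x x' hx hx' => simp only [LinearMap.map_add, hx, hx', LinearMap.add_apply]
      | tmul p v =>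
        induction y with
        | zero => simp
        | add x x' hx hx' => simp only [LinearMap.map_add, hx, hx']
        | tmul q w =>
          simp only [contract_tmul, map_smul, tensorCoact_tmul, lTensor_tmul]
          rfl
    have h2 : ∀ (x : B ⊗[k] V) (y : B ⊗[k] W), (swapBy r.r ρ σ).lTensor B (mulCo x y) =
        G₂ (ρ.lTensor B x) (σ.lTensor B y) := by
      intro x y
      induction x with
      | zero => simp
      | add x x' hx hx' => simp only [LinearMap.map_add, hx, hx', LinearMap.add_apply]
      | tmul p v =>
        induction y with
        | zero => simp
        | add x x' hx hx' => simp only [LinearMap.map_add, hx, hx']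
        | tmul q w => rfl
    have h3 : ∀ (x : B ⊗[k] V) (y : B ⊗[k] W),
        G₁ (TensorProduct.assoc k B B V (comul.rTensor V x))
          (TensorProduct.assoc k B B W (comul.rTensor W y)) =
        G₂ (TensorProduct.assoc k B B V (comul.rTensor V x))
          (TensorProduct.assoc k B B W (comul.rTensor W y)) := by
      intro x y
      induction x with
      | zero => simp
      | add x x' hx hx' => simp only [LinearMap.map_add, LinearEquiv.map_add, hx, hx', LinearMap.add_apply]
      | tmul p v =>
        induction y with
        | zero => simp
        | add x x' hx hx' => simp only [LinearMap.map_add, LinearEquiv.map_add, hx, hx']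
        | tmul q w =>
          have h4 : ∀ (P Q : B ⊗[k] B), G₁ (TensorProduct.assoc k B B V (P ⊗ₜ v))
              (TensorProduct.assoc k B B W (Q ⊗ₜ w)) =
              TensorProduct.lid k B (map₂ r.r (LinearMap.mul k B) Q P) ⊗ₜ[k]
                (w ⊗ₜ[k] v) := by
            intro P Q
            induction P with
            | zero => simp
            | add x x' hx hx' =>
              simp only [LinearMap.map_add, LinearEquiv.map_add, hx, hx', LinearMap.add_apply, add_tmul]
            | tmul p p' =>
              induction Q with
              | zero => simp
              | add x x' hx hx' =>
                simp only [LinearMap.map_add, LinearEquiv.map_add, hx, hx', LinearMap.add_apply, add_tmul]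
              | tmul q q' => simp [hG₁, smul_tmul']
          have h5 : ∀ (P Q : B ⊗[k] B), G₂ (TensorProduct.assoc k B B V (P ⊗ₜ v))
              (TensorProduct.assoc k B B W (Q ⊗ₜ w)) =
              TensorProduct.rid k B (map₂ (LinearMap.mul k B).flip r.r Q P) ⊗ₜ[k]
                (w ⊗ₜ[k] v) := by
            intro P Q
            induction P with
            | zero => simp
            | add x x' hx hx' =>
              simp only [LinearMap.map_add, LinearEquiv.map_add, hx, hx', LinearMap.add_apply, add_tmul]
            | tmul p p' =>
              induction Q with
              | zero => simp
              | add x x' hx hx' =>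
                simp only [LinearMap.map_add, LinearEquiv.map_add, hx, hx', LinearMap.add_apply, add_tmul]
              | tmul q q' => simp [hG₂, smul_tmul]
          simp only [rTensor_tmul, h4, h5, r.comm_mul]
    rw [tensorCoact_tmul, swapBy_tmul, h1, h2, ← hρ.coassoc, ← hσ.coassoc, h3]

theorem hexagon_forward {ρ : V →ₗ[k] B ⊗[k] V} (σ : W →ₗ[k] B ⊗[k] W) (τ : U →ₗ[k] B ⊗[k] U)
    (hρ : IsLeftCoaction ρ) (x : (V ⊗[k] W) ⊗[k] U) :
    TensorProduct.assoc k W U V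
        (swapBy r.r ρ (tensorCoact σ τ) (TensorProduct.assoc k V W U x)) =
      (swapBy r.r ρ τ).lTensor W
        (TensorProduct.assoc k W V U ((swapBy r.r ρ σ).rTensor U x)) := by
  induction x with
  | zero => simp
  | add x x' hx hx' => simp only [LinearMap.map_add, LinearEquiv.map_add, hx, hx']
  | tmul y u =>
    induction y with
    | zero => simp
    | add x x' hx hx' => simp only [LinearMap.map_add, LinearEquiv.map_add, add_tmul, hx, hx']
    | tmul v w =>
      simp only [assoc_tmul, swapBy_tmul, tensorCoact_tmul, rTensor_tmul]
      generalize σ w = y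
      induction y with
      | zero => simp
      | add x x' hx hx' =>
        simp only [LinearMap.map_add, LinearEquiv.map_add, hx, hx', add_tmul, LinearMap.add_apply]
      | tmul q w =>
        let K : B ⊗[k] (B ⊗[k] V) →ₗ[k] B ⊗[k] U →ₗ[k] W ⊗[k] (U ⊗[k] V) :=
          LinearMap.flip ((LinearMap.flip (map₂ (r.r q |>.smulRight
            (LinearMap.id : k →ₗ[k] k) : B →ₗ[k] k →ₗ[k] k)
            (contract r.r : B ⊗[k] V →ₗ[k] B ⊗[k] U →ₗ[k] U ⊗[k] V)) ∘ₗ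
              TensorProduct.mk k k (B ⊗[k] U) 1)) |>.compr₂
            (TensorProduct.mk k W (U ⊗[k] V) w ∘ₗ (TensorProduct.lid k (U ⊗[k] V)).toLinearMap)
        have hK : ∀ p x z, K (p ⊗ₜ x) z = w ⊗ₜ[k] (r.r q p • contract r.r x z) := by
          intro p x z
          simp [K]
        have h1 : ∀ x : B ⊗[k] V, (swapBy r.r ρ τ).lTensor W
            (TensorProduct.assoc k W V U (contract r.r x (q ⊗ₜ[k] w) ⊗ₜ[k] u)) =
            K (ρ.lTensor B x) (τ u) := by
          intro x
          induction x with
          | zero => simp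
          | add x x' hx hx' =>
            simp only [LinearMap.map_add, LinearEquiv.map_add, hx, hx', add_tmul, LinearMap.add_apply]
          | tmul p v => simp [hK, ← smul_tmul']
        have h2 : ∀ (x : B ⊗[k] V) (z : B ⊗[k] U), TensorProduct.assoc k W U V
            (contract r.r x (mulCo (q ⊗ₜ[k] w) z)) =
            K (TensorProduct.assoc k B B V (comul.rTensor V x)) z := by
          intro x z
          induction x with
          | zero => simp
          | add x x' hx hx' => simp only [LinearMap.map_add, LinearEquiv.map_add, hx, hx', LinearMap.add_apply]
          | tmul p v =>
            induction z with
            | zero => simp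
            | add x x' hx hx' => simp only [LinearMap.map_add, LinearEquiv.map_add, hx, hx']
            | tmul s u =>
              have h3 : ∀ P : B ⊗[k] B, K (TensorProduct.assoc k B B V (P ⊗ₜ v)) (s ⊗ₜ u) =
                  LinearMap.mul' k k (map (r.r q) (r.r s) P) •
                    (w ⊗ₜ[k] (u ⊗ₜ[k] v)) := by
                intro P
                induction P with
                | zero => simp
                | add x x' hx hx' =>
                  simp only [LinearMap.map_add, LinearEquiv.map_add, hx, hx', LinearMap.add_apply, add_tmul, add_smul]
                | tmul p p' => simp [hK, mul_smul]
              rw [rTensor_tmul, h3, ← r.mul_left]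
              simp
        rw [h1, ← hρ.coassoc, h2]

theorem hexagon_reverse (ρ : V →ₗ[k] B ⊗[k] V) (σ : W →ₗ[k] B ⊗[k] W) {τ : U →ₗ[k] B ⊗[k] U}
    (hτ : IsLeftCoaction τ) (x : V ⊗[k] (W ⊗[k] U)) :
    (TensorProduct.assoc k U V W).symm
        (swapBy r.r (tensorCoact ρ σ) τ ((TensorProduct.assoc k V W U).symm x)) =
      (swapBy r.r ρ τ).rTensor W
        ((TensorProduct.assoc k V U W).symm ((swapBy r.r σ τ).lTensor V x)) := by
  induction x with
  | zero => simp
  | add x x' hx hx' => simp only [LinearMap.map_add, LinearEquiv.map_add, hx, hx']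
  | tmul v y =>
    induction y with
    | zero => simp
    | add x x' hx hx' => simp only [LinearMap.map_add, LinearEquiv.map_add, tmul_add, hx, hx']
    | tmul w u =>
      simp only [assoc_symm_tmul, swapBy_tmul, tensorCoact_tmul,
        lTensor_tmul]
      generalize σ w = y
      induction y with
      | zero => simp
      | add x x' hx hx' =>
        simp only [LinearMap.map_add, LinearEquiv.map_add, hx, hx', tmul_add, LinearMap.add_apply]
      | tmul q w =>
        let K : B ⊗[k] (B ⊗[k] U) →ₗ[k] B ⊗[k] V →ₗ[k] (U ⊗[k] V) ⊗[k] W :=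
          LinearMap.flip ((LinearMap.flip (map₂ (r.r.flip q |>.smulRight
            (LinearMap.id : k →ₗ[k] k) : B →ₗ[k] k →ₗ[k] k)
            (contract r.r : B ⊗[k] V →ₗ[k] B ⊗[k] U →ₗ[k] U ⊗[k] V).flip) ∘ₗ
              TensorProduct.mk k k (B ⊗[k] V) 1)) |>.compr₂
            ((TensorProduct.mk k (U ⊗[k] V) W).flip w ∘ₗ
              (TensorProduct.lid k (U ⊗[k] V)).toLinearMap)
        have hK : ∀ s z x, K (s ⊗ₜ z) x = (r.r s q • contract r.r x z) ⊗ₜ[k] w := by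
          intro p x z
          simp [K, smul_tmul']
        have h1 : ∀ z : B ⊗[k] U, (swapBy r.r ρ τ).rTensor W
            ((TensorProduct.assoc k V U W).symm (v ⊗ₜ[k] contract r.r (q ⊗ₜ[k] w) z)) =
            K (τ.lTensor B z) (ρ v) := by
          intro x
          induction x with
          | zero => simp
          | add x x' hx hx' =>
            simp only [LinearMap.map_add, LinearEquiv.map_add, hx, hx', tmul_add, LinearMap.add_apply]
          | tmul p v => simp [hK, smul_tmul']
        have h2 : ∀ (z : B ⊗[k] U) (x : B ⊗[k] V), (TensorProduct.assoc k U V W).symm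
            (contract r.r (mulCo x (q ⊗ₜ[k] w)) z) =
            K (TensorProduct.assoc k B B U (comul.rTensor U z)) x := by
          intro z x
          induction z with
          | zero => simp
          | add x x' hx hx' => simp only [LinearMap.map_add, LinearEquiv.map_add, hx, hx', LinearMap.add_apply]
          | tmul s u =>
            induction x with
            | zero => simp
            | add x x' hx hx' => simp only [LinearMap.map_add, LinearEquiv.map_add, hx, hx', LinearMap.add_apply]
            | tmul p v =>
              have h3 : ∀ P : B ⊗[k] B, K (TensorProduct.assoc k B B U (P ⊗ₜ u)) (p ⊗ₜ v) =
                  LinearMap.mul' k k (map (r.r.flip q) (r.r.flip p) P) •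
                    ((u ⊗ₜ[k] v) ⊗ₜ[k] w) := by
                intro P
                induction P with
                | zero => simp
                | add x x' hx hx' =>
                  simp only [LinearMap.map_add, LinearEquiv.map_add, hx, hx', LinearMap.add_apply, add_tmul, add_smul]
                | tmul p p' => simp [hK, mul_smul, smul_tmul']
              rw [rTensor_tmul, h3, ← r.mul_right]
              simp
        rw [h1, ← hτ.coassoc, h2]

end CoquasiTriangular
end Coquasi
end BraidedDuality

namespace BraidedDuality

universe u v

section YetterDrinfeld
open scoped TensorProduct
open TensorProduct Coalgebra LinearMap
attribute [local simp] LinearMap.map_zero LinearEquiv.map_zero LinearMap.map_add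
  LinearEquiv.map_add LinearMap.map_smul LinearEquiv.map_smul

variable {k : Type u} [Field k] {B : Type v} [Ring B] [HopfAlgebra k B]
variable {V W U : Type u} [AddCommGroup V] [Module k V] [AddCommGroup W] [Module k W]
  [AddCommGroup U] [Module k U]

/-- For `z = h₁ ⊗ h₂` this is `(h₁ v)₍₋₁₎ h₂ ⊗ (h₁ v)₍₀₎`. -/
noncomputable def ydLeft (a : B →ₐ[k] Module.End k V) (ρ : V →ₗ[k] B ⊗[k] V) (v : V) :
    B ⊗[k] B →ₗ[k] B ⊗[k] V :=
  (LinearMap.mul' k B).rTensor V ∘ₗ (rightComm k B V B).toLinearMap ∘ₗ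
    (ρ ∘ₗ a.toLinearMap.flip v).rTensor B

/-- The left-left Yetter-Drinfeld condition
`h₁ v₍₋₁₎ ⊗ h₂ v₍₀₎ = (h₁ v)₍₋₁₎ h₂ ⊗ (h₁ v)₍₀₎`. -/
def IsYDLeftLeft (a : B →ₐ[k] Module.End k V) (ρ : V →ₗ[k] B ⊗[k] V) : Prop :=
  ∀ (h : B) (v : V),
    map₂ (LinearMap.mul k B) a.toLinearMap (comul (R := k) h) (ρ v) =
      ydLeft a ρ v (comul (R := k) h)

theorem isYDLeftLeft_triv : IsYDLeftLeft (trivAct k B) (trivCoact k B) := by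
  intro h c
  have h1 : ∀ z : B ⊗[k] B, map₂ (LinearMap.mul k B) (trivAct k B).toLinearMap z
      (trivCoact k B c) = TensorProduct.comm k k B (c • TensorProduct.comm k B k
        (Coalgebra.counit.lTensor B z)) := by
    intro z
    induction z with
    | zero => simp
    | add x x' hx hx' => simp only [LinearMap.map_add, LinearEquiv.map_add, hx, hx', LinearMap.add_apply, smul_add]
    | tmul p q => simp [trivAct_apply, smul_tmul', mul_comm]
  have h2 : ∀ z : B ⊗[k] B, ydLeft (trivAct k B) (trivCoact k B) c z =
      TensorProduct.comm k k B (c • Coalgebra.counit.rTensor B z) := by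
    intro z
    induction z with
    | zero => simp
    | add x x' hx hx' => simp only [LinearMap.map_add, LinearEquiv.map_add, hx, hx', smul_add]
    | tmul p q => simp [ydLeft, trivAct_apply, smul_tmul', mul_comm]
  rw [h1, h2, Coalgebra.lTensor_counit_comul, Coalgebra.rTensor_counit_comul]
  simp

theorem IsYDLeftLeft.tensor {a : B →ₐ[k] Module.End k V} {ρ : V →ₗ[k] B ⊗[k] V}
    {b : B →ₐ[k] Module.End k W} {σ : W →ₗ[k] B ⊗[k] W}
    (ha : IsYDLeftLeft a ρ) (hb : IsYDLeftLeft b σ) :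
    IsYDLeftLeft (tensorAct a b) (tensorCoact ρ σ) := by
  intro h x
  induction x with
  | zero => simp [ydLeft]
  | add x x' hx hx' =>
    rw [map_add, map_add, hx, hx', ydLeft, ydLeft, ydLeft, map_add, LinearMap.comp_add,
      LinearMap.rTensor_add, LinearMap.comp_add, LinearMap.comp_add]
    rfl
  | tmul v w =>
    let P : B ⊗[k] W →ₗ[k] B →ₗ[k] B ⊗[k] W :=
      (LinearMap.lTensorHom B ∘ₗ b.toLinearMap).flip
    have hP : ∀ y h, P y h = (b h).lTensor B y := fun _ _ => rfl
    let M : B ⊗[k] V →ₗ[k] B ⊗[k] B →ₗ[k] B ⊗[k] V :=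
      (map₂ (LinearMap.mul k B) a.toLinearMap).flip
    let N : B ⊗[k] W →ₗ[k] B ⊗[k] B →ₗ[k] B ⊗[k] W :=
      (map₂ (LinearMap.mul k B) b.toLinearMap).flip
    let F₁ (x : B ⊗[k] V) (y : B ⊗[k] W) : (B ⊗[k] B) ⊗[k] B →ₗ[k] B ⊗[k] (V ⊗[k] W) :=
      lift (mulCo.compl₁₂ (M x) (P y))
    have hF₁ : ∀ x y z h, F₁ x y (z ⊗ₜ h) = mulCo (M x z) (P y h) := fun _ _ _ _ => rfl
    let F₂ (y : B ⊗[k] W) : (B ⊗[k] B) ⊗[k] B →ₗ[k] B ⊗[k] (V ⊗[k] W) :=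
      lift (mulCo.compl₁₂ (ydLeft a ρ v) (P y))
    have hF₂ : ∀ y z h, F₂ y (z ⊗ₜ h) = mulCo (ydLeft a ρ v z) (P y h) := fun _ _ _ => rfl
    let G₂ (y : B ⊗[k] W) : B ⊗[k] (B ⊗[k] B) →ₗ[k] B ⊗[k] (V ⊗[k] W) :=
      lift (mulCo.compl₁₂ (ρ ∘ₗ a.toLinearMap.flip v) (N y))
    have hG₂ : ∀ y z h, G₂ y (h ⊗ₜ z) = mulCo (ρ (a h v)) (N y z) := fun _ _ _ => rfl
    let G₃ : B ⊗[k] (B ⊗[k] B) →ₗ[k] B ⊗[k] (V ⊗[k] W) :=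
      lift (mulCo.compl₁₂ (ρ ∘ₗ a.toLinearMap.flip v) (ydLeft b σ w))
    have hG₃ : ∀ z h, G₃ (h ⊗ₜ z) = mulCo (ρ (a h v)) (ydLeft b σ w z) := fun _ _ => rfl
    have stepA : ∀ (x : B ⊗[k] V) (y : B ⊗[k] W) (t : B ⊗[k] B),
        map₂ (LinearMap.mul k B) (tensorAct a b).toLinearMap t (mulCo x y) =
        F₁ x y ((TensorProduct.assoc k B B B).symm (comul.lTensor B t)) := by
      intro x y t
      induction t with
      | zero => simp
      | add x x' hx hx' => simp only [LinearMap.map_add, LinearEquiv.map_add, hx, hx', LinearMap.add_apply]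
      | tmul r s =>
        simp only [map₂_apply_tmul, lTensor_tmul, AlgHom.toLinearMap_apply,
          tensorAct_apply]
        generalize (comul (R := k) s) = z
        induction z with
        | zero => simp
        | add x x' hx hx' =>
          simp only [map_add, hx, hx', LinearMap.add_apply, tmul_add,
            map_add_right]
        | tmul s s' =>
          rw [assoc_symm_tmul, hF₁, hP]
          simp only [M, LinearMap.flip_apply, map₂_apply_tmul]
          induction x with
          | zero => simp
          | add x x' hx hx' => simp only [LinearMap.map_add, hx, hx', LinearMap.add_apply]
          | tmul p v =>
            induction y with
            | zero => simp
            | add x x' hx hx' => simp only [LinearMap.map_add, hx, hx']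
            | tmul q w => simp [mul_assoc]
    have stepB : ∀ (y : B ⊗[k] W) (t : B ⊗[k] B), F₁ (ρ v) y (comul.rTensor B t) =
        F₂ y (comul.rTensor B t) := by
      intro y t
      induction t with
      | zero => simp
      | add x x' hx hx' => simp only [LinearMap.map_add, hx, hx']
      | tmul r s =>
        rw [rTensor_tmul, hF₁, hF₂, ← ha]
        rfl
    have stepC : ∀ (y : B ⊗[k] W) (s : (B ⊗[k] B) ⊗[k] B), F₂ y s =
        G₂ y (TensorProduct.assoc k B B B s) := by
      intro y s
      induction s with
      | zero => simp
      | add x x' hx hx' => simp only [LinearMap.map_add, LinearEquiv.map_add, hx, hx']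
      | tmul z h₃ =>
        induction z with
        | zero => simp
        | add x x' hx hx' => simp only [LinearMap.map_add, LinearEquiv.map_add, hx, hx', add_tmul]
        | tmul h₁ h₂ =>
          rw [assoc_tmul, hF₂, hG₂]
          simp only [ydLeft, comp_apply, rTensor_tmul, LinearMap.flip_apply,
            AlgHom.toLinearMap_apply, N, map₂_apply_tmul, hP]
          generalize ρ (a h₁ v) = x
          induction x with
          | zero => simp
          | add x x' hx hx' =>
            simp only [LinearMap.map_add, hx, hx', add_tmul, LinearMap.add_apply]
          | tmul p v =>
            induction y with
            | zero => simp
            | add x x' hx hx' => simp only [LinearMap.map_add, hx, hx']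
            | tmul q w => simp [mul_assoc]
    have stepD : ∀ t : B ⊗[k] B, G₂ (σ w) (comul.lTensor B t) =
        G₃ (comul.lTensor B t) := by
      intro t
      induction t with
      | zero => simp
      | add x x' hx hx' => simp only [LinearMap.map_add, hx, hx']
      | tmul r s =>
        rw [lTensor_tmul, hG₂, hG₃, ← hb]
        rfl
    have stepE : ∀ t : B ⊗[k] B,
        G₃ (TensorProduct.assoc k B B B (comul.rTensor B t)) =
        ydLeft (tensorAct a b) (tensorCoact ρ σ) (v ⊗ₜ w) t := by
      intro t
      induction t with
      | zero => simp
      | add x x' hx hx' => simp only [LinearMap.map_add, LinearEquiv.map_add, hx, hx']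
      | tmul r s =>
        simp only [rTensor_tmul, ydLeft, comp_apply, LinearMap.flip_apply,
            AlgHom.toLinearMap_apply, tensorAct_apply]
        generalize (comul (R := k) r) = z
        induction z with
        | zero => simp
        | add x x' hx hx' =>
          simp only [map_add, hx, hx', LinearMap.add_apply, add_tmul]
        | tmul h₁ h₂ =>
          rw [assoc_tmul, hG₃, twoAct_tmul, map_tmul, tensorCoact_tmul]
          simp only [ydLeft, comp_apply, rTensor_tmul, LinearMap.flip_apply,
            AlgHom.toLinearMap_apply]
          generalize ρ (a h₁ v) = x
          generalize σ (b h₂ w) = y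
          induction x with
          | zero => simp
          | add x x' hx hx' =>
            simp only [LinearMap.map_add, hx, hx', add_tmul, LinearMap.add_apply]
          | tmul p v =>
            induction y with
            | zero => simp
            | add x x' hx hx' => simp only [LinearMap.map_add, hx, hx', add_tmul]
            | tmul q w => simp [mul_assoc]
    have co := Coalgebra.coassoc_apply (R := k) h
    have co' := co
    rw [← LinearEquiv.eq_symm_apply] at co'
    rw [tensorCoact_tmul, stepA, ← co', stepB, stepC, co, stepD, ← co, stepE]

/-- The map `v ⊗ w ↦ f(v₍₋₁₎) w ⊗ v₍₀₎`. -/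
noncomputable def actSwap (f : B →ₗ[k] Module.End k W) (ρ : V →ₗ[k] B ⊗[k] V) :
    V ⊗[k] W →ₗ[k] W ⊗[k] V :=
  (lift f).rTensor V ∘ₗ (rightComm k B V W).toLinearMap ∘ₗ
    ρ.rTensor W

theorem actSwap_tmul (f : B →ₗ[k] Module.End k W) (ρ : V →ₗ[k] B ⊗[k] V) (v : V) (w : W) :
    actSwap f ρ (v ⊗ₜ w) = (f.flip w).rTensor V (ρ v) := by
  simp only [actSwap, comp_apply, rTensor_tmul]
  generalize ρ v = x
  induction x with
  | zero => simp
  | add x x' hx hx' => simp only [LinearMap.map_add, hx, hx', add_tmul]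
  | tmul p v => simp

theorem actSwap_actSwap (f g : B →ₗ[k] Module.End k W)
    (hfg : ∀ (h : B) (w : W), lift (f.flip ∘ₗ g.flip w)
      (comul (R := k) h) = Coalgebra.counit (R := k) h • w)
    {ρ : V →ₗ[k] B ⊗[k] V} (hρ : IsLeftCoaction ρ) (x : V ⊗[k] W) :
    actSwap f ρ (TensorProduct.comm k W V (actSwap g ρ x)) = TensorProduct.comm k V W x := by
  induction x with
  | zero => simp
  | add x x' hx hx' => simp only [LinearMap.map_add, LinearEquiv.map_add, hx, hx']
  | tmul v w =>
    let K : B ⊗[k] (B ⊗[k] V) →ₗ[k] W ⊗[k] V :=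
      (lift (f.flip ∘ₗ g.flip w)).rTensor V ∘ₗ
        (TensorProduct.assoc k B B V).symm.toLinearMap
    have h1 : ∀ x : B ⊗[k] V, actSwap f ρ (TensorProduct.comm k W V
        ((g.flip w).rTensor V x)) = K (ρ.lTensor B x) := by
      intro x
      induction x with
      | zero => simp
      | add x x' hx hx' => simp only [LinearMap.map_add, LinearEquiv.map_add, hx, hx']
      | tmul p v =>
        simp only [rTensor_tmul, comm_tmul, actSwap_tmul,
          lTensor_tmul]
        generalize ρ v = y
        induction y with
        | zero => simp
        | add x x' hx hx' => simp only [LinearMap.map_add, hx, hx', tmul_add]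
        | tmul q v => simp [K]
    have h2 : ∀ x : B ⊗[k] V, K (TensorProduct.assoc k B B V (comul.rTensor V x)) =
        TensorProduct.comm k V W (TensorProduct.lid k V (Coalgebra.counit.rTensor V x) ⊗ₜ w) := by
      intro x
      induction x with
      | zero => simp
      | add x x' hx hx' => simp only [LinearMap.map_add, LinearEquiv.map_add, hx, hx', add_tmul]
      | tmul p v =>
        simp only [rTensor_tmul, K, comp_apply, LinearEquiv.coe_coe,
          LinearEquiv.symm_apply_apply, hfg]
        simp [smul_tmul]
    rw [actSwap_tmul, h1, ← hρ.coassoc, h2, hρ.counit]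
    simp

/-- The map `v ⊗ w ↦ v₍₋₁₎ w ⊗ v₍₀₎`. -/
noncomputable def ydSwap (b : B →ₐ[k] Module.End k W) (ρ : V →ₗ[k] B ⊗[k] V) :
    V ⊗[k] W →ₗ[k] W ⊗[k] V := actSwap b.toLinearMap ρ

theorem ydSwap_tmul (b : B →ₐ[k] Module.End k W) (ρ : V →ₗ[k] B ⊗[k] V) (v : V) (w : W) :
    ydSwap b ρ (v ⊗ₜ w) = (b.toLinearMap.flip w).rTensor V (ρ v) := actSwap_tmul _ _ _ _

/-- The inverse of a bijective antipode. -/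
noncomputable def antipodeInv (hS : Function.Bijective (HopfAlgebra.antipode k (A := B))) :
    B →ₗ[k] B :=
  (LinearEquiv.ofBijective (HopfAlgebra.antipode k (A := B)) hS).symm.toLinearMap

theorem antipode_antipodeInv (hS : Function.Bijective (HopfAlgebra.antipode k (A := B))) (h : B) :
    HopfAlgebra.antipode k (antipodeInv hS h) = h :=
  (LinearEquiv.ofBijective (HopfAlgebra.antipode k (A := B)) hS).apply_symm_apply h

theorem antipode_algebraMap (c : k) :
    HopfAlgebra.antipode k (algebraMap k B c) = algebraMap k B c := by
  rw [Algebra.algebraMap_eq_smul_one, map_smul, HopfAlgebra.antipode_one]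

theorem mul_antipodeInv (hS : Function.Bijective (HopfAlgebra.antipode k (A := B))) (h : B) :
    LinearMap.mul' k B ((antipodeInv hS).lTensor B
      (TensorProduct.comm k B B (comul (R := k) h))) =
      algebraMap k B (Coalgebra.counit (R := k) h) := by
  apply hS.injective
  have h1 : ∀ z : B ⊗[k] B, HopfAlgebra.antipode k (LinearMap.mul' k B
      ((antipodeInv hS).lTensor B (TensorProduct.comm k B B z))) =
      LinearMap.mul' k B ((HopfAlgebra.antipode k).lTensor B z) := by
    intro z
    induction z with
    | zero => simp
    | add x x' hx hx' => simp only [LinearMap.map_add, LinearEquiv.map_add, hx, hx']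
    | tmul p q => simp [HopfAlgebra.antipode_mul_antidistrib, antipode_antipodeInv]
  rw [h1, antipode_algebraMap, HopfAlgebra.mul_antipode_lTensor_comul_apply]

theorem antipodeInv_mul (hS : Function.Bijective (HopfAlgebra.antipode k (A := B))) (h : B) :
    LinearMap.mul' k B ((antipodeInv hS).rTensor B
      (TensorProduct.comm k B B (comul (R := k) h))) =
      algebraMap k B (Coalgebra.counit (R := k) h) := by
  apply hS.injective
  have h1 : ∀ z : B ⊗[k] B, HopfAlgebra.antipode k (LinearMap.mul' k B
      ((antipodeInv hS).rTensor B (TensorProduct.comm k B B z))) =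
      LinearMap.mul' k B ((HopfAlgebra.antipode k).rTensor B z) := by
    intro z
    induction z with
    | zero => simp
    | add x x' hx hx' => simp only [LinearMap.map_add, LinearEquiv.map_add, hx, hx']
    | tmul p q => simp [HopfAlgebra.antipode_mul_antidistrib, antipode_antipodeInv]
  rw [h1, antipode_algebraMap, HopfAlgebra.mul_antipode_rTensor_comul_apply]

/-- The braiding `v ⊗ w ↦ v₍₋₁₎ w ⊗ v₍₀₎`, with inverse `w ⊗ v ↦ v₍₀₎ ⊗ S⁻¹(v₍₋₁₎) w`. -/
noncomputable def ydBraid (hS : Function.Bijective (HopfAlgebra.antipode k (A := B)))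
    (b : B →ₐ[k] Module.End k W) {ρ : V →ₗ[k] B ⊗[k] V} (hρ : IsLeftCoaction ρ) :
    V ⊗[k] W ≃ₗ[k] W ⊗[k] V :=
  { ydSwap b ρ with
    invFun := fun x => TensorProduct.comm k W V (actSwap (b.toLinearMap ∘ₗ antipodeInv hS) ρ
      (TensorProduct.comm k W V x))
    left_inv := fun x => by
      refine ((TensorProduct.comm k V W).eq_symm_apply.mpr ?_).trans
        ((TensorProduct.comm k V W).symm_apply_apply x)
      refine Eq.trans ?_ (actSwap_actSwap (b.toLinearMap ∘ₗ antipodeInv hS) b.toLinearMap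
        (fun h w => ?_) hρ x)
      · exact (TensorProduct.comm k V W).apply_symm_apply _
      · have h1 : ∀ z : B ⊗[k] B, lift
            ((b.toLinearMap ∘ₗ antipodeInv hS).flip ∘ₗ b.toLinearMap.flip w) z =
            b (LinearMap.mul' k B ((antipodeInv hS).rTensor B (TensorProduct.comm k B B z))) w := by
          intro z
          induction z with
          | zero => simp
          | add x x' hx hx' => simp only [map_add, hx, hx', LinearMap.add_apply]
          | tmul p q => simp
        rw [h1, antipodeInv_mul]
        simp [Module.algebraMap_end_apply]
    right_inv := fun x => by
      refine Eq.trans ?_ ((TensorProduct.comm k W V).symm_apply_apply x)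
      refine Eq.trans ?_ (actSwap_actSwap b.toLinearMap (b.toLinearMap ∘ₗ antipodeInv hS)
        (fun h w => ?_) hρ (TensorProduct.comm k W V x))
      · rfl
      · have h1 : ∀ z : B ⊗[k] B, lift
            (b.toLinearMap.flip ∘ₗ (b.toLinearMap ∘ₗ antipodeInv hS).flip w) z =
            b (LinearMap.mul' k B ((antipodeInv hS).lTensor B (TensorProduct.comm k B B z))) w := by
          intro z
          induction z with
          | zero => simp
          | add x x' hx hx' => simp only [map_add, hx, hx', LinearMap.add_apply]
          | tmul p q => simp
        rw [h1, mul_antipodeInv]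
        simp [Module.algebraMap_end_apply] }

theorem ydSwap_map {V' W' : Type u} [AddCommGroup V'] [Module k V'] [AddCommGroup W']
    [Module k W'] {b : B →ₐ[k] Module.End k W} {ρ : V →ₗ[k] B ⊗[k] V}
    {b' : B →ₐ[k] Module.End k W'} {ρ' : V' →ₗ[k] B ⊗[k] V'}
    {f : V →ₗ[k] V'} {g : W →ₗ[k] W'} (hf : ∀ v, f.lTensor B (ρ v) = ρ' (f v))
    (hg : ∀ h w, g (b h w) = b' h (g w)) (x : V ⊗[k] W) :
    ydSwap b' ρ' (map f g x) = map g f (ydSwap b ρ x) := by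
  induction x with
  | zero => simp
  | add x x' hx hx' => simp only [LinearMap.map_add, hx, hx']
  | tmul v w =>
    simp only [ydSwap_tmul, map_tmul, ← hf]
    generalize ρ v = x
    induction x with
    | zero => simp
    | add x x' hx hx' => simp only [LinearMap.map_add, hx, hx']
    | tmul p v => simp [hg]

theorem ydSwap_act {a : B →ₐ[k] Module.End k V} {ρ : V →ₗ[k] B ⊗[k] V}
    (b : B →ₐ[k] Module.End k W) (ha : IsYDLeftLeft a ρ) (h : B) (x : V ⊗[k] W) :
    ydSwap b ρ (tensorAct a b h x) = tensorAct b a h (ydSwap b ρ x) := by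
  induction x with
  | zero => simp
  | add x x' hx hx' => simp only [LinearMap.map_add, hx, hx']
  | tmul v w =>
    have h1 : ∀ z : B ⊗[k] B, ydSwap b ρ (twoAct a b z (v ⊗ₜ w)) =
        (b.toLinearMap.flip w).rTensor V (ydLeft a ρ v z) := by
      intro z
      induction z with
      | zero => simp
      | add x x' hx hx' => simp only [map_add, hx, hx', LinearMap.add_apply]
      | tmul r s =>
        simp only [twoAct_tmul, map_tmul, ydSwap_tmul, ydLeft, comp_apply,
          rTensor_tmul, LinearMap.flip_apply, AlgHom.toLinearMap_apply]
        generalize ρ (a r v) = x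
        induction x with
        | zero => simp
        | add x x' hx hx' => simp only [LinearMap.map_add, hx, hx', add_tmul]
        | tmul p v => simp
    have h2 : ∀ (z : B ⊗[k] B) (x : B ⊗[k] V),
        twoAct b a z ((b.toLinearMap.flip w).rTensor V x) = (b.toLinearMap.flip w).rTensor V
          (map₂ (LinearMap.mul k B) a.toLinearMap z x) := by
      intro z x
      induction z with
      | zero => simp
      | add x x' hx hx' => simp only [map_add, hx, hx', LinearMap.add_apply]
      | tmul r s =>
        induction x with
        | zero => simp
        | add x x' hx hx' => simp only [LinearMap.map_add, hx, hx']
        | tmul p v => simp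
    rw [tensorAct_apply, tensorAct_apply, h1, ydSwap_tmul, h2, ha]

theorem ydSwap_coact {ρ : V →ₗ[k] B ⊗[k] V}
    {b : B →ₐ[k] Module.End k W} {σ : W →ₗ[k] B ⊗[k] W} (hρ : IsLeftCoaction ρ)
    (hb : IsYDLeftLeft b σ) (x : V ⊗[k] W) :
    (ydSwap b ρ).lTensor B (tensorCoact ρ σ x) = tensorCoact σ ρ (ydSwap b ρ x) := by
  induction x with
  | zero => simp
  | add x x' hx hx' => simp only [LinearMap.map_add, hx, hx']
  | tmul v w =>
    let T : B ⊗[k] (B ⊗[k] V) →ₗ[k] B ⊗[k] (W ⊗[k] V) :=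
      (TensorProduct.assoc k B W V).toLinearMap ∘ₗ (ydLeft b σ w).rTensor V ∘ₗ
        (TensorProduct.assoc k B B V).symm.toLinearMap
    have hT : ∀ z v, T (TensorProduct.assoc k B B V (z ⊗ₜ v)) =
        TensorProduct.assoc k B W V (ydLeft b σ w z ⊗ₜ v) := by
      intro z v
      simp [T]
    have h1 : ∀ x : B ⊗[k] V, tensorCoact σ ρ ((b.toLinearMap.flip w).rTensor V x) =
        T (ρ.lTensor B x) := by
      intro x
      induction x with
      | zero => simp
      | add x x' hx hx' => simp only [LinearMap.map_add, hx, hx']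
      | tmul p v =>
        simp only [rTensor_tmul, tensorCoact_tmul, lTensor_tmul,
          LinearMap.flip_apply, AlgHom.toLinearMap_apply]
        generalize ρ v = y
        induction y with
        | zero => simp
        | add x x' hx hx' => simp only [LinearMap.map_add, hx, hx', tmul_add]
        | tmul q v =>
          rw [← assoc_tmul, hT]
          simp only [ydLeft, comp_apply, rTensor_tmul, LinearMap.flip_apply,
            AlgHom.toLinearMap_apply]
          generalize σ (b p w) = y
          induction y with
          | zero => simp
          | add x x' hx hx' =>
            simp only [LinearMap.map_add, LinearEquiv.map_add, hx, hx', add_tmul, LinearMap.add_apply]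
          | tmul r w => simp
    let T' : B ⊗[k] (B ⊗[k] V) →ₗ[k] B ⊗[k] (W ⊗[k] V) :=
      (TensorProduct.assoc k B W V).toLinearMap ∘ₗ
        ((map₂ (LinearMap.mul k B) b.toLinearMap).flip (σ w)).rTensor V ∘ₗ
        (TensorProduct.assoc k B B V).symm.toLinearMap
    have hT' : ∀ z v, T' (TensorProduct.assoc k B B V (z ⊗ₜ v)) = TensorProduct.assoc k B W V
        (map₂ (LinearMap.mul k B) b.toLinearMap z (σ w) ⊗ₜ v) := by
      intro z v
      simp [T']
    have h2 : ∀ x : B ⊗[k] V, (ydSwap b ρ).lTensor B (mulCo x (σ w)) = T' (ρ.lTensor B x) := by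
      intro x
      induction x with
      | zero => simp
      | add x x' hx hx' => simp only [LinearMap.map_add, hx, hx', LinearMap.add_apply]
      | tmul p v =>
        simp only [T', lTensor_tmul, comp_apply]
        generalize σ w = y
        induction y with
        | zero => simp
        | add x x' hx hx' =>
          simp only [LinearMap.map_add, hx, hx', LinearMap.rTensor_add, LinearMap.add_apply]
        | tmul q w =>
          simp only [mulCo_tmul, lTensor_tmul, ydSwap_tmul]
          generalize ρ v = x
          induction x with
          | zero => simp
          | add x x' hx hx' => simp only [LinearMap.map_add, hx, hx', tmul_add]
          | tmul r v => simp
    have h4 : ∀ x : B ⊗[k] V,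
        T (TensorProduct.assoc k B B V (comul.rTensor V x)) =
        T' (TensorProduct.assoc k B B V (comul.rTensor V x)) := by
      intro x
      induction x with
      | zero => simp
      | add x x' hx hx' => simp only [LinearMap.map_add, LinearEquiv.map_add, hx, hx']
      | tmul p v => rw [rTensor_tmul, hT, hT', hb]
    rw [tensorCoact_tmul, ydSwap_tmul, h1, h2, ← hρ.coassoc, h4]

theorem ydSwap_hexagon_forward {ρ : V →ₗ[k] B ⊗[k] V} (hρ : IsLeftCoaction ρ)
    (b : B →ₐ[k] Module.End k W) (c : B →ₐ[k] Module.End k U) (x : (V ⊗[k] W) ⊗[k] U) :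
    TensorProduct.assoc k W U V (ydSwap (tensorAct b c) ρ (TensorProduct.assoc k V W U x)) =
      (ydSwap c ρ).lTensor W (TensorProduct.assoc k W V U ((ydSwap b ρ).rTensor U x)) := by
  induction x with
  | zero => simp
  | add x x' hx hx' => simp only [LinearMap.map_add, LinearEquiv.map_add, hx, hx']
  | tmul y u =>
    induction y with
    | zero => simp
    | add x x' hx hx' => simp only [LinearMap.map_add, LinearEquiv.map_add, add_tmul, hx, hx']
    | tmul v w =>
      let K : B ⊗[k] (B ⊗[k] V) →ₗ[k] W ⊗[k] (U ⊗[k] V) :=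
        map (b.toLinearMap.flip w) ((c.toLinearMap.flip u).rTensor V)
      have h1 : ∀ x : B ⊗[k] V, (ydSwap c ρ).lTensor W (TensorProduct.assoc k W V U
          ((b.toLinearMap.flip w).rTensor V x ⊗ₜ u)) = K (ρ.lTensor B x) := by
        intro x
        induction x with
        | zero => simp
        | add x x' hx hx' => simp only [LinearMap.map_add, LinearEquiv.map_add, hx, hx', add_tmul]
        | tmul p v => simp [K, ydSwap_tmul]
      have h2 : ∀ x : B ⊗[k] V, TensorProduct.assoc k W U V
          (((tensorAct b c).toLinearMap.flip (w ⊗ₜ u)).rTensor V x) =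
          K (TensorProduct.assoc k B B V (comul.rTensor V x)) := by
        intro x
        induction x with
        | zero => simp
        | add x x' hx hx' => simp only [LinearMap.map_add, LinearEquiv.map_add, hx, hx']
        | tmul p v =>
          simp only [rTensor_tmul, LinearMap.flip_apply, AlgHom.toLinearMap_apply,
            tensorAct_apply]
          generalize (comul (R := k) p) = z
          induction z with
          | zero => simp
          | add x x' hx hx' =>
            simp only [map_add, hx, hx', add_tmul, LinearMap.add_apply]
          | tmul p q => simp [K]
      rw [assoc_tmul, ydSwap_tmul, rTensor_tmul, ydSwap_tmul, h1, h2,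
        hρ.coassoc]

theorem ydSwap_hexagon_reverse (ρ : V →ₗ[k] B ⊗[k] V) (σ : W →ₗ[k] B ⊗[k] W)
    (c : B →ₐ[k] Module.End k U) (x : V ⊗[k] (W ⊗[k] U)) :
    (TensorProduct.assoc k U V W).symm
        (ydSwap c (tensorCoact ρ σ) ((TensorProduct.assoc k V W U).symm x)) =
      (ydSwap c ρ).rTensor W
        ((TensorProduct.assoc k V U W).symm ((ydSwap c σ).lTensor V x)) := by
  induction x with
  | zero => simp
  | add x x' hx hx' => simp only [LinearMap.map_add, LinearEquiv.map_add, hx, hx']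
  | tmul v y =>
    induction y with
    | zero => simp
    | add x x' hx hx' => simp only [LinearMap.map_add, LinearEquiv.map_add, tmul_add, hx, hx']
    | tmul w u =>
      simp only [assoc_symm_tmul, ydSwap_tmul, tensorCoact_tmul,
        lTensor_tmul]
      generalize σ w = y
      induction y with
      | zero => simp
      | add x x' hx hx' => simp only [LinearMap.map_add, LinearEquiv.map_add, hx, hx', tmul_add]
      | tmul q w =>
        simp only [rTensor_tmul, assoc_symm_tmul, ydSwap_tmul,
          LinearMap.flip_apply, AlgHom.toLinearMap_apply]
        generalize ρ v = x
        induction x with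
        | zero => simp
        | add x x' hx hx' =>
          simp only [LinearMap.map_add, LinearEquiv.map_add, hx, hx', add_tmul, LinearMap.add_apply]
        | tmul p v => simp

end YetterDrinfeld
end BraidedDuality

namespace BraidedDuality

universe u v

section YetterDrinfeldRight
open scoped TensorProduct
open TensorProduct Coalgebra LinearMap
attribute [local simp] LinearMap.map_zero LinearEquiv.map_zero LinearMap.map_add
  LinearEquiv.map_add LinearMap.map_smul LinearEquiv.map_smul

variable {k : Type u} [Field k] {B : Type v} [Ring B] [HopfAlgebra k B]
variable {V W U : Type u} [AddCommGroup V] [Module k V] [AddCommGroup W] [Module k W]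
  [AddCommGroup U] [Module k U]

/-- For `z = h₁ ⊗ h₂` this is `(h₂ v)₍₀₎ ⊗ (h₂ v)₍₁₎ h₁`. -/
noncomputable def ydRight (a : B →ₐ[k] Module.End k V) (ρ : V →ₗ[k] V ⊗[k] B) (v : V) :
    B ⊗[k] B →ₗ[k] V ⊗[k] B :=
  (LinearMap.mul' k B).lTensor V ∘ₗ (TensorProduct.assoc k V B B).toLinearMap ∘ₗ
    (ρ ∘ₗ a.toLinearMap.flip v).rTensor B ∘ₗ (TensorProduct.comm k B B).toLinearMap

/-- The left-right Yetter-Drinfeld condition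
`h₁ v₍₀₎ ⊗ h₂ v₍₁₎ = (h₂ v)₍₀₎ ⊗ (h₂ v)₍₁₎ h₁`. -/
def IsYDLeftRight (a : B →ₐ[k] Module.End k V) (ρ : V →ₗ[k] V ⊗[k] B) : Prop :=
  ∀ (h : B) (v : V),
    map₂ a.toLinearMap (LinearMap.mul k B) (comul (R := k) h) (ρ v) =
      ydRight a ρ v (comul (R := k) h)

theorem isYDLeftRight_triv : IsYDLeftRight (trivAct k B) (trivCoactR k B) := by
  intro h c
  have h1 : ∀ z : B ⊗[k] B, map₂ (trivAct k B).toLinearMap (LinearMap.mul k B) z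
      (trivCoactR k B c) = c • Coalgebra.counit.rTensor B z := by
    intro z
    induction z with
    | zero => simp
    | add x x' hx hx' => simp only [LinearMap.map_add, hx, hx', LinearMap.add_apply, smul_add]
    | tmul p q => simp [trivAct_apply, smul_tmul', mul_comm]
  have h2 : ∀ z : B ⊗[k] B, ydRight (trivAct k B) (trivCoactR k B) c z =
      c • TensorProduct.comm k B k (Coalgebra.counit.lTensor B z) := by
    intro z
    induction z with
    | zero => simp
    | add x x' hx hx' => simp only [LinearMap.map_add, LinearEquiv.map_add, hx, hx', smul_add]
    | tmul p q => simp [ydRight, trivAct_apply, smul_tmul', mul_comm]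
  rw [h1, h2, Coalgebra.lTensor_counit_comul, Coalgebra.rTensor_counit_comul]
  simp

theorem IsYDLeftRight.tensor {a : B →ₐ[k] Module.End k V} {ρ : V →ₗ[k] V ⊗[k] B}
    {b : B →ₐ[k] Module.End k W} {σ : W →ₗ[k] W ⊗[k] B}
    (ha : IsYDLeftRight a ρ) (hb : IsYDLeftRight b σ) :
    IsYDLeftRight (tensorAct a b) (tensorCoactR ρ σ) := by
  intro h x
  induction x with
  | zero => simp [ydRight]
  | add x x' hx hx' =>
    rw [map_add, map_add, hx, hx', ydRight, ydRight, ydRight, map_add, LinearMap.comp_add,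
      LinearMap.rTensor_add, LinearMap.add_comp, LinearMap.comp_add, LinearMap.comp_add]
    rfl
  | tmul v w =>
    let P : V ⊗[k] B →ₗ[k] B →ₗ[k] V ⊗[k] B :=
      (LinearMap.rTensorHom B ∘ₗ a.toLinearMap).flip
    have hP : ∀ y h, P y h = (a h).rTensor B y := fun _ _ => rfl
    let M : V ⊗[k] B →ₗ[k] B ⊗[k] B →ₗ[k] V ⊗[k] B :=
      (map₂ a.toLinearMap (LinearMap.mul k B)).flip
    let N : W ⊗[k] B →ₗ[k] B ⊗[k] B →ₗ[k] W ⊗[k] B :=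
      (map₂ b.toLinearMap (LinearMap.mul k B)).flip
    let F₁ (x : V ⊗[k] B) (y : W ⊗[k] B) : B ⊗[k] (B ⊗[k] B) →ₗ[k] (V ⊗[k] W) ⊗[k] B :=
      lift (mulCoR.compl₁₂ (P x) (N y))
    have hF₁ : ∀ x y z h, F₁ x y (h ⊗ₜ z) = mulCoR (P x h) (N y z) := fun _ _ _ _ => rfl
    let F₂ (x : V ⊗[k] B) : B ⊗[k] (B ⊗[k] B) →ₗ[k] (V ⊗[k] W) ⊗[k] B :=
      lift (mulCoR.compl₁₂ (P x) (ydRight b σ w))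
    have hF₂ : ∀ x z h, F₂ x (h ⊗ₜ z) = mulCoR (P x h) (ydRight b σ w z) := fun _ _ _ => rfl
    let G₂ (x : V ⊗[k] B) : (B ⊗[k] B) ⊗[k] B →ₗ[k] (V ⊗[k] W) ⊗[k] B :=
      lift (mulCoR.compl₁₂ (M x) (σ ∘ₗ b.toLinearMap.flip w))
    have hG₂ : ∀ x z h, G₂ x (z ⊗ₜ h) = mulCoR (M x z) (σ (b h w)) := fun _ _ _ => rfl
    let G₃ : (B ⊗[k] B) ⊗[k] B →ₗ[k] (V ⊗[k] W) ⊗[k] B :=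
      lift (mulCoR.compl₁₂ (ydRight a ρ v) (σ ∘ₗ b.toLinearMap.flip w))
    have hG₃ : ∀ z h, G₃ (z ⊗ₜ h) = mulCoR (ydRight a ρ v z) (σ (b h w)) := fun _ _ => rfl
    have stepA : ∀ (x : V ⊗[k] B) (y : W ⊗[k] B) (t : B ⊗[k] B),
        map₂ (tensorAct a b).toLinearMap (LinearMap.mul k B) t (mulCoR x y) =
        F₁ x y (TensorProduct.assoc k B B B (comul.rTensor B t)) := by
      intro x y t
      induction t with
      | zero => simp
      | add x x' hx hx' => simp only [LinearMap.map_add, LinearEquiv.map_add, hx, hx', LinearMap.add_apply]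
      | tmul r s =>
        simp only [map₂_apply_tmul, rTensor_tmul, AlgHom.toLinearMap_apply,
          tensorAct_apply]
        generalize (comul (R := k) r) = z
        induction z with
        | zero => simp
        | add x x' hx hx' =>
          simp only [map_add, hx, hx', LinearMap.add_apply, add_tmul,
            map_add_left]
        | tmul r r' =>
          rw [assoc_tmul, hF₁, hP]
          simp only [N, LinearMap.flip_apply, map₂_apply_tmul]
          induction x with
          | zero => simp
          | add x x' hx hx' => simp only [LinearMap.map_add, hx, hx', LinearMap.add_apply]
          | tmul p v =>
            induction y with
            | zero => simp
            | add x x' hx hx' => simp only [LinearMap.map_add, hx, hx']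
            | tmul q w => simp [mul_assoc]
    have stepB : ∀ (x : V ⊗[k] B) (t : B ⊗[k] B), F₁ x (σ w) (comul.lTensor B t) =
        F₂ x (comul.lTensor B t) := by
      intro y t
      induction t with
      | zero => simp
      | add x x' hx hx' => simp only [LinearMap.map_add, hx, hx']
      | tmul r s =>
        rw [lTensor_tmul, hF₁, hF₂, ← hb]
        rfl
    have stepC : ∀ (x : V ⊗[k] B) (s : (B ⊗[k] B) ⊗[k] B),
        F₂ x (TensorProduct.assoc k B B B s) = G₂ x s := by
      intro x s
      induction s with
      | zero => simp
      | add x x' hx hx' => simp only [LinearMap.map_add, LinearEquiv.map_add, hx, hx']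
      | tmul z h₃ =>
        induction z with
        | zero => simp
        | add x x' hx hx' => simp only [LinearMap.map_add, LinearEquiv.map_add, hx, hx', add_tmul]
        | tmul h₁ h₂ =>
          rw [assoc_tmul, hF₂, hG₂]
          simp only [ydRight, comp_apply, LinearEquiv.coe_coe, comm_tmul,
            rTensor_tmul, LinearMap.flip_apply,
            AlgHom.toLinearMap_apply, M, map₂_apply_tmul, hP]
          generalize σ (b h₃ w) = y
          induction y with
          | zero => simp
          | add x x' hx hx' =>
            simp only [LinearMap.map_add, LinearEquiv.map_add, hx, hx', add_tmul]
          | tmul q w =>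
            induction x with
            | zero => simp
            | add x x' hx hx' => simp only [LinearMap.map_add, hx, hx', LinearMap.add_apply]
            | tmul v p => simp [mul_assoc]
    have stepD : ∀ t : B ⊗[k] B, G₂ (ρ v) (comul.rTensor B t) =
        G₃ (comul.rTensor B t) := by
      intro t
      induction t with
      | zero => simp
      | add x x' hx hx' => simp only [LinearMap.map_add, hx, hx']
      | tmul r s =>
        rw [rTensor_tmul, hG₂, hG₃, ← ha]
        rfl
    have stepE : ∀ t : B ⊗[k] B,
        G₃ ((TensorProduct.assoc k B B B).symm (comul.lTensor B t)) =
        ydRight (tensorAct a b) (tensorCoactR ρ σ) (v ⊗ₜ w) t := by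
      intro t
      induction t with
      | zero => simp
      | add x x' hx hx' => simp only [LinearMap.map_add, LinearEquiv.map_add, hx, hx']
      | tmul r s =>
        simp only [lTensor_tmul, rTensor_tmul, ydRight, comp_apply,
          LinearMap.flip_apply, LinearEquiv.coe_coe, comm_tmul,
            AlgHom.toLinearMap_apply, tensorAct_apply]
        generalize (comul (R := k) s) = z
        induction z with
        | zero => simp
        | add x x' hx hx' =>
          simp only [map_add, hx, hx', LinearMap.add_apply, add_tmul,
            tmul_add]
        | tmul h₁ h₂ =>
          rw [assoc_symm_tmul, hG₃, twoAct_tmul, map_tmul,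
            tensorCoactR_tmul]
          simp only [ydRight, comp_apply, rTensor_tmul, LinearMap.flip_apply,
            LinearEquiv.coe_coe, comm_tmul, AlgHom.toLinearMap_apply]
          generalize ρ (a h₁ v) = x
          generalize σ (b h₂ w) = y
          induction x with
          | zero => simp
          | add x x' hx hx' =>
            simp only [LinearMap.map_add, LinearEquiv.map_add, hx, hx', add_tmul, LinearMap.add_apply]
          | tmul p v =>
            induction y with
            | zero => simp
            | add x x' hx hx' => simp only [LinearMap.map_add, LinearEquiv.map_add, hx, hx', add_tmul]
            | tmul q w => simp [mul_assoc]
    have co := Coalgebra.coassoc_apply (R := k) h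
    have co' := co
    rw [← LinearEquiv.eq_symm_apply] at co'
    rw [tensorCoactR_tmul, stepA, co, stepB, ← co, stepC, stepD, co', stepE]

/-- The map `v ⊗ w ↦ w₍₀₎ ⊗ f(w₍₁₎) v`. -/
noncomputable def actSwapR (f : B →ₗ[k] Module.End k V) (σ : W →ₗ[k] W ⊗[k] B) :
    V ⊗[k] W →ₗ[k] W ⊗[k] V :=
  (lift f).lTensor W ∘ₗ (TensorProduct.assoc k W B V).toLinearMap ∘ₗ
    σ.rTensor V ∘ₗ (TensorProduct.comm k V W).toLinearMap

theorem actSwapR_tmul (f : B →ₗ[k] Module.End k V) (σ : W →ₗ[k] W ⊗[k] B) (v : V) (w : W) :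
    actSwapR f σ (v ⊗ₜ w) = (f.flip v).lTensor W (σ w) := by
  simp only [actSwapR, comp_apply, rTensor_tmul, LinearEquiv.coe_coe,
    comm_tmul]
  generalize σ w = x
  induction x with
  | zero => simp
  | add x x' hx hx' => simp only [LinearMap.map_add, LinearEquiv.map_add, hx, hx', add_tmul]
  | tmul p v => simp

theorem actSwapR_actSwapR (f g : B →ₗ[k] Module.End k V)
    (hfg : ∀ (h : B) (v : V), lift (f.flip ∘ₗ g.flip v).flip
      (comul (R := k) h) = Coalgebra.counit (R := k) h • v)
    {σ : W →ₗ[k] W ⊗[k] B} (hσ : IsRightCoaction σ) (x : V ⊗[k] W) :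
    actSwapR f σ (TensorProduct.comm k W V (actSwapR g σ x)) = TensorProduct.comm k V W x := by
  induction x with
  | zero => simp
  | add x x' hx hx' => simp only [LinearMap.map_add, LinearEquiv.map_add, hx, hx']
  | tmul v w =>
    let K : (W ⊗[k] B) ⊗[k] B →ₗ[k] W ⊗[k] V :=
      (lift (f.flip ∘ₗ g.flip v).flip).lTensor W ∘ₗ
        (TensorProduct.assoc k W B B).toLinearMap
    have h1 : ∀ x : W ⊗[k] B, actSwapR f σ (TensorProduct.comm k W V
        ((g.flip v).lTensor W x)) = K (σ.rTensor B x) := by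
      intro x
      induction x with
      | zero => simp
      | add x x' hx hx' => simp only [LinearMap.map_add, LinearEquiv.map_add, hx, hx']
      | tmul w p =>
        simp only [lTensor_tmul, comm_tmul, actSwapR_tmul,
          rTensor_tmul]
        generalize σ w = y
        induction y with
        | zero => simp
        | add x x' hx hx' => simp only [LinearMap.map_add, hx, hx', add_tmul]
        | tmul w q => simp [K]
    have h2 : ∀ x : W ⊗[k] B, K ((TensorProduct.assoc k W B B).symm
        (comul.lTensor W x)) =
        TensorProduct.rid k W (Coalgebra.counit.lTensor W x) ⊗ₜ v := by
      intro x
      induction x with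
      | zero => simp
      | add x x' hx hx' => simp only [LinearMap.map_add, LinearEquiv.map_add, hx, hx', add_tmul]
      | tmul w p =>
        simp only [lTensor_tmul, K, comp_apply, LinearEquiv.coe_coe,
          LinearEquiv.apply_symm_apply, hfg]
        simp [smul_tmul]
    rw [actSwapR_tmul, h1, ← LinearEquiv.symm_apply_apply (TensorProduct.assoc k W B B)
      (σ.rTensor B (σ w)), hσ.coassoc, h2, hσ.counit]
    simp

/-- The map `v ⊗ w ↦ w₍₀₎ ⊗ w₍₁₎ v`. -/
noncomputable def ydSwapR (a : B →ₐ[k] Module.End k V) (σ : W →ₗ[k] W ⊗[k] B) :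
    V ⊗[k] W →ₗ[k] W ⊗[k] V := actSwapR a.toLinearMap σ

theorem ydSwapR_tmul (a : B →ₐ[k] Module.End k V) (σ : W →ₗ[k] W ⊗[k] B) (v : V) (w : W) :
    ydSwapR a σ (v ⊗ₜ w) = (a.toLinearMap.flip v).lTensor W (σ w) := actSwapR_tmul _ _ _ _

/-- The braiding `v ⊗ w ↦ w₍₀₎ ⊗ w₍₁₎ v`, with inverse `w ⊗ v ↦ S(w₍₁₎) v ⊗ w₍₀₎`. -/
noncomputable def ydBraidR (a : B →ₐ[k] Module.End k V) {σ : W →ₗ[k] W ⊗[k] B}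
    (hσ : IsRightCoaction σ) : V ⊗[k] W ≃ₗ[k] W ⊗[k] V :=
  { ydSwapR a σ with
    invFun := fun x => TensorProduct.comm k W V (actSwapR
      (a.toLinearMap ∘ₗ HopfAlgebra.antipode k) σ (TensorProduct.comm k W V x))
    left_inv := fun x => by
      refine ((TensorProduct.comm k V W).eq_symm_apply.mpr ?_).trans
        ((TensorProduct.comm k V W).symm_apply_apply x)
      refine Eq.trans ?_ (actSwapR_actSwapR (a.toLinearMap ∘ₗ HopfAlgebra.antipode k)
        a.toLinearMap (fun h v => ?_) hσ x)
      · exact (TensorProduct.comm k V W).apply_symm_apply _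
      · have h1 : ∀ z : B ⊗[k] B, lift
            ((a.toLinearMap ∘ₗ HopfAlgebra.antipode k).flip ∘ₗ a.toLinearMap.flip v).flip z =
            a (LinearMap.mul' k B ((HopfAlgebra.antipode k).rTensor B z)) v := by
          intro z
          induction z with
          | zero => simp
          | add x x' hx hx' => simp only [map_add, hx, hx', LinearMap.add_apply]
          | tmul p q => simp
        rw [h1, HopfAlgebra.mul_antipode_rTensor_comul_apply]
        simp [Module.algebraMap_end_apply]
    right_inv := fun x => by
      refine Eq.trans ?_ ((TensorProduct.comm k W V).symm_apply_apply x)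
      refine Eq.trans ?_ (actSwapR_actSwapR a.toLinearMap
        (a.toLinearMap ∘ₗ HopfAlgebra.antipode k) (fun h v => ?_) hσ (TensorProduct.comm k W V x))
      · rfl
      · have h1 : ∀ z : B ⊗[k] B, lift
            (a.toLinearMap.flip ∘ₗ (a.toLinearMap ∘ₗ HopfAlgebra.antipode k).flip v).flip z =
            a (LinearMap.mul' k B ((HopfAlgebra.antipode k).lTensor B z)) v := by
          intro z
          induction z with
          | zero => simp
          | add x x' hx hx' => simp only [map_add, hx, hx', LinearMap.add_apply]
          | tmul p q => simp
        rw [h1, HopfAlgebra.mul_antipode_lTensor_comul_apply]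
        simp [Module.algebraMap_end_apply] }

theorem ydSwapR_map {V' W' : Type u} [AddCommGroup V'] [Module k V'] [AddCommGroup W']
    [Module k W'] {a : B →ₐ[k] Module.End k V} {σ : W →ₗ[k] W ⊗[k] B}
    {a' : B →ₐ[k] Module.End k V'} {σ' : W' →ₗ[k] W' ⊗[k] B}
    {f : V →ₗ[k] V'} {g : W →ₗ[k] W'} (hf : ∀ h v, f (a h v) = a' h (f v))
    (hg : ∀ w, g.rTensor B (σ w) = σ' (g w)) (x : V ⊗[k] W) :
    ydSwapR a' σ' (map f g x) = map g f (ydSwapR a σ x) := by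
  induction x with
  | zero => simp
  | add x x' hx hx' => simp only [LinearMap.map_add, hx, hx']
  | tmul v w =>
    simp only [ydSwapR_tmul, map_tmul, ← hg]
    generalize σ w = x
    induction x with
    | zero => simp
    | add x x' hx hx' => simp only [LinearMap.map_add, hx, hx']
    | tmul p v => simp [hf]

theorem ydSwapR_act (a : B →ₐ[k] Module.End k V) {b : B →ₐ[k] Module.End k W}
    {σ : W →ₗ[k] W ⊗[k] B} (hb : IsYDLeftRight b σ) (h : B) (x : V ⊗[k] W) :
    ydSwapR a σ (tensorAct a b h x) = tensorAct b a h (ydSwapR a σ x) := by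
  induction x with
  | zero => simp
  | add x x' hx hx' => simp only [LinearMap.map_add, hx, hx']
  | tmul v w =>
    have h1 : ∀ z : B ⊗[k] B, ydSwapR a σ (twoAct a b z (v ⊗ₜ w)) =
        (a.toLinearMap.flip v).lTensor W (ydRight b σ w z) := by
      intro z
      induction z with
      | zero => simp
      | add x x' hx hx' => simp only [map_add, hx, hx', LinearMap.add_apply]
      | tmul r s =>
        simp only [twoAct_tmul, map_tmul, ydSwapR_tmul, ydRight,
          comp_apply, LinearEquiv.coe_coe, comm_tmul,
          rTensor_tmul, LinearMap.flip_apply, AlgHom.toLinearMap_apply]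
        generalize σ (b s w) = x
        induction x with
        | zero => simp
        | add x x' hx hx' => simp only [LinearMap.map_add, LinearEquiv.map_add, hx, hx', add_tmul]
        | tmul p v => simp
    have h2 : ∀ (z : B ⊗[k] B) (x : W ⊗[k] B),
        twoAct b a z ((a.toLinearMap.flip v).lTensor W x) = (a.toLinearMap.flip v).lTensor W
          (map₂ b.toLinearMap (LinearMap.mul k B) z x) := by
      intro z x
      induction z with
      | zero => simp
      | add x x' hx hx' => simp only [map_add, hx, hx', LinearMap.add_apply]
      | tmul r s =>
        induction x with
        | zero => simp
        | add x x' hx hx' => simp only [LinearMap.map_add, hx, hx']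
        | tmul p v => simp
    rw [tensorAct_apply, tensorAct_apply, h1, ydSwapR_tmul, h2, hb]

theorem ydSwapR_coact {a : B →ₐ[k] Module.End k V} {ρ : V →ₗ[k] V ⊗[k] B}
    {σ : W →ₗ[k] W ⊗[k] B} (ha : IsYDLeftRight a ρ) (hσ : IsRightCoaction σ) (x : V ⊗[k] W) :
    (ydSwapR a σ).rTensor B (tensorCoactR ρ σ x) = tensorCoactR σ ρ (ydSwapR a σ x) := by
  induction x with
  | zero => simp
  | add x x' hx hx' => simp only [LinearMap.map_add, hx, hx']
  | tmul v w =>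
    let T (f : B ⊗[k] B →ₗ[k] V ⊗[k] B) : W ⊗[k] (B ⊗[k] B) →ₗ[k] (W ⊗[k] V) ⊗[k] B :=
      (TensorProduct.assoc k W V B).symm.toLinearMap ∘ₗ f.lTensor W
    have hT : ∀ f z w, T f (w ⊗ₜ z) = (TensorProduct.assoc k W V B).symm (w ⊗ₜ f z) :=
      fun _ _ _ => rfl
    have h1 : ∀ x : W ⊗[k] B, tensorCoactR σ ρ ((a.toLinearMap.flip v).lTensor W x) =
        T (ydRight a ρ v) (TensorProduct.assoc k W B B (σ.rTensor B x)) := by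
      intro x
      induction x with
      | zero => simp
      | add x x' hx hx' => simp only [LinearMap.map_add, LinearEquiv.map_add, hx, hx']
      | tmul w p =>
        simp only [rTensor_tmul, tensorCoactR_tmul, lTensor_tmul,
          LinearMap.flip_apply, AlgHom.toLinearMap_apply]
        generalize σ w = y
        induction y with
        | zero => simp
        | add x x' hx hx' =>
          simp only [LinearMap.map_add, LinearEquiv.map_add, hx, hx', add_tmul, LinearMap.add_apply]
        | tmul w q =>
          rw [assoc_tmul, hT]
          simp only [ydRight, comp_apply, rTensor_tmul, LinearMap.flip_apply,
            AlgHom.toLinearMap_apply, LinearEquiv.coe_coe, comm_tmul]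
          generalize ρ (a p v) = y
          induction y with
          | zero => simp
          | add x x' hx hx' =>
            simp only [LinearMap.map_add, LinearEquiv.map_add, hx, hx', add_tmul, tmul_add]
          | tmul r w => simp
    have h2 : ∀ x : W ⊗[k] B, (ydSwapR a σ).rTensor B (mulCoR (ρ v) x) =
        T ((map₂ a.toLinearMap (LinearMap.mul k B)).flip (ρ v))
          (TensorProduct.assoc k W B B (σ.rTensor B x)) := by
      intro x
      induction x with
      | zero => simp
      | add x x' hx hx' => simp only [LinearMap.map_add, LinearEquiv.map_add, hx, hx']
      | tmul w p =>
        simp only [rTensor_tmul]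
        generalize ρ v = y
        induction y with
        | zero => simp [T]
        | add x x' hx hx' =>
          simp only [T] at hx hx' ⊢
          simp only [LinearMap.map_add, hx, hx', LinearMap.lTensor_add, LinearMap.add_apply,
            LinearMap.comp_add]
        | tmul v q =>
          simp only [mulCoR_tmul, rTensor_tmul, ydSwapR_tmul]
          generalize σ w = x
          induction x with
          | zero => simp
          | add x x' hx hx' => simp only [LinearMap.map_add, LinearEquiv.map_add, hx, hx', add_tmul]
          | tmul r v => simp [hT]
    have h4 : ∀ x : W ⊗[k] B,
        T (ydRight a ρ v) (comul.lTensor W x) =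
        T ((map₂ a.toLinearMap (LinearMap.mul k B)).flip (ρ v))
          (comul.lTensor W x) := by
      intro x
      induction x with
      | zero => simp
      | add x x' hx hx' => simp only [LinearMap.map_add, hx, hx']
      | tmul w p => rw [lTensor_tmul, hT, hT, ← ha, LinearMap.flip_apply]
    rw [tensorCoactR_tmul, ydSwapR_tmul, h1, h2, hσ.coassoc, h4]

theorem ydSwapR_hexagon_forward (a : B →ₐ[k] Module.End k V) (σ : W →ₗ[k] W ⊗[k] B)
    (τ : U →ₗ[k] U ⊗[k] B) (x : (V ⊗[k] W) ⊗[k] U) :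
    TensorProduct.assoc k W U V
        (ydSwapR a (tensorCoactR σ τ) (TensorProduct.assoc k V W U x)) =
      (ydSwapR a τ).lTensor W (TensorProduct.assoc k W V U ((ydSwapR a σ).rTensor U x)) := by
  induction x with
  | zero => simp
  | add x x' hx hx' => simp only [LinearMap.map_add, LinearEquiv.map_add, hx, hx']
  | tmul y u =>
    induction y with
    | zero => simp
    | add x x' hx hx' => simp only [LinearMap.map_add, LinearEquiv.map_add, add_tmul, hx, hx']
    | tmul v w =>
      simp only [assoc_tmul, ydSwapR_tmul, tensorCoactR_tmul,
        rTensor_tmul]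
      generalize σ w = y
      induction y with
      | zero => simp
      | add x x' hx hx' =>
        simp only [LinearMap.map_add, LinearEquiv.map_add, hx, hx', add_tmul, LinearMap.add_apply]
      | tmul w q =>
        simp only [lTensor_tmul, assoc_tmul, ydSwapR_tmul,
          LinearMap.flip_apply, AlgHom.toLinearMap_apply]
        generalize τ u = x
        induction x with
        | zero => simp
        | add x x' hx hx' => simp only [LinearMap.map_add, LinearEquiv.map_add, hx, hx', tmul_add]
        | tmul p v => simp

theorem ydSwapR_hexagon_reverse (a : B →ₐ[k] Module.End k V) (b : B →ₐ[k] Module.End k W)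
    {τ : U →ₗ[k] U ⊗[k] B} (hτ : IsRightCoaction τ) (x : V ⊗[k] (W ⊗[k] U)) :
    (TensorProduct.assoc k U V W).symm
        (ydSwapR (tensorAct a b) τ ((TensorProduct.assoc k V W U).symm x)) =
      (ydSwapR a τ).rTensor W
        ((TensorProduct.assoc k V U W).symm ((ydSwapR b τ).lTensor V x)) := by
  induction x with
  | zero => simp
  | add x x' hx hx' => simp only [LinearMap.map_add, LinearEquiv.map_add, hx, hx']
  | tmul v y =>
    induction y with
    | zero => simp
    | add x x' hx hx' => simp only [LinearMap.map_add, LinearEquiv.map_add, tmul_add, hx, hx']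
    | tmul w u =>
      let K : U ⊗[k] (B ⊗[k] B) →ₗ[k] (U ⊗[k] V) ⊗[k] W :=
        (TensorProduct.assoc k U V W).symm.toLinearMap ∘ₗ
          (map (a.toLinearMap.flip v) (b.toLinearMap.flip w)).lTensor U
      have h1 : ∀ x : U ⊗[k] B, (ydSwapR a τ).rTensor W ((TensorProduct.assoc k V U W).symm
          (v ⊗ₜ (b.toLinearMap.flip w).lTensor U x)) =
          K (TensorProduct.assoc k U B B (τ.rTensor B x)) := by
        intro x
        induction x with
        | zero => simp
        | add x x' hx hx' => simp only [LinearMap.map_add, LinearEquiv.map_add, hx, hx', tmul_add]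
        | tmul u p =>
          simp only [lTensor_tmul, assoc_symm_tmul, rTensor_tmul,
            ydSwapR_tmul]
          generalize τ u = x
          induction x with
          | zero => simp
          | add x x' hx hx' => simp only [LinearMap.map_add, LinearEquiv.map_add, hx, hx', add_tmul]
          | tmul u q => simp [K]
      have h2 : ∀ x : U ⊗[k] B, (TensorProduct.assoc k U V W).symm
          (((tensorAct a b).toLinearMap.flip (v ⊗ₜ w)).lTensor U x) =
          K (comul.lTensor U x) := by
        intro x
        induction x with
        | zero => simp
        | add x x' hx hx' => simp only [LinearMap.map_add, LinearEquiv.map_add, hx, hx']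
        | tmul u p =>
          simp only [lTensor_tmul, LinearMap.flip_apply, AlgHom.toLinearMap_apply,
            tensorAct_apply]
          generalize (comul (R := k) p) = z
          induction z with
          | zero => simp
          | add x x' hx hx' =>
            simp only [map_add, hx, hx', tmul_add, LinearMap.add_apply]
          | tmul p q => simp [K]
      rw [assoc_symm_tmul, ydSwapR_tmul, lTensor_tmul, ydSwapR_tmul, h1,
        h2, hτ.coassoc]

end YetterDrinfeldRight
end BraidedDuality

namespace BraidedDuality

universe u v w

section Species
open CategoryTheory MonoidalCategory

/-- A kind of linear-algebraic structure on `k`-vector spaces (such as an action or a coaction of a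
Hopf algebra), with its structure-preserving linear maps, tensor products and a braiding, such that
the vector spaces with this structure form a braided monoidal category over the category of vector
spaces. -/
structure BraidedKind (k : Type u) [Field k] where
  /-- the structures on a vector space -/
  Str : (V : Type u) → [AddCommGroup V] → [Module k V] → Type w
  /-- the structure-preserving linear maps -/
  IsHom : ∀ {V W : Type u} [AddCommGroup V] [Module k V] [AddCommGroup W] [Module k W],
    Str V → Str W → (V →ₗ[k] W) → Prop
  id_isHom : ∀ {V : Type u} [AddCommGroup V] [Module k V] (a : Str V), IsHom a a LinearMap.id
  comp_isHom : ∀ {V W U : Type u} [AddCommGroup V] [Module k V] [AddCommGroup W] [Module k W]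
    [AddCommGroup U] [Module k U] {a : Str V} {b : Str W} {c : Str U}
    {f : V →ₗ[k] W} {g : W →ₗ[k] U}, IsHom a b f → IsHom b c g → IsHom a c (g ∘ₗ f)
  symm_isHom : ∀ {V W : Type u} [AddCommGroup V] [Module k V] [AddCommGroup W] [Module k W]
    {a : Str V} {b : Str W} {e : V ≃ₗ[k] W}, IsHom a b e.toLinearMap → IsHom b a e.symm.toLinearMap
  /-- the structure on a tensor product -/
  tensor : ∀ {V W : Type u} [AddCommGroup V] [Module k V] [AddCommGroup W] [Module k W],
    Str V → Str W → Str (TensorProduct k V W)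
  /-- the structure on `k` -/
  unit : Str k
  map_isHom : ∀ {V W V' W' : Type u} [AddCommGroup V] [Module k V] [AddCommGroup W] [Module k W]
    [AddCommGroup V'] [Module k V'] [AddCommGroup W'] [Module k W']
    {a : Str V} {b : Str W} {a' : Str V'} {b' : Str W'} {f : V →ₗ[k] V'} {g : W →ₗ[k] W'},
    IsHom a a' f → IsHom b b' g → IsHom (tensor a b) (tensor a' b') (TensorProduct.map f g)
  assoc_isHom : ∀ {V W U : Type u} [AddCommGroup V] [Module k V] [AddCommGroup W] [Module k W]
    [AddCommGroup U] [Module k U] (a : Str V) (b : Str W) (c : Str U),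
    IsHom (tensor (tensor a b) c) (tensor a (tensor b c)) (TensorProduct.assoc k V W U).toLinearMap
  lid_isHom : ∀ {V : Type u} [AddCommGroup V] [Module k V] (a : Str V),
    IsHom (tensor unit a) a (TensorProduct.lid k V).toLinearMap
  rid_isHom : ∀ {V : Type u} [AddCommGroup V] [Module k V] (a : Str V),
    IsHom (tensor a unit) a (TensorProduct.rid k V).toLinearMap
  /-- the braiding -/
  braid : ∀ {V W : Type u} [AddCommGroup V] [Module k V] [AddCommGroup W] [Module k W],
    Str V → Str W → TensorProduct k V W ≃ₗ[k] TensorProduct k W V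
  braid_isHom : ∀ {V W : Type u} [AddCommGroup V] [Module k V] [AddCommGroup W] [Module k W]
    (a : Str V) (b : Str W), IsHom (tensor a b) (tensor b a) (braid a b).toLinearMap
  braid_natural : ∀ {V W V' W' : Type u} [AddCommGroup V] [Module k V] [AddCommGroup W]
    [Module k W] [AddCommGroup V'] [Module k V'] [AddCommGroup W'] [Module k W']
    {a : Str V} {b : Str W} {a' : Str V'} {b' : Str W'} {f : V →ₗ[k] V'} {g : W →ₗ[k] W'},
    IsHom a a' f → IsHom b b' g → ∀ x, braid a' b' (TensorProduct.map f g x) =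
      TensorProduct.map g f (braid a b x)
  hexagon_forward : ∀ {V W U : Type u} [AddCommGroup V] [Module k V] [AddCommGroup W] [Module k W]
    [AddCommGroup U] [Module k U] (a : Str V) (b : Str W) (c : Str U)
    (x : TensorProduct k (TensorProduct k V W) U),
    TensorProduct.assoc k W U V (braid a (tensor b c) (TensorProduct.assoc k V W U x)) =
      (braid a c).toLinearMap.lTensor W
        (TensorProduct.assoc k W V U ((braid a b).toLinearMap.rTensor U x))
  hexagon_reverse : ∀ {V W U : Type u} [AddCommGroup V] [Module k V] [AddCommGroup W] [Module k W]
    [AddCommGroup U] [Module k U] (a : Str V) (b : Str W) (c : Str U)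
    (x : TensorProduct k V (TensorProduct k W U)),
    (TensorProduct.assoc k U V W).symm (braid (tensor a b) c
        ((TensorProduct.assoc k V W U).symm x)) =
      (braid a c).toLinearMap.rTensor W
        ((TensorProduct.assoc k V U W).symm ((braid b c).toLinearMap.lTensor V x))

namespace BraidedKind

variable {k : Type u} [Field k]

/-- A vector space with a structure of kind `D`. -/
structure Obj (D : BraidedKind.{u, w} k) where
  /-- the underlying vector space -/
  carrier : Type u
  [addCommGroup : AddCommGroup carrier]
  [module : Module k carrier]
  /-- the structure -/
  str : D.Str carrier

attribute [instance] Obj.addCommGroup Obj.module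

variable {D : BraidedKind.{u, w} k}

/-- The morphisms are the structure-preserving linear maps. -/
@[ext] structure Hom (X Y : D.Obj) where
  /-- the underlying linear map -/
  lin : X.carrier →ₗ[k] Y.carrier
  isHom : D.IsHom X.str Y.str lin

instance : Category D.Obj where
  Hom X Y := Hom X Y
  id X := ⟨LinearMap.id, D.id_isHom X.str⟩
  comp f g := ⟨g.lin ∘ₗ f.lin, D.comp_isHom f.isHom g.isHom⟩

/-- An invertible structure-preserving linear map is an isomorphism. -/
def mkIso {X Y : D.Obj} (e : X.carrier ≃ₗ[k] Y.carrier)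
    (h : D.IsHom X.str Y.str e.toLinearMap) : X ≅ Y where
  hom := ⟨e.toLinearMap, h⟩
  inv := ⟨e.symm.toLinearMap, D.symm_isHom h⟩
  hom_inv_id := Hom.ext (by ext x; exact e.symm_apply_apply x)
  inv_hom_id := Hom.ext (by ext x; exact e.apply_symm_apply x)

/-- The tensor product of two structured vector spaces. -/
def tensorObj (X Y : D.Obj) : D.Obj := ⟨TensorProduct k X.carrier Y.carrier, D.tensor X.str Y.str⟩

/-- The tensor product of two morphisms. -/
def tensorHom {X Y X' Y' : D.Obj} (f : X ⟶ X') (g : Y ⟶ Y') : tensorObj X Y ⟶ tensorObj X' Y' :=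
  ⟨TensorProduct.map f.lin g.lin, D.map_isHom f.isHom g.isHom⟩

instance : MonoidalCategoryStruct D.Obj where
  tensorObj := tensorObj
  tensorHom := tensorHom
  whiskerLeft X _ _ f := tensorHom (𝟙 X) f
  whiskerRight f Y := tensorHom f (𝟙 Y)
  tensorUnit := ⟨k, D.unit⟩
  associator X Y Z := mkIso (X := tensorObj (tensorObj X Y) Z) (Y := tensorObj X (tensorObj Y Z))
    (TensorProduct.assoc k X.carrier Y.carrier Z.carrier) (D.assoc_isHom X.str Y.str Z.str)
  leftUnitor X := mkIso (X := tensorObj ⟨k, D.unit⟩ X) (TensorProduct.lid k X.carrier)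
    (D.lid_isHom X.str)
  rightUnitor X := mkIso (X := tensorObj X ⟨k, D.unit⟩) (TensorProduct.rid k X.carrier)
    (D.rid_isHom X.str)

variable (D) in
/-- The functor that forgets the structure. -/
def forget : D.Obj ⥤ ModuleCat.{u} k where
  obj X := ModuleCat.of k X.carrier
  map f := ModuleCat.ofHom f.lin

instance : (forget D).Faithful where
  map_injective h := Hom.ext (congrArg ModuleCat.Hom.hom h)

variable (D) in
/-- The forgetful functor preserves tensor products, units, associators and unitors. -/
def forgetData : Monoidal.InducingFunctorData (forget D) where
  μIso X Y := Iso.refl _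
  εIso := Iso.refl _
  whiskerLeft_eq X Y Z f := by ext; rfl
  whiskerRight_eq f Z := by ext; rfl
  tensorHom_eq f g := by ext; rfl
  associator_eq X Y Z := by ext1; exact TensorProduct.ext (TensorProduct.ext rfl)
  leftUnitor_eq X := by ext1; exact TensorProduct.ext rfl
  rightUnitor_eq X := by ext1; exact TensorProduct.ext rfl

instance : MonoidalCategory D.Obj := Monoidal.induced (forget D) (forgetData D)

instance : (forget D).Monoidal := Monoidal.fromInducedMonoidal (forget D) (forgetData D)

instance : BraidedCategory D.Obj where
  braiding X Y := mkIso (X := tensorObj X Y) (Y := tensorObj Y X) (D.braid X.str Y.str)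
    (D.braid_isHom X.str Y.str)
  braiding_naturality_right X _ _ f := Hom.ext <| LinearMap.ext fun x =>
    D.braid_natural (D.id_isHom X.str) f.isHom x
  braiding_naturality_left f Z := Hom.ext <| LinearMap.ext fun x =>
    D.braid_natural f.isHom (D.id_isHom Z.str) x
  hexagon_forward X Y Z := Hom.ext <| LinearMap.ext fun x =>
    D.hexagon_forward X.str Y.str Z.str x
  hexagon_reverse X Y Z := Hom.ext <| LinearMap.ext fun x =>
    D.hexagon_reverse X.str Y.str Z.str x

end BraidedKind

variable {k : Type u} [Field k] {B : Type v} [Ring B] [HopfAlgebra k B]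

/-- Left `B`-modules, with `h (v ⊗ w) = h₁ v ⊗ h₂ w` and the braiding of a quasi-triangular
structure. -/
noncomputable def moduleKind (Q : QuasiTriangular k B) : BraidedKind k where
  Str V := B →ₐ[k] Module.End k V
  IsHom a b f := ∀ h v, f (a h v) = b h (f v)
  id_isHom _ _ _ := rfl
  comp_isHom hf hg h v := by simp [hf h v, hg h]
  symm_isHom {V W _ _ _ _ a b e} he h w := by
    change e.symm (b h w) = a h (e.symm w)
    have := he h (e.symm w)
    rw [LinearEquiv.symm_apply_eq]
    simpa using this.symm
  tensor := tensorAct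
  unit := trivAct k B
  map_isHom hf hg h x := tensorAct_map hf hg h x
  assoc_isHom := tensorAct_assoc
  lid_isHom := tensorAct_lid
  rid_isHom := tensorAct_rid
  braid := Q.braid
  braid_isHom := Q.braid_act
  braid_natural hf hg x := by
    rw [Q.braid_apply, Q.braid_apply, ← twoAct_map hf hg, TensorProduct.map_comm]
  hexagon_forward := Q.hexagon_forward
  hexagon_reverse := Q.hexagon_reverse

theorem lTensor_symm {V W : Type u} [AddCommGroup V] [Module k V] [AddCommGroup W] [Module k W]
    {ρ : V →ₗ[k] TensorProduct k B V} {σ : W →ₗ[k] TensorProduct k B W} {e : V ≃ₗ[k] W}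
    (he : ∀ v, e.toLinearMap.lTensor B (ρ v) = σ (e v)) (w : W) :
    e.symm.toLinearMap.lTensor B (σ w) = ρ (e.symm w) := by
  have := he (e.symm w)
  rw [LinearEquiv.apply_symm_apply] at this
  rw [← this, ← LinearMap.comp_apply, ← LinearMap.lTensor_comp]
  simp

theorem rTensor_symm {V W : Type u} [AddCommGroup V] [Module k V] [AddCommGroup W] [Module k W]
    {ρ : V →ₗ[k] TensorProduct k V B} {σ : W →ₗ[k] TensorProduct k W B} {e : V ≃ₗ[k] W}
    (he : ∀ v, e.toLinearMap.rTensor B (ρ v) = σ (e v)) (w : W) :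
    e.symm.toLinearMap.rTensor B (σ w) = ρ (e.symm w) := by
  have := he (e.symm w)
  rw [LinearEquiv.apply_symm_apply] at this
  rw [← this, ← LinearMap.comp_apply, ← LinearMap.rTensor_comp]
  simp

/-- Left `B`-comodules, with `v ⊗ w ↦ v₍₋₁₎ w₍₋₁₎ ⊗ (v₍₀₎ ⊗ w₍₀₎)` and the braiding of a
coquasi-triangular structure. -/
noncomputable def comoduleKind (r : CoquasiTriangular k B) : BraidedKind k where
  Str V := { ρ : V →ₗ[k] TensorProduct k B V // IsLeftCoaction ρ }
  IsHom a b f := ∀ v, f.lTensor B (a.1 v) = b.1 (f v)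
  id_isHom a v := by simp
  comp_isHom hf hg v := by
    rw [LinearMap.lTensor_comp, LinearMap.comp_apply, hf, hg]; rfl
  symm_isHom he := lTensor_symm he
  tensor a b := ⟨tensorCoact a.1 b.1, a.2.tensor b.2⟩
  unit := ⟨trivCoact k B, isLeftCoaction_triv⟩
  map_isHom hf hg x := tensorCoact_map hf hg x
  assoc_isHom a b c := tensorCoact_assoc a.1 b.1 c.1
  lid_isHom a := tensorCoact_lid a.1
  rid_isHom a := tensorCoact_rid a.1
  braid a b := r.braid a.2 b.2
  braid_isHom a b := r.braid_coact a.1 b.1 a.2 b.2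
  braid_natural hf hg x := swapBy_map r.r hf hg x
  hexagon_forward a b c := r.hexagon_forward b.1 c.1 a.2
  hexagon_reverse a b c := r.hexagon_reverse a.1 b.1 c.2

/-- Left-left Yetter-Drinfeld modules over `B`. -/
noncomputable def yetterDrinfeldLeftLeftKind
    (hS : Function.Bijective (HopfAlgebra.antipode k (A := B))) : BraidedKind k where
  Str V := { s : (B →ₐ[k] Module.End k V) × (V →ₗ[k] TensorProduct k B V) //
    IsLeftCoaction s.2 ∧ IsYDLeftLeft s.1 s.2 }
  IsHom a b f := (∀ h v, f (a.1.1 h v) = b.1.1 h (f v)) ∧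
    ∀ v, f.lTensor B (a.1.2 v) = b.1.2 (f v)
  id_isHom a := ⟨fun _ _ => rfl, fun v => by simp⟩
  comp_isHom hf hg := ⟨fun h v => by simp [hf.1 h v, hg.1 h], fun v => by
    rw [LinearMap.lTensor_comp, LinearMap.comp_apply, hf.2, hg.2]; rfl⟩
  symm_isHom {V W _ _ _ _ a b e} he := ⟨fun h w => by
    change e.symm (b.1.1 h w) = a.1.1 h (e.symm w)
    have := he.1 h (e.symm w)
    rw [LinearEquiv.symm_apply_eq]
    simpa using this.symm, lTensor_symm he.2⟩
  tensor a b := ⟨(tensorAct a.1.1 b.1.1, tensorCoact a.1.2 b.1.2), a.2.1.tensor b.2.1,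
    a.2.2.tensor b.2.2⟩
  unit := ⟨(trivAct k B, trivCoact k B), isLeftCoaction_triv, isYDLeftLeft_triv⟩
  map_isHom hf hg := ⟨fun h x => tensorAct_map hf.1 hg.1 h x,
    fun x => tensorCoact_map hf.2 hg.2 x⟩
  assoc_isHom a b c := ⟨tensorAct_assoc a.1.1 b.1.1 c.1.1, tensorCoact_assoc a.1.2 b.1.2 c.1.2⟩
  lid_isHom a := ⟨tensorAct_lid a.1.1, tensorCoact_lid a.1.2⟩
  rid_isHom a := ⟨tensorAct_rid a.1.1, tensorCoact_rid a.1.2⟩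
  braid a b := ydBraid hS b.1.1 a.2.1
  braid_isHom a b := ⟨ydSwap_act b.1.1 a.2.2, ydSwap_coact a.2.1 b.2.2⟩
  braid_natural hf hg x := ydSwap_map hf.2 hg.1 x
  hexagon_forward a b c := ydSwap_hexagon_forward a.2.1 b.1.1 c.1.1
  hexagon_reverse a b c := ydSwap_hexagon_reverse a.1.2 b.1.2 c.1.1

variable (k B) in
/-- Left-right Yetter-Drinfeld modules over `B`. -/
noncomputable def yetterDrinfeldLeftRightKind : BraidedKind k where
  Str V := { s : (B →ₐ[k] Module.End k V) × (V →ₗ[k] TensorProduct k V B) //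
    IsRightCoaction s.2 ∧ IsYDLeftRight s.1 s.2 }
  IsHom a b f := (∀ h v, f (a.1.1 h v) = b.1.1 h (f v)) ∧
    ∀ v, f.rTensor B (a.1.2 v) = b.1.2 (f v)
  id_isHom a := ⟨fun _ _ => rfl, fun v => by simp⟩
  comp_isHom hf hg := ⟨fun h v => by simp [hf.1 h v, hg.1 h], fun v => by
    rw [LinearMap.rTensor_comp, LinearMap.comp_apply, hf.2, hg.2]; rfl⟩
  symm_isHom {V W _ _ _ _ a b e} he := ⟨fun h w => by
    change e.symm (b.1.1 h w) = a.1.1 h (e.symm w)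
    have := he.1 h (e.symm w)
    rw [LinearEquiv.symm_apply_eq]
    simpa using this.symm, rTensor_symm he.2⟩
  tensor a b := ⟨(tensorAct a.1.1 b.1.1, tensorCoactR a.1.2 b.1.2), a.2.1.tensor b.2.1,
    a.2.2.tensor b.2.2⟩
  unit := ⟨(trivAct k B, trivCoactR k B), isRightCoaction_triv, isYDLeftRight_triv⟩
  map_isHom hf hg := ⟨fun h x => tensorAct_map hf.1 hg.1 h x,
    fun x => tensorCoactR_map hf.2 hg.2 x⟩
  assoc_isHom a b c := ⟨tensorAct_assoc a.1.1 b.1.1 c.1.1, tensorCoactR_assoc a.1.2 b.1.2 c.1.2⟩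
  lid_isHom a := ⟨tensorAct_lid a.1.1, tensorCoactR_lid a.1.2⟩
  rid_isHom a := ⟨tensorAct_rid a.1.1, tensorCoactR_rid a.1.2⟩
  braid a b := ydBraidR a.1.1 b.2.1
  braid_isHom a b := ⟨ydSwapR_act a.1.1 b.2.2, ydSwapR_coact a.2.2 b.2.1⟩
  braid_natural hf hg x := ydSwapR_map hf.1 hg.2 x
  hexagon_forward a b c := ydSwapR_hexagon_forward a.1.1 b.1.2 c.1.2
  hexagon_reverse a b c := ydSwapR_hexagon_reverse a.1.1 b.1.1 c.2.1

end Species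
end BraidedDuality

namespace BraidedDuality

universe u v w

section Duality
open CategoryTheory MonoidalCategory
open scoped MonObj ComonObj

namespace BraidedKind

variable {k : Type u} [Field k] {D : BraidedKind.{u, w} k}

/-- The ordinary ring underlying an algebra in the category. -/
@[reducible] def ringOf (A : D.Obj) [MonObj A] : Ring A.carrier :=
  { A.addCommGroup with
    mul := fun x y => (μ[A]).lin (x ⊗ₜ[k] y)
    one := (η[A]).lin (1 : k)
    left_distrib := fun x y z => by
      change (μ[A]).lin (x ⊗ₜ[k] (y + z)) = _
      rw [TensorProduct.tmul_add]; exact map_add (μ[A]).lin _ _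
    right_distrib := fun x y z => by
      change (μ[A]).lin ((x + y) ⊗ₜ[k] z) = _
      rw [TensorProduct.add_tmul]; exact map_add (μ[A]).lin _ _
    zero_mul := fun x => by
      change (μ[A]).lin ((0 : A.carrier) ⊗ₜ[k] x) = _
      rw [TensorProduct.zero_tmul]; exact map_zero (μ[A]).lin
    mul_zero := fun x => by
      change (μ[A]).lin (x ⊗ₜ[k] (0 : A.carrier)) = _
      rw [TensorProduct.tmul_zero]; exact map_zero (μ[A]).lin
    mul_assoc := fun x y z =>
      LinearMap.congr_fun (congrArg Hom.lin (MonObj.mul_assoc A)) ((x ⊗ₜ[k] y) ⊗ₜ[k] z)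
    one_mul := fun x => (LinearMap.congr_fun (congrArg Hom.lin (MonObj.one_mul A))
      ((1 : k) ⊗ₜ[k] x)).trans (one_smul k x)
    mul_one := fun x => (LinearMap.congr_fun (congrArg Hom.lin (MonObj.mul_one A))
      (x ⊗ₜ[k] (1 : k))).trans (one_smul k x) }

variable (D) in
/-- Every finite-dimensional object has a left dual. -/
def FiniteHaveLeftDuals : Prop :=
  ∀ X : D.Obj, Module.Finite k X.carrier → ∃ Xd : D.Obj, Nonempty (ExactPairing X Xd)

/-- The value `⟨f, x⟩` of the evaluation `Hd ⊗ H ⟶ 𝟙_` on elements. -/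
def pairing {H Hd : D.Obj} [ExactPairing H Hd] (f : Hd.carrier) (x : H.carrier) : k :=
  (ε_ H Hd).lin (f ⊗ₜ[k] x)

variable (D) in
/-- For a finite-dimensional Hopf algebra `H` with `C_{H,H} = C_{H,H}⁻¹`, with left dual `Hd`, and
for a left `H`-module algebra `R`: the matrix algebra `M_n(R)`, `n = dim H`, carries a structure that
makes it an algebra in the category, which is isomorphic to the braided tensor product
`R ⊗ (H ⊗̄ Hd)` and to `(R # H) # H^`, as algebras in the category. -/
def DualityTheorem : Prop :=
  ∀ (H Hd R : D.Obj) [HopfObj H] [ExactPairing H Hd] [MonObj R] (act : H ⊗ R ⟶ R),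
    Module.Finite k H.carrier → (β_ H H).hom = (β_ H H).inv →
    IsModuleAlgebra μ[H] η[H] Δ[H] ε[H] μ[R] η[R] act →
    ∀ e : Module.Basis (Fin (Module.finrank k H.carrier)) k H.carrier,
    letI := ringOf R
    ∃ (s : D.Str (Matrix (Fin (Module.finrank k H.carrier)) (Fin (Module.finrank k H.carrier))
        R.carrier))
      (mM : (⟨_, s⟩ : D.Obj) ⊗ ⟨_, s⟩ ⟶ ⟨_, s⟩) (uM : 𝟙_ D.Obj ⟶ ⟨_, s⟩)
      (Θ : R ⊗ (H ⊗ Hd) ≅ ⟨_, s⟩) (Φ : (R ⊗ H) ⊗ Hd ≅ ⟨_, s⟩),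
      (∀ x y, mM.lin (x ⊗ₜ[k] y) = x * y) ∧ uM.lin (1 : k) = 1 ∧
      IsAlgebraIso (tensorMul μ[R] (pairMul H Hd)) (tensorOne η[R] (pairOne H Hd)) mM uM Θ ∧
      (∀ (v : H.carrier) (f : Hd.carrier), Θ.hom.lin ((1 : R.carrier) ⊗ₜ[k] (v ⊗ₜ[k] f)) =
        Matrix.of fun i j => (e.repr v i * pairing f (e j)) • (1 : R.carrier)) ∧
      IsAlgebraIso (doubleSmashMul R H Hd act) (doubleSmashOne R H Hd) mM uM Φ

end BraidedKind
end Duality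
end BraidedDuality

/-! Write `Σ bᵢ ⊗ bⁱ` for the coevaluation and use Sweedler notation with the braidings suppressed,
here and in the comments below. The algebra `(R # H) # H^` acts on `R # H`: the factor `R # H` by
left multiplication, and `H^` through `f ⇀ h = h₁ ⟨f, h₂⟩` on `H`. These operators commute with
right multiplication by `R`, because `h · r = h₁ r # h₂` while `⇀` touches only the last leg of the
coproduct (`tail_hatAct_entwine`).

If the antipode `S` is invertible, `h ⊗ r ↦ h · r` identifies `H ⊗ R` with `R # H`; the inverse is
`r # h ↦ h₂ ⊗ S⁻¹(h₁) r`. So `R # H` is the free right `R`-module on `H`, and its `R`-linear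
endomorphisms form `H ⊗ R ⊗ H*` with the product `⟨f, h'⟩ h ⊗ r r' ⊗ f'`. Hence `x ↦ Σ (x · bᵢ) ⊗
bⁱ` is an algebra map (`tail_smash_mul`, `tail_toPair_mul`). It is bijective: it is `h ⊗ f ↦ Σ h (f
⇀ bᵢ) ⊗ bⁱ` followed by the inverse of `h ⊗ r ↦ h · r`, and the first of these maps has the
one-sided inverse `h ⊗ f ↦ Σ h S⁻¹(bᵢ₁) ⟨f, bᵢ₂⟩ ⊗ bⁱ` (`tail_actDualInv_actDual`), which is enough
in finite dimension.

Only the braiding of `H` with itself is assumed symmetric. By duality the double braidings of `H`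
with `H*` and of `H*` with itself are then trivial as well; this makes `H` a module algebra over
`H^` and gives `S⁻¹` its usual identities. The braidings with `R` remain arbitrary.

Invertibility of `S` follows the argument of Larson and Sweedler. The dual is a Hopf module over
`H`, with `⟨h f, x⟩ = ⟨f, S(h) x⟩`, and `P(f) = S(f₋₁) f₀` projects it onto its coinvariants. As for
every Hopf module, `h ⊗ P(f)` can be recovered from `h P(f)`, which depends on `h` only through
`S(h)`. So `S(z) = 0` forces `z = 0` or `P = 0`; since `f = f₋₁ P(f₀)`, the second case makes the
dual zero, and with it `H` (`antipode_injective`).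

Braiding `H` past `R` turns `H ⊗ R ⊗ H*` into the braided tensor product `R ⊗ (H ⊗̄ H*)`, and a
basis of `H` turns it into `M_n(R)`, with the sum over dual bases becoming the sum over the middle
index of a matrix product. The structure on `M_n(R)` is the one transported along the resulting
linear isomorphism. All of this works in any `BraidedKind` whose structures can be transported
(`Transports.dualityTheorem`); for the four categories it remains to check transport, and to build
left duals from the antipode. -/

namespace BraidedDuality

universe v₁ u₁

section Tail

open CategoryTheory MonoidalCategory

variable {C : Type u₁} [Category.{v₁} C] [MonoidalCategory C]

/-! ### Morphisms acting on the first factors of a tensor product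

A morphism between tensor products of objects acts on the first factors of a right-nested tensor
product with an arbitrary last factor `W`. In the names `boxmn` and `boxmn_exchange`, `m` and `n`
are the numbers of tensor factors of the domain and of the codomain. -/

/-- The action of `f` on a tensor product with last factor `W`. -/
def box01 {A' : C} (f : 𝟙_ C ⟶ A') (W : C) : W ⟶ A' ⊗ W :=
  (λ_ W).inv ≫ f ▷ W

/-- The action of `f` on a tensor product with last factor `W`. -/
def box10 {A : C} (f : A ⟶ 𝟙_ C) (W : C) : A ⊗ W ⟶ W :=
  f ▷ W ≫ (λ_ W).hom

/-- The action of `f` on a tensor product with last factor `W`. -/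
def box11 {A A' : C} (f : A ⟶ A') (W : C) : A ⊗ W ⟶ A' ⊗ W :=
  f ▷ W

/-- The action of `f` on a tensor product with last factor `W`. -/
def box12 {A A' B' : C} (f : A ⟶ A' ⊗ B') (W : C) : A ⊗ W ⟶ A' ⊗ (B' ⊗ W) :=
  f ▷ W ≫ (α_ A' B' W).hom

/-- The action of `f` on a tensor product with last factor `W`. -/
def box21 {A B A' : C} (f : A ⊗ B ⟶ A') (W : C) : A ⊗ (B ⊗ W) ⟶ A' ⊗ W :=
  (α_ A B W).inv ≫ f ▷ W

/-- The action of `f` on a tensor product with last factor `W`. -/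
def box02 {A' B' : C} (f : 𝟙_ C ⟶ A' ⊗ B') (W : C) : W ⟶ A' ⊗ (B' ⊗ W) :=
  (λ_ W).inv ≫ f ▷ W ≫ (α_ A' B' W).hom

/-- The action of `f` on a tensor product with last factor `W`. -/
def box20 {A B : C} (f : A ⊗ B ⟶ 𝟙_ C) (W : C) : A ⊗ (B ⊗ W) ⟶ W :=
  (α_ A B W).inv ≫ f ▷ W ≫ (λ_ W).hom

/-- The action of `f` on a tensor product with last factor `W`. -/
def box22 {A B A' B' : C} (f : A ⊗ B ⟶ A' ⊗ B') (W : C) : A ⊗ (B ⊗ W) ⟶ A' ⊗ (B' ⊗ W) :=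
  (α_ A B W).inv ≫ f ▷ W ≫ (α_ A' B' W).hom

/-- The interchange law: a morphism on the first factors commutes with a morphism on the remaining
ones. The primed forms are the same equations reversed, so that either direction can serve as a step
of a chain. -/
theorem box01_exchange {A' W W' : C} {f : 𝟙_ C ⟶ A'} {g : W ⟶ W'} :
    g ≫ box01 f W' = box01 f W ≫ A' ◁ g := by
  calc
    _ = 𝟙 _ ⊗≫ ((𝟙_ C) ◁ g ≫ f ▷ W') ⊗≫ 𝟙 _ := by simp only [box01]; monoidal
    _ = _ := by rw [whisker_exchange]; simp only [box01]; monoidal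

theorem box01_exchange' {A' W W' : C} {f : 𝟙_ C ⟶ A'} {g : W ⟶ W'} :
    box01 f W ≫ A' ◁ g = g ≫ box01 f W' := box01_exchange.symm

theorem box10_exchange {A W W' : C} {f : A ⟶ 𝟙_ C} {g : W ⟶ W'} :
    A ◁ g ≫ box10 f W' = box10 f W ≫ g := by
  calc
    _ = 𝟙 _ ⊗≫ (A ◁ g ≫ f ▷ W') ⊗≫ 𝟙 _ := by simp only [box10]; monoidal
    _ = _ := by rw [whisker_exchange]; simp only [box10]; monoidal

theorem box10_exchange' {A W W' : C} {f : A ⟶ 𝟙_ C} {g : W ⟶ W'} :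
    box10 f W ≫ g = A ◁ g ≫ box10 f W' := box10_exchange.symm

theorem box11_exchange {A A' W W' : C} {f : A ⟶ A'} {g : W ⟶ W'} :
    A ◁ g ≫ box11 f W' = box11 f W ≫ A' ◁ g := by
  calc
    _ = 𝟙 _ ⊗≫ (A ◁ g ≫ f ▷ W') ⊗≫ 𝟙 _ := by simp only [box11]; monoidal
    _ = _ := by rw [whisker_exchange]; simp only [box11]; monoidal

theorem box11_exchange' {A A' W W' : C} {f : A ⟶ A'} {g : W ⟶ W'} :
    box11 f W ≫ A' ◁ g = A ◁ g ≫ box11 f W' := box11_exchange.symm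

theorem box12_exchange {A A' B' W W' : C} {f : A ⟶ A' ⊗ B'} {g : W ⟶ W'} :
    A ◁ g ≫ box12 f W' = box12 f W ≫ A' ◁ (B' ◁ g) := by
  calc
    _ = 𝟙 _ ⊗≫ (A ◁ g ≫ f ▷ W') ⊗≫ 𝟙 _ := by simp only [box12]; monoidal
    _ = _ := by rw [whisker_exchange]; simp only [box12]; monoidal

theorem box12_exchange' {A A' B' W W' : C} {f : A ⟶ A' ⊗ B'} {g : W ⟶ W'} :
    box12 f W ≫ A' ◁ (B' ◁ g) = A ◁ g ≫ box12 f W' := box12_exchange.symm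

theorem box21_exchange {A B A' W W' : C} {f : A ⊗ B ⟶ A'} {g : W ⟶ W'} :
    A ◁ (B ◁ g) ≫ box21 f W' = box21 f W ≫ A' ◁ g := by
  calc
    _ = 𝟙 _ ⊗≫ ((A ⊗ B) ◁ g ≫ f ▷ W') ⊗≫ 𝟙 _ := by simp only [box21]; monoidal
    _ = _ := by rw [whisker_exchange]; simp only [box21]; monoidal

theorem box21_exchange' {A B A' W W' : C} {f : A ⊗ B ⟶ A'} {g : W ⟶ W'} :
    box21 f W ≫ A' ◁ g = A ◁ (B ◁ g) ≫ box21 f W' := box21_exchange.symm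

theorem box02_exchange {A' B' W W' : C} {f : 𝟙_ C ⟶ A' ⊗ B'} {g : W ⟶ W'} :
    g ≫ box02 f W' = box02 f W ≫ A' ◁ (B' ◁ g) := by
  calc
    _ = 𝟙 _ ⊗≫ ((𝟙_ C) ◁ g ≫ f ▷ W') ⊗≫ 𝟙 _ := by simp only [box02]; monoidal
    _ = _ := by rw [whisker_exchange]; simp only [box02]; monoidal

theorem box02_exchange' {A' B' W W' : C} {f : 𝟙_ C ⟶ A' ⊗ B'} {g : W ⟶ W'} :
    box02 f W ≫ A' ◁ (B' ◁ g) = g ≫ box02 f W' := box02_exchange.symm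

theorem box20_exchange {A B W W' : C} {f : A ⊗ B ⟶ 𝟙_ C} {g : W ⟶ W'} :
    A ◁ (B ◁ g) ≫ box20 f W' = box20 f W ≫ g := by
  calc
    _ = 𝟙 _ ⊗≫ ((A ⊗ B) ◁ g ≫ f ▷ W') ⊗≫ 𝟙 _ := by simp only [box20]; monoidal
    _ = _ := by rw [whisker_exchange]; simp only [box20]; monoidal

theorem box20_exchange' {A B W W' : C} {f : A ⊗ B ⟶ 𝟙_ C} {g : W ⟶ W'} :
    box20 f W ≫ g = A ◁ (B ◁ g) ≫ box20 f W' := box20_exchange.symm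

theorem box22_exchange {A B A' B' W W' : C} {f : A ⊗ B ⟶ A' ⊗ B'} {g : W ⟶ W'} :
    A ◁ (B ◁ g) ≫ box22 f W' = box22 f W ≫ A' ◁ (B' ◁ g) := by
  calc
    _ = 𝟙 _ ⊗≫ ((A ⊗ B) ◁ g ≫ f ▷ W') ⊗≫ 𝟙 _ := by simp only [box22]; monoidal
    _ = _ := by rw [whisker_exchange]; simp only [box22]; monoidal

theorem box22_exchange' {A B A' B' W W' : C} {f : A ⊗ B ⟶ A' ⊗ B'} {g : W ⟶ W'} :
    box22 f W ≫ A' ◁ (B' ◁ g) = A ◁ (B ◁ g) ≫ box22 f W' := box22_exchange.symm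

end Tail

/-! ### Rewriting inside compositions and whiskerings -/

section Composition

open CategoryTheory

variable {C : Type u₁} [Category.{v₁} C]

/-- The names encode one step of a diagram calculation on a right-nested composite: `preN` skips `N`
morphisms, `postMN` replaces the leading `M` morphisms by `N` others and keeps the remainder `t`,
and `endMN` inserts or deletes a pair of mutually cancelling morphisms at the end. A count of `0`
stands for an identity. -/
theorem pre1 {A X Y : C} {f : A ⟶ X} {g h : X ⟶ Y} (e : g = h) : f ≫ g = f ≫ h := e ▸ rfl

theorem post02 {X B1 Z : C} {g1 : X ⟶ B1} {g2 : B1 ⟶ X} {t : X ⟶ Z} (e : 𝟙 _ = g1 ≫ g2) : t = g1 ≫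
    g2 ≫ t := by simpa using e =≫ t

theorem post12 {X Y B1 Z : C} {f1 : X ⟶ Y} {g1 : X ⟶ B1} {g2 : B1 ⟶ Y} {t : Y ⟶ Z} (e : f1 = g1 ≫
    g2) : f1 ≫ t = g1 ≫ g2 ≫ t := by simpa using e =≫ t

theorem post13 {X Y B1 B2 Z : C} {f1 : X ⟶ Y} {g1 : X ⟶ B1} {g2 : B1 ⟶ B2} {g3 : B2 ⟶ Y} {t : Y ⟶
    Z} (e : f1 = g1 ≫ g2 ≫ g3) : f1 ≫ t = g1 ≫ g2 ≫ g3 ≫ t := by simpa using e =≫ t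

theorem post14 {X Y B1 B2 B3 Z : C} {f1 : X ⟶ Y} {g1 : X ⟶ B1} {g2 : B1 ⟶ B2} {g3 : B2 ⟶ B3} {g4 :
    B3 ⟶ Y} {t : Y ⟶ Z} (e : f1 = g1 ≫ g2 ≫ g3 ≫ g4) : f1 ≫ t = g1 ≫ g2 ≫ g3 ≫ g4 ≫ t := by simpa
    using e =≫ t

theorem post15 {X Y B1 B2 B3 B4 Z : C} {f1 : X ⟶ Y} {g1 : X ⟶ B1} {g2 : B1 ⟶ B2} {g3 : B2 ⟶ B3}
    {g4 : B3 ⟶ B4} {g5 : B4 ⟶ Y} {t : Y ⟶ Z} (e : f1 = g1 ≫ g2 ≫ g3 ≫ g4 ≫ g5) : f1 ≫ t = g1 ≫ g2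
    ≫ g3 ≫ g4 ≫ g5 ≫ t := by simpa using e =≫ t

theorem post16 {X Y B1 B2 B3 B4 B5 Z : C} {f1 : X ⟶ Y} {g1 : X ⟶ B1} {g2 : B1 ⟶ B2} {g3 : B2 ⟶ B3}
    {g4 : B3 ⟶ B4} {g5 : B4 ⟶ B5} {g6 : B5 ⟶ Y} {t : Y ⟶ Z} (e : f1 = g1 ≫ g2 ≫ g3 ≫ g4 ≫ g5 ≫ g6)
    : f1 ≫ t = g1 ≫ g2 ≫ g3 ≫ g4 ≫ g5 ≫ g6 ≫ t := by simpa using e =≫ t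

theorem post20 {X A1 Z : C} {f1 : X ⟶ A1} {f2 : A1 ⟶ X} {t : X ⟶ Z} (e : f1 ≫ f2 = 𝟙 _) : f1 ≫ f2
    ≫ t = t := by simpa using e =≫ t

theorem post21 {X A1 Y Z : C} {f1 : X ⟶ A1} {f2 : A1 ⟶ Y} {g1 : X ⟶ Y} {t : Y ⟶ Z} (e : f1 ≫ f2 =
    g1) : f1 ≫ f2 ≫ t = g1 ≫ t := by simpa using e =≫ t

theorem post22 {X A1 Y B1 Z : C} {f1 : X ⟶ A1} {f2 : A1 ⟶ Y} {g1 : X ⟶ B1} {g2 : B1 ⟶ Y} {t : Y ⟶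
    Z} (e : f1 ≫ f2 = g1 ≫ g2) : f1 ≫ f2 ≫ t = g1 ≫ g2 ≫ t := by simpa using e =≫ t

theorem post23 {X A1 Y B1 B2 Z : C} {f1 : X ⟶ A1} {f2 : A1 ⟶ Y} {g1 : X ⟶ B1} {g2 : B1 ⟶ B2} {g3 :
    B2 ⟶ Y} {t : Y ⟶ Z} (e : f1 ≫ f2 = g1 ≫ g2 ≫ g3) : f1 ≫ f2 ≫ t = g1 ≫ g2 ≫ g3 ≫ t := by simpa
    using e =≫ t

theorem post24 {X A1 Y B1 B2 B3 Z : C} {f1 : X ⟶ A1} {f2 : A1 ⟶ Y} {g1 : X ⟶ B1} {g2 : B1 ⟶ B2}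
    {g3 : B2 ⟶ B3} {g4 : B3 ⟶ Y} {t : Y ⟶ Z} (e : f1 ≫ f2 = g1 ≫ g2 ≫ g3 ≫ g4) : f1 ≫ f2 ≫ t = g1
    ≫ g2 ≫ g3 ≫ g4 ≫ t := by simpa using e =≫ t

theorem post25 {X A1 Y B1 B2 B3 B4 Z : C} {f1 : X ⟶ A1} {f2 : A1 ⟶ Y} {g1 : X ⟶ B1} {g2 : B1 ⟶ B2}
    {g3 : B2 ⟶ B3} {g4 : B3 ⟶ B4} {g5 : B4 ⟶ Y} {t : Y ⟶ Z} (e : f1 ≫ f2 = g1 ≫ g2 ≫ g3 ≫ g4 ≫ g5)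
    : f1 ≫ f2 ≫ t = g1 ≫ g2 ≫ g3 ≫ g4 ≫ g5 ≫ t := by simpa using e =≫ t

theorem post31 {X A1 A2 Y Z : C} {f1 : X ⟶ A1} {f2 : A1 ⟶ A2} {f3 : A2 ⟶ Y} {g1 : X ⟶ Y} {t : Y ⟶
    Z} (e : f1 ≫ f2 ≫ f3 = g1) : f1 ≫ f2 ≫ f3 ≫ t = g1 ≫ t := by simpa using e =≫ t

theorem post32 {X A1 A2 Y B1 Z : C} {f1 : X ⟶ A1} {f2 : A1 ⟶ A2} {f3 : A2 ⟶ Y} {g1 : X ⟶ B1} {g2 :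
    B1 ⟶ Y} {t : Y ⟶ Z} (e : f1 ≫ f2 ≫ f3 = g1 ≫ g2) : f1 ≫ f2 ≫ f3 ≫ t = g1 ≫ g2 ≫ t := by simpa
    using e =≫ t

theorem post33 {X A1 A2 Y B1 B2 Z : C} {f1 : X ⟶ A1} {f2 : A1 ⟶ A2} {f3 : A2 ⟶ Y} {g1 : X ⟶ B1}
    {g2 : B1 ⟶ B2} {g3 : B2 ⟶ Y} {t : Y ⟶ Z} (e : f1 ≫ f2 ≫ f3 = g1 ≫ g2 ≫ g3) : f1 ≫ f2 ≫ f3 ≫ t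
    = g1 ≫ g2 ≫ g3 ≫ t := by simpa using e =≫ t

theorem post42 {X A1 A2 A3 Y B1 Z : C} {f1 : X ⟶ A1} {f2 : A1 ⟶ A2} {f3 : A2 ⟶ A3} {f4 : A3 ⟶ Y}
    {g1 : X ⟶ B1} {g2 : B1 ⟶ Y} {t : Y ⟶ Z} (e : f1 ≫ f2 ≫ f3 ≫ f4 = g1 ≫ g2) : f1 ≫ f2 ≫ f3 ≫ f4
    ≫ t = g1 ≫ g2 ≫ t := by simpa using e =≫ t

theorem post63 {X A1 A2 A3 A4 A5 Y B1 B2 Z : C} {f1 : X ⟶ A1} {f2 : A1 ⟶ A2} {f3 : A2 ⟶ A3} {f4 :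
    A3 ⟶ A4} {f5 : A4 ⟶ A5} {f6 : A5 ⟶ Y} {g1 : X ⟶ B1} {g2 : B1 ⟶ B2} {g3 : B2 ⟶ Y} {t : Y ⟶ Z}
    (e : f1 ≫ f2 ≫ f3 ≫ f4 ≫ f5 ≫ f6 = g1 ≫ g2 ≫ g3) : f1 ≫ f2 ≫ f3 ≫ f4 ≫ f5 ≫ f6 ≫ t = g1 ≫ g2 ≫
    g3 ≫ t := by simpa using e =≫ t

theorem post72 {X A1 A2 A3 A4 A5 A6 Y B1 Z : C} {f1 : X ⟶ A1} {f2 : A1 ⟶ A2} {f3 : A2 ⟶ A3} {f4 :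
    A3 ⟶ A4} {f5 : A4 ⟶ A5} {f6 : A5 ⟶ A6} {f7 : A6 ⟶ Y} {g1 : X ⟶ B1} {g2 : B1 ⟶ Y} {t : Y ⟶ Z}
    (e : f1 ≫ f2 ≫ f3 ≫ f4 ≫ f5 ≫ f6 ≫ f7 = g1 ≫ g2) : f1 ≫ f2 ≫ f3 ≫ f4 ≫ f5 ≫ f6 ≫ f7 ≫ t = g1 ≫
    g2 ≫ t := by simpa using e =≫ t

theorem post94 {X A1 A2 A3 A4 A5 A6 A7 A8 Y B1 B2 B3 Z : C} {f1 : X ⟶ A1} {f2 : A1 ⟶ A2} {f3 : A2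
    ⟶ A3} {f4 : A3 ⟶ A4} {f5 : A4 ⟶ A5} {f6 : A5 ⟶ A6} {f7 : A6 ⟶ A7} {f8 : A7 ⟶ A8} {f9 : A8 ⟶ Y}
    {g1 : X ⟶ B1} {g2 : B1 ⟶ B2} {g3 : B2 ⟶ B3} {g4 : B3 ⟶ Y} {t : Y ⟶ Z} (e : f1 ≫ f2 ≫ f3 ≫ f4 ≫
    f5 ≫ f6 ≫ f7 ≫ f8 ≫ f9 = g1 ≫ g2 ≫ g3 ≫ g4) : f1 ≫ f2 ≫ f3 ≫ f4 ≫ f5 ≫ f6 ≫ f7 ≫ f8 ≫ f9 ≫ t =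
    g1 ≫ g2 ≫ g3 ≫ g4 ≫ t := by simpa using e =≫ t

theorem post1310 {X A1 A2 A3 A4 A5 A6 A7 A8 A9 A10 A11 A12 Y B1 B2 B3 B4 B5 B6 B7 B8 B9 Z : C} {f1
    : X ⟶ A1} {f2 : A1 ⟶ A2} {f3 : A2 ⟶ A3} {f4 : A3 ⟶ A4} {f5 : A4 ⟶ A5} {f6 : A5 ⟶ A6} {f7 : A6
    ⟶ A7} {f8 : A7 ⟶ A8} {f9 : A8 ⟶ A9} {f10 : A9 ⟶ A10} {f11 : A10 ⟶ A11} {f12 : A11 ⟶ A12} {f13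
    : A12 ⟶ Y} {g1 : X ⟶ B1} {g2 : B1 ⟶ B2} {g3 : B2 ⟶ B3} {g4 : B3 ⟶ B4} {g5 : B4 ⟶ B5} {g6 : B5
    ⟶ B6} {g7 : B6 ⟶ B7} {g8 : B7 ⟶ B8} {g9 : B8 ⟶ B9} {g10 : B9 ⟶ Y} {t : Y ⟶ Z} (e : f1 ≫ f2 ≫
    f3 ≫ f4 ≫ f5 ≫ f6 ≫ f7 ≫ f8 ≫ f9 ≫ f10 ≫ f11 ≫ f12 ≫ f13 = g1 ≫ g2 ≫ g3 ≫ g4 ≫ g5 ≫ g6 ≫ g7 ≫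
    g8 ≫ g9 ≫ g10) : f1 ≫ f2 ≫ f3 ≫ f4 ≫ f5 ≫ f6 ≫ f7 ≫ f8 ≫ f9 ≫ f10 ≫ f11 ≫ f12 ≫ f13 ≫ t = g1 ≫
    g2 ≫ g3 ≫ g4 ≫ g5 ≫ g6 ≫ g7 ≫ g8 ≫ g9 ≫ g10 ≫ t := by simpa using e =≫ t

theorem end02 {X Y A : C} {f : X ⟶ Y} {g₁ : Y ⟶ A} {g₂ : A ⟶ Y} (e : 𝟙 _ = g₁ ≫ g₂) :
    f = f ≫ g₁ ≫ g₂ := by simp [← e]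

theorem end20 {X Y A : C} {f : X ⟶ Y} {g₁ : Y ⟶ A} {g₂ : A ⟶ Y} (e : g₁ ≫ g₂ = 𝟙 _) :
    f ≫ g₁ ≫ g₂ = f := by simp [e]

theorem pre2 {A0 A1 A2 Y : C} {f1 : A0 ⟶ A1} {f2 : A1 ⟶ A2} {g h : A2 ⟶ Y} (e : g = h) : f1 ≫ f2 ≫
    g = f1 ≫ f2 ≫ h := e ▸ rfl

theorem pre3 {A0 A1 A2 A3 Y : C} {f1 : A0 ⟶ A1} {f2 : A1 ⟶ A2} {f3 : A2 ⟶ A3} {g h : A3 ⟶ Y} (e :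
    g = h) : f1 ≫ f2 ≫ f3 ≫ g = f1 ≫ f2 ≫ f3 ≫ h := e ▸ rfl

theorem pre4 {A0 A1 A2 A3 A4 Y : C} {f1 : A0 ⟶ A1} {f2 : A1 ⟶ A2} {f3 : A2 ⟶ A3} {f4 : A3 ⟶ A4} {g
    h : A4 ⟶ Y} (e : g = h) : f1 ≫ f2 ≫ f3 ≫ f4 ≫ g = f1 ≫ f2 ≫ f3 ≫ f4 ≫ h := e ▸ rfl

theorem pre5 {A0 A1 A2 A3 A4 A5 Y : C} {f1 : A0 ⟶ A1} {f2 : A1 ⟶ A2} {f3 : A2 ⟶ A3} {f4 : A3 ⟶ A4}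
    {f5 : A4 ⟶ A5} {g h : A5 ⟶ Y} (e : g = h) : f1 ≫ f2 ≫ f3 ≫ f4 ≫ f5 ≫ g = f1 ≫ f2 ≫ f3 ≫ f4 ≫
    f5 ≫ h := e ▸ rfl

theorem pre6 {A0 A1 A2 A3 A4 A5 A6 Y : C} {f1 : A0 ⟶ A1} {f2 : A1 ⟶ A2} {f3 : A2 ⟶ A3} {f4 : A3 ⟶
    A4} {f5 : A4 ⟶ A5} {f6 : A5 ⟶ A6} {g h : A6 ⟶ Y} (e : g = h) : f1 ≫ f2 ≫ f3 ≫ f4 ≫ f5 ≫ f6 ≫ g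
    = f1 ≫ f2 ≫ f3 ≫ f4 ≫ f5 ≫ f6 ≫ h := e ▸ rfl

theorem pre7 {A0 A1 A2 A3 A4 A5 A6 A7 Y : C} {f1 : A0 ⟶ A1} {f2 : A1 ⟶ A2} {f3 : A2 ⟶ A3} {f4 : A3
    ⟶ A4} {f5 : A4 ⟶ A5} {f6 : A5 ⟶ A6} {f7 : A6 ⟶ A7} {g h : A7 ⟶ Y} (e : g = h) : f1 ≫ f2 ≫ f3 ≫
    f4 ≫ f5 ≫ f6 ≫ f7 ≫ g = f1 ≫ f2 ≫ f3 ≫ f4 ≫ f5 ≫ f6 ≫ f7 ≫ h := e ▸ rfl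

theorem pre8 {A0 A1 A2 A3 A4 A5 A6 A7 A8 Y : C} {f1 : A0 ⟶ A1} {f2 : A1 ⟶ A2} {f3 : A2 ⟶ A3} {f4 :
    A3 ⟶ A4} {f5 : A4 ⟶ A5} {f6 : A5 ⟶ A6} {f7 : A6 ⟶ A7} {f8 : A7 ⟶ A8} {g h : A8 ⟶ Y} (e : g =
    h) : f1 ≫ f2 ≫ f3 ≫ f4 ≫ f5 ≫ f6 ≫ f7 ≫ f8 ≫ g = f1 ≫ f2 ≫ f3 ≫ f4 ≫ f5 ≫ f6 ≫ f7 ≫ f8 ≫ h :=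
    e ▸ rfl

theorem pre9 {A0 A1 A2 A3 A4 A5 A6 A7 A8 A9 Y : C} {f1 : A0 ⟶ A1} {f2 : A1 ⟶ A2} {f3 : A2 ⟶ A3}
    {f4 : A3 ⟶ A4} {f5 : A4 ⟶ A5} {f6 : A5 ⟶ A6} {f7 : A6 ⟶ A7} {f8 : A7 ⟶ A8} {f9 : A8 ⟶ A9} {g h
    : A9 ⟶ Y} (e : g = h) : f1 ≫ f2 ≫ f3 ≫ f4 ≫ f5 ≫ f6 ≫ f7 ≫ f8 ≫ f9 ≫ g = f1 ≫ f2 ≫ f3 ≫ f4 ≫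
    f5 ≫ f6 ≫ f7 ≫ f8 ≫ f9 ≫ h := e ▸ rfl

end Composition

section Whiskering

open CategoryTheory MonoidalCategory

variable {C : Type u₁} [Category.{v₁} C] [MonoidalCategory C]

/-- Carries an equation between composites of the given lengths under one more tensor factor on the
left. Factors on the right need no such lemma, since they are absorbed into the arbitrary last
factor `W`. -/
theorem whisker02 {V X B1 : C} {g1 : X ⟶ B1} {g2 : B1 ⟶ X} (e : 𝟙 _ = g1 ≫ g2) : 𝟙 _ = V ◁ g1 ≫ V
    ◁ g2 := by simpa using congrArg (V ◁ ·) e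

theorem whisker13 {V X Y B1 B2 : C} {f1 : X ⟶ Y} {g1 : X ⟶ B1} {g2 : B1 ⟶ B2} {g3 : B2 ⟶ Y} (e :
    f1 = g1 ≫ g2 ≫ g3) : V ◁ f1 = V ◁ g1 ≫ V ◁ g2 ≫ V ◁ g3 := by simpa using congrArg (V ◁ ·) e

theorem whisker20 {V X A1 : C} {f1 : X ⟶ A1} {f2 : A1 ⟶ X} (e : f1 ≫ f2 = 𝟙 _) : V ◁ f1 ≫ V ◁ f2 =
    𝟙 _ := by simpa using congrArg (V ◁ ·) e

theorem whisker21 {V X A1 Y : C} {f1 : X ⟶ A1} {f2 : A1 ⟶ Y} {g1 : X ⟶ Y} (e : f1 ≫ f2 = g1) : V ◁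
    f1 ≫ V ◁ f2 = V ◁ g1 := by simpa using congrArg (V ◁ ·) e

theorem whisker22 {V X A1 Y B1 : C} {f1 : X ⟶ A1} {f2 : A1 ⟶ Y} {g1 : X ⟶ B1} {g2 : B1 ⟶ Y} (e :
    f1 ≫ f2 = g1 ≫ g2) : V ◁ f1 ≫ V ◁ f2 = V ◁ g1 ≫ V ◁ g2 := by simpa using congrArg (V ◁ ·) e

theorem whisker23 {V X A1 Y B1 B2 : C} {f1 : X ⟶ A1} {f2 : A1 ⟶ Y} {g1 : X ⟶ B1} {g2 : B1 ⟶ B2}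
    {g3 : B2 ⟶ Y} (e : f1 ≫ f2 = g1 ≫ g2 ≫ g3) : V ◁ f1 ≫ V ◁ f2 = V ◁ g1 ≫ V ◁ g2 ≫ V ◁ g3 := by
    simpa using congrArg (V ◁ ·) e

theorem whisker24 {V X A1 Y B1 B2 B3 : C} {f1 : X ⟶ A1} {f2 : A1 ⟶ Y} {g1 : X ⟶ B1} {g2 : B1 ⟶ B2}
    {g3 : B2 ⟶ B3} {g4 : B3 ⟶ Y} (e : f1 ≫ f2 = g1 ≫ g2 ≫ g3 ≫ g4) : V ◁ f1 ≫ V ◁ f2 = V ◁ g1 ≫ V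
    ◁ g2 ≫ V ◁ g3 ≫ V ◁ g4 := by simpa using congrArg (V ◁ ·) e

theorem whisker25 {V X A1 Y B1 B2 B3 B4 : C} {f1 : X ⟶ A1} {f2 : A1 ⟶ Y} {g1 : X ⟶ B1} {g2 : B1 ⟶
    B2} {g3 : B2 ⟶ B3} {g4 : B3 ⟶ B4} {g5 : B4 ⟶ Y} (e : f1 ≫ f2 = g1 ≫ g2 ≫ g3 ≫ g4 ≫ g5) : V ◁
    f1 ≫ V ◁ f2 = V ◁ g1 ≫ V ◁ g2 ≫ V ◁ g3 ≫ V ◁ g4 ≫ V ◁ g5 := by simpa using congrArg (V ◁ ·) e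

theorem whisker31 {V X A1 A2 Y : C} {f1 : X ⟶ A1} {f2 : A1 ⟶ A2} {f3 : A2 ⟶ Y} {g1 : X ⟶ Y} (e :
    f1 ≫ f2 ≫ f3 = g1) : V ◁ f1 ≫ V ◁ f2 ≫ V ◁ f3 = V ◁ g1 := by simpa using congrArg (V ◁ ·) e

theorem whisker32 {V X A1 A2 Y B1 : C} {f1 : X ⟶ A1} {f2 : A1 ⟶ A2} {f3 : A2 ⟶ Y} {g1 : X ⟶ B1}
    {g2 : B1 ⟶ Y} (e : f1 ≫ f2 ≫ f3 = g1 ≫ g2) : V ◁ f1 ≫ V ◁ f2 ≫ V ◁ f3 = V ◁ g1 ≫ V ◁ g2 := by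
    simpa using congrArg (V ◁ ·) e

theorem whisker33 {V X A1 A2 Y B1 B2 : C} {f1 : X ⟶ A1} {f2 : A1 ⟶ A2} {f3 : A2 ⟶ Y} {g1 : X ⟶ B1}
    {g2 : B1 ⟶ B2} {g3 : B2 ⟶ Y} (e : f1 ≫ f2 ≫ f3 = g1 ≫ g2 ≫ g3) : V ◁ f1 ≫ V ◁ f2 ≫ V ◁ f3 = V
    ◁ g1 ≫ V ◁ g2 ≫ V ◁ g3 := by simpa using congrArg (V ◁ ·) e

theorem whisker42 {V X A1 A2 A3 Y B1 : C} {f1 : X ⟶ A1} {f2 : A1 ⟶ A2} {f3 : A2 ⟶ A3} {f4 : A3 ⟶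
    Y} {g1 : X ⟶ B1} {g2 : B1 ⟶ Y} (e : f1 ≫ f2 ≫ f3 ≫ f4 = g1 ≫ g2) : V ◁ f1 ≫ V ◁ f2 ≫ V ◁ f3 ≫
    V ◁ f4 = V ◁ g1 ≫ V ◁ g2 := by simpa using congrArg (V ◁ ·) e

theorem whisker63 {V X A1 A2 A3 A4 A5 Y B1 B2 : C} {f1 : X ⟶ A1} {f2 : A1 ⟶ A2} {f3 : A2 ⟶ A3} {f4
    : A3 ⟶ A4} {f5 : A4 ⟶ A5} {f6 : A5 ⟶ Y} {g1 : X ⟶ B1} {g2 : B1 ⟶ B2} {g3 : B2 ⟶ Y} (e : f1 ≫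
    f2 ≫ f3 ≫ f4 ≫ f5 ≫ f6 = g1 ≫ g2 ≫ g3) : V ◁ f1 ≫ V ◁ f2 ≫ V ◁ f3 ≫ V ◁ f4 ≫ V ◁ f5 ≫ V ◁ f6 =
    V ◁ g1 ≫ V ◁ g2 ≫ V ◁ g3 := by simpa using congrArg (V ◁ ·) e

end Whiskering

/-! ### Naturality of the braiding on the first factors -/

section Braid

open CategoryTheory MonoidalCategory

variable {C : Type u₁} [Category.{v₁} C] [MonoidalCategory C] [BraidedCategory C]

/-- The braiding of the first two factors. -/
abbrev swap (X Y W : C) : X ⊗ (Y ⊗ W) ⟶ Y ⊗ (X ⊗ W) := box22 (β_ X Y).hom W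

/-- The inverse braiding of the first two factors. -/
abbrev swapInv (X Y W : C) : X ⊗ (Y ⊗ W) ⟶ Y ⊗ (X ⊗ W) := box22 (β_ Y X).inv W

/-- Naturality of the braiding, where the hexagon axioms split a crossing with two factors into two
crossings and a crossing with the unit object is trivial. In `swap_left` the strand `X` starts to
the left of the box `f`, in `swap_right` to its right; the digits are those of the box. -/
theorem swap_left01 {A' X W : C} {f : 𝟙_ C ⟶ A'} : box01 f (X ⊗ W) = X ◁ box01 f W ≫ swap X A' W
    := by
  calc
    _ = 𝟙 _ ⊗≫ ((β_ X (𝟙_ C)).hom ≫ f ▷ X) ▷ W ⊗≫ 𝟙 _ := by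
      simp only [box01, braiding_tensorUnit_right]; monoidal
    _ = _ := by rw [← BraidedCategory.braiding_naturality_right]; simp only [box01, box22]; monoidal

theorem swap_right01 {A' X W : C} {f : 𝟙_ C ⟶ A'} : X ◁ box01 f W = box01 f (X ⊗ W) ≫ swap A' X W
    := by
  calc
    _ = 𝟙 _ ⊗≫ ((β_ (𝟙_ C) X).hom ≫ X ◁ f) ▷ W ⊗≫ 𝟙 _ := by
      simp only [box01, braiding_tensorUnit_left]; monoidal
    _ = _ := by rw [← BraidedCategory.braiding_naturality_left]; simp only [box01, box22]; monoidal

theorem swap_left10 {A X W : C} {f : A ⟶ 𝟙_ C} : swap X A W ≫ box10 f (X ⊗ W) = X ◁ box10 f W :=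
    by
  calc
    _ = 𝟙 _ ⊗≫ ((β_ X A).hom ≫ f ▷ X) ▷ W ⊗≫ 𝟙 _ := by
      simp only [box10, box22]; monoidal
    _ = _ := by
      rw [← BraidedCategory.braiding_naturality_right]
      simp only [box10, braiding_tensorUnit_right]
      monoidal

theorem swap_left11 {A A' X W : C} {f : A ⟶ A'} : swap X A W ≫ box11 f (X ⊗ W) = X ◁ box11 f W ≫
    swap X A' W := by
  calc
    _ = 𝟙 _ ⊗≫ ((β_ X A).hom ≫ f ▷ X) ▷ W ⊗≫ 𝟙 _ := by
      simp only [box11, box22]; monoidal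
    _ = _ := by rw [← BraidedCategory.braiding_naturality_right]; simp only [box11, box22]; monoidal

theorem swap_right11 {A A' X W : C} {f : A ⟶ A'} : swap A X W ≫ X ◁ box11 f W = box11 f (X ⊗ W) ≫
    swap A' X W := by
  calc
    _ = 𝟙 _ ⊗≫ ((β_ A X).hom ≫ X ◁ f) ▷ W ⊗≫ 𝟙 _ := by
      simp only [box11, box22]; monoidal
    _ = _ := by rw [← BraidedCategory.braiding_naturality_left]; simp only [box11, box22]; monoidal

theorem swap_left12 {A A' B' X W : C} {f : A ⟶ A' ⊗ B'} : swap X A W ≫ box12 f (X ⊗ W) = X ◁ box12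
    f W ≫ swap X A' (B' ⊗ W) ≫ A' ◁ (swap X B' W) := by
  calc
    _ = 𝟙 _ ⊗≫ ((β_ X A).hom ≫ f ▷ X) ▷ W ⊗≫ 𝟙 _ := by
      simp only [box12, box22]; monoidal
    _ = _ := by
      rw [← BraidedCategory.braiding_naturality_right]
      simp only [box12, box22, BraidedCategory.braiding_tensor_right_hom]
      monoidal

theorem swap_right12 {A A' B' X W : C} {f : A ⟶ A' ⊗ B'} : swap A X W ≫ X ◁ box12 f W = box12 f (X
    ⊗ W) ≫ A' ◁ (swap B' X W) ≫ swap A' X (B' ⊗ W) := by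
  calc
    _ = 𝟙 _ ⊗≫ ((β_ A X).hom ≫ X ◁ f) ▷ W ⊗≫ 𝟙 _ := by
      simp only [box12, box22]; monoidal
    _ = _ := by
      rw [← BraidedCategory.braiding_naturality_left]
      simp only [box12, box22, BraidedCategory.braiding_tensor_left_hom]
      monoidal

theorem swap_left21 {A B A' X W : C} {f : A ⊗ B ⟶ A'} : swap X A (B ⊗ W) ≫ A ◁ (swap X B W) ≫
    box21 f (X ⊗ W) = X ◁ box21 f W ≫ swap X A' W := by
  calc
    _ = 𝟙 _ ⊗≫ ((β_ X (A ⊗ B)).hom ≫ f ▷ X) ▷ W ⊗≫ 𝟙 _ := by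
      simp only [box21, box22, BraidedCategory.braiding_tensor_right_hom]; monoidal
    _ = _ := by rw [← BraidedCategory.braiding_naturality_right]; simp only [box21, box22]; monoidal

theorem swap_right21 {A B A' X W : C} {f : A ⊗ B ⟶ A'} : A ◁ (swap B X W) ≫ swap A X (B ⊗ W) ≫ X ◁
    box21 f W = box21 f (X ⊗ W) ≫ swap A' X W := by
  calc
    _ = 𝟙 _ ⊗≫ ((β_ (A ⊗ B) X).hom ≫ X ◁ f) ▷ W ⊗≫ 𝟙 _ := by
      simp only [box21, box22, BraidedCategory.braiding_tensor_left_hom]; monoidal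
    _ = _ := by rw [← BraidedCategory.braiding_naturality_left]; simp only [box21, box22]; monoidal

theorem swap_left02 {A' B' X W : C} {f : 𝟙_ C ⟶ A' ⊗ B'} : box02 f (X ⊗ W) = X ◁ box02 f W ≫ swap
    X A' (B' ⊗ W) ≫ A' ◁ (swap X B' W) := by
  calc
    _ = 𝟙 _ ⊗≫ ((β_ X (𝟙_ C)).hom ≫ f ▷ X) ▷ W ⊗≫ 𝟙 _ := by
      simp only [box02, braiding_tensorUnit_right]; monoidal
    _ = _ := by
      rw [← BraidedCategory.braiding_naturality_right]
      simp only [box02, box22, BraidedCategory.braiding_tensor_right_hom]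
      monoidal

theorem swap_right02 {A' B' X W : C} {f : 𝟙_ C ⟶ A' ⊗ B'} : X ◁ box02 f W = box02 f (X ⊗ W) ≫ A' ◁
    (swap B' X W) ≫ swap A' X (B' ⊗ W) := by
  calc
    _ = 𝟙 _ ⊗≫ ((β_ (𝟙_ C) X).hom ≫ X ◁ f) ▷ W ⊗≫ 𝟙 _ := by
      simp only [box02, braiding_tensorUnit_left]; monoidal
    _ = _ := by
      rw [← BraidedCategory.braiding_naturality_left]
      simp only [box02, box22, BraidedCategory.braiding_tensor_left_hom]
      monoidal

theorem swap_left20 {A B X W : C} {f : A ⊗ B ⟶ 𝟙_ C} : swap X A (B ⊗ W) ≫ A ◁ (swap X B W) ≫ box20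
    f (X ⊗ W) = X ◁ box20 f W := by
  calc
    _ = 𝟙 _ ⊗≫ ((β_ X (A ⊗ B)).hom ≫ f ▷ X) ▷ W ⊗≫ 𝟙 _ := by
      simp only [box20, box22, BraidedCategory.braiding_tensor_right_hom]; monoidal
    _ = _ := by
      rw [← BraidedCategory.braiding_naturality_right]
      simp only [box20, braiding_tensorUnit_right]
      monoidal

theorem swap_right20 {A B X W : C} {f : A ⊗ B ⟶ 𝟙_ C} : A ◁ (swap B X W) ≫ swap A X (B ⊗ W) ≫ X ◁
    box20 f W = box20 f (X ⊗ W) := by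
  calc
    _ = 𝟙 _ ⊗≫ ((β_ (A ⊗ B) X).hom ≫ X ◁ f) ▷ W ⊗≫ 𝟙 _ := by
      simp only [box20, box22, BraidedCategory.braiding_tensor_left_hom]; monoidal
    _ = _ := by
      rw [← BraidedCategory.braiding_naturality_left]
      simp only [box20, braiding_tensorUnit_left]
      monoidal

theorem swap_left22 {A B A' B' X W : C} {f : A ⊗ B ⟶ A' ⊗ B'} : swap X A (B ⊗ W) ≫ A ◁ (swap X B
    W) ≫ box22 f (X ⊗ W) = X ◁ box22 f W ≫ swap X A' (B' ⊗ W) ≫ A' ◁ (swap X B' W) := by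
  calc
    _ = 𝟙 _ ⊗≫ ((β_ X (A ⊗ B)).hom ≫ f ▷ X) ▷ W ⊗≫ 𝟙 _ := by
      simp only [box22, BraidedCategory.braiding_tensor_right_hom]; monoidal
    _ = _ := by
      rw [← BraidedCategory.braiding_naturality_right]
      simp only [box22, BraidedCategory.braiding_tensor_right_hom]
      monoidal

theorem swap_right22 {A B A' B' X W : C} {f : A ⊗ B ⟶ A' ⊗ B'} : A ◁ (swap B X W) ≫ swap A X (B ⊗
    W) ≫ X ◁ box22 f W = box22 f (X ⊗ W) ≫ A' ◁ (swap B' X W) ≫ swap A' X (B' ⊗ W) := by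
  calc
    _ = 𝟙 _ ⊗≫ ((β_ (A ⊗ B) X).hom ≫ X ◁ f) ▷ W ⊗≫ 𝟙 _ := by
      simp only [box22, BraidedCategory.braiding_tensor_left_hom]; monoidal
    _ = _ := by
      rw [← BraidedCategory.braiding_naturality_left]
      simp only [box22, BraidedCategory.braiding_tensor_left_hom]
      monoidal

end Braid

end BraidedDuality

namespace BraidedDuality

universe v₁ u₁

/-! ### The structure maps, and the axioms as rewriting rules -/

section Axioms

open CategoryTheory MonoidalCategory
open scoped MonObj ComonObj HopfObj

set_option linter.unusedSectionVars false

variable {C : Type u₁} [Category.{v₁} C] [MonoidalCategory C] [BraidedCategory C]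

/-- The braiding of `H` with itself is its own inverse. -/
class SelfSymmetric (H : C) : Prop where
  braiding_braiding : (β_ H H).hom ≫ (β_ H H).hom = 𝟙 _

/-- An action of the Hopf algebra `H` that makes the algebra `R` a module algebra. -/
class ModuleAlgebra (H R : C) [HopfObj H] [MonObj R] where
  /-- the action -/
  act (H R) : H ⊗ R ⟶ R
  isModuleAlgebra : IsModuleAlgebra μ[H] η[H] Δ[H] ε[H] μ[R] η[R] act

/-- The map `h ⊗ r ↦ h₁ r ⊗ h₂`, the commutation relation of the smash product. -/
def entwine (H R : C) [HopfObj H] [MonObj R] [ModuleAlgebra H R] : H ⊗ R ⟶ R ⊗ H :=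
  Δ[H] ▷ R ⊗≫ H ◁ (β_ H R).hom ⊗≫ ModuleAlgebra.act H R ▷ H

/-- The inverse of `entwine`. -/
noncomputable def entwineInv (H R : C) [HopfObj H] [IsIso 𝒮[H]] [MonObj R] [ModuleAlgebra H R] :
    R ⊗ H ⟶ H ⊗ R :=
  (β_ H R).inv ≫ Δ[H] ▷ R ≫ (β_ H H).hom ▷ R ⊗≫ H ◁ inv 𝒮[H] ▷ R ⊗≫ H ◁ ModuleAlgebra.act H R

/-- The map `h ⊗ f ↦ ∑ h (f ⇀ bᵢ) ⊗ bⁱ`, where `∑ bᵢ ⊗ bⁱ` is the coevaluation. -/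
def actDual (H Hd : C) [HopfObj H] [ExactPairing H Hd] : H ⊗ Hd ⟶ H ⊗ Hd :=
  𝟙 _ ⊗≫ (H ⊗ Hd) ◁ η_ H Hd ⊗≫ H ◁ hatAct H Hd ▷ Hd ⊗≫ μ[H] ▷ Hd

/-- The inverse of `actDual`. -/
noncomputable def actDualInv (H Hd : C) [HopfObj H] [IsIso 𝒮[H]] [ExactPairing H Hd] :
    H ⊗ Hd ⟶ H ⊗ Hd :=
  𝟙 _ ⊗≫ (H ⊗ Hd) ◁ η_ H Hd ⊗≫ (H ⊗ Hd) ◁ Δ[H] ▷ Hd ⊗≫ H ◁ (β_ Hd H).hom ▷ (H ⊗ Hd) ⊗≫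
    H ◁ inv 𝒮[H] ▷ (Hd ⊗ H ⊗ Hd) ⊗≫ (H ⊗ H) ◁ ε_ H Hd ▷ Hd ⊗≫ μ[H] ▷ Hd

/-- The action of `H` on the dual through the antipode. -/
def dualAct (H Hd : C) [HopfObj H] [ExactPairing H Hd] : H ⊗ Hd ⟶ Hd :=
  (β_ H Hd).hom ≫ Hd ◁ 𝒮[H] ⊗≫ (Hd ⊗ H) ◁ η_ H Hd ⊗≫ Hd ◁ μ[H] ▷ Hd ⊗≫ ε_ H Hd ▷ Hd ⊗≫ 𝟙 _

/-- The coaction of `H` on the dual. -/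
def dualCoact (H Hd : C) [HopfObj H] [ExactPairing H Hd] : Hd ⟶ H ⊗ Hd :=
  𝟙 _ ⊗≫ Hd ◁ η_ H Hd ⊗≫ Hd ◁ Δ[H] ▷ Hd ⊗≫ ε_ H Hd ▷ (H ⊗ Hd) ⊗≫ 𝟙 _

/-- The projection of the dual onto the coinvariants. -/
def dualProj (H Hd : C) [HopfObj H] [ExactPairing H Hd] : Hd ⟶ Hd :=
  dualCoact H Hd ≫ 𝒮[H] ▷ Hd ≫ dualAct H Hd

/-- The `tail_` lemmas up to `tail_act_one` are mostly the axioms of algebras, Hopf algebras, dual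
pairs and module algebras tensored with `W`; the associators are hidden in the boxes, so that only
genuine moves remain in a calculation. -/
theorem tail_mul_mul {M W : C} [MonObj M] :
    M ◁ box21 μ[M] W ≫ box21 μ[M] W = box21 μ[M] (M ⊗ W) ≫ box21 μ[M] W := by
  calc
    _ = 𝟙 _ ⊗≫ ((α_ M M M).hom ≫ M ◁ μ[M] ≫ μ[M]) ▷ W ⊗≫ 𝟙 _ := by simp only [box21]; monoidal
    _ = _ := by rw [← MonObj.mul_assoc]; simp only [box21]; monoidal

theorem tail_one_mul {M W : C} [MonObj M] : box01 η[M] (M ⊗ W) ≫ box21 μ[M] W = 𝟙 _ := by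
  calc
    _ = 𝟙 _ ⊗≫ (η[M] ▷ M ≫ μ[M]) ▷ W ⊗≫ 𝟙 _ := by simp only [box01, box21]; monoidal
    _ = _ := by rw [MonObj.one_mul]; monoidal

theorem tail_mul_one {M W : C} [MonObj M] : M ◁ box01 η[M] W ≫ box21 μ[M] W = 𝟙 _ := by
  calc
    _ = 𝟙 _ ⊗≫ (M ◁ η[M] ≫ μ[M]) ▷ W ⊗≫ 𝟙 _ := by simp only [box01, box21]; monoidal
    _ = _ := by rw [MonObj.mul_one]; monoidal

theorem box22_comp {X Y X' Y' X'' Y'' W : C} (f : X ⊗ Y ⟶ X' ⊗ Y') (g : X' ⊗ Y' ⟶ X'' ⊗ Y'') :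
    box22 f W ≫ box22 g W = box22 (f ≫ g) W := by
  simp [box22]

theorem box22_id {X Y W : C} : box22 (𝟙 (X ⊗ Y)) W = 𝟙 _ := by simp [box22]

theorem tail_swap_swapInv {X Y W : C} : swap X Y W ≫ swapInv Y X W = 𝟙 _ := by
  rw [box22_comp, Iso.hom_inv_id, box22_id]

theorem tail_swapInv_swap {X Y W : C} : swapInv X Y W ≫ swap Y X W = 𝟙 _ := by
  rw [box22_comp, Iso.inv_hom_id, box22_id]

theorem tail_swap_swap {W : C} {H : C} [SelfSymmetric H] : swap H H W ≫ swap H H W = 𝟙 _ := by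
  rw [box22_comp, SelfSymmetric.braiding_braiding, box22_id]

/-- If the braiding of `X` and `Y` is inverted by the braiding of `Y` and `X`, then conversely. -/
theorem swap_swap_symm {X Y : C} (h : ∀ W : C, swap X Y W ≫ swap Y X W = 𝟙 _) (W : C) :
    swap Y X W ≫ swap X Y W = 𝟙 _ := by
  have e : swap Y X W = swapInv Y X W := by
    
    calc
      _ = (swapInv Y X W ≫ swap X Y W) ≫ swap Y X W := by rw [tail_swapInv_swap, Category.id_comp]
      _ = _ := by rw [Category.assoc, h, Category.comp_id]
  rw [e, tail_swapInv_swap]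

variable {H Hd R : C} [HopfObj H] [ExactPairing H Hd] [MonObj R]


theorem tail_comul_comul {W : C} : box12 Δ[H] W ≫ _ ◁ (box12 Δ[H] _) = box12 Δ[H] _ ≫ box12 Δ[H] _
    := by
  calc
    _ = 𝟙 _ ⊗≫ (Δ[H] ≫ H ◁ Δ[H]) ▷ W ⊗≫ 𝟙 _ := by simp only [box12]; monoidal
    _ = _ := by rw [ComonObj.comul_assoc]; simp only [box12]; monoidal

theorem tail_comul_counit_left {W : C} : box12 Δ[H] W ≫ box10 ε[H] _ = 𝟙 _ := by
  calc
    _ = 𝟙 _ ⊗≫ (Δ[H] ≫ ε[H] ▷ H) ▷ W ⊗≫ 𝟙 _ := by simp only [box10, box12]; monoidal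
    _ = _ := by rw [ComonObj.counit_comul]; monoidal

theorem tail_comul_counit_right {W : C} : box12 Δ[H] W ≫ _ ◁ (box10 ε[H] _) = 𝟙 _ := by
  calc
    _ = 𝟙 _ ⊗≫ (Δ[H] ≫ H ◁ ε[H]) ▷ W ⊗≫ 𝟙 _ := by simp only [box10, box12]; monoidal
    _ = _ := by rw [ComonObj.comul_counit]; monoidal

theorem tail_mul_comul {W : C} : box21 μ[H] W ≫ box12 Δ[H] _ = _ ◁ (box12 Δ[H] _) ≫ box12 Δ[H] _ ≫
    _ ◁ (swap H H _) ≫ box21 μ[H] _ ≫ _ ◁ (box21 μ[H] _) := by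
  calc
    _ = 𝟙 _ ⊗≫ (μ[H] ≫ Δ[H]) ▷ W ⊗≫ 𝟙 _ := by simp only [box12, box21]; monoidal
    _ = _ := by
      rw [BimonObj.mul_comul, tensorμ, MonoidalCategory.tensorHom_def' Δ[H],
        MonoidalCategory.tensorHom_def]
      simp only [box12, box21, box22]
      monoidal

theorem tail_antipode_left {W : C} : box12 Δ[H] W ≫ box11 𝒮[H] _ ≫ box21 μ[H] _ = box10 ε[H] _ ≫
    box01 η[H] _ := by
  calc
    _ = 𝟙 _ ⊗≫ (Δ[H] ≫ 𝒮[H] ▷ H ≫ μ[H]) ▷ W ⊗≫ 𝟙 _ := by simp only [box11, box12, box21]; monoidal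
    _ = _ := by rw [HopfObj.antipode_left]; simp only [box01, box10]; monoidal

theorem tail_antipode_right {W : C} : box12 Δ[H] W ≫ _ ◁ (box11 𝒮[H] _) ≫ box21 μ[H] _ = box10
    ε[H] _ ≫ box01 η[H] _ := by
  calc
    _ = 𝟙 _ ⊗≫ (Δ[H] ≫ H ◁ 𝒮[H] ≫ μ[H]) ▷ W ⊗≫ 𝟙 _ := by simp only [box11, box12, box21]; monoidal
    _ = _ := by rw [HopfObj.antipode_right]; simp only [box01, box10]; monoidal

theorem tail_one_antipode {W : C} : box01 η[H] W ≫ box11 𝒮[H] _ = box01 η[H] _ := by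
  calc
    _ = 𝟙 _ ⊗≫ (η[H] ≫ 𝒮[H]) ▷ W ⊗≫ 𝟙 _ := by simp only [box01, box11]; monoidal
    _ = _ := by rw [HopfObj.one_antipode]; simp only [box01]; monoidal

theorem tail_antipode_comul {W : C} : box11 𝒮[H] W ≫ box12 Δ[H] _ = box12 Δ[H] _ ≫ swap H H _ ≫
    box11 𝒮[H] _ ≫ _ ◁ (box11 𝒮[H] _) := by
  calc
    _ = 𝟙 _ ⊗≫ (𝒮[H] ≫ Δ[H]) ▷ W ⊗≫ 𝟙 _ := by simp only [box11, box12]; monoidal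
    _ = _ := by
      rw [HopfObj.antipode_comul, MonoidalCategory.tensorHom_def]
      simp only [box11, box12, box22]
      monoidal

theorem tail_mul_antipode {W : C} : box21 μ[H] W ≫ box11 𝒮[H] _ = box11 𝒮[H] _ ≫ _ ◁ (box11 𝒮[H]
    _) ≫ swap H H _ ≫ box21 μ[H] _ := by
  calc
    _ = 𝟙 _ ⊗≫ (μ[H] ≫ 𝒮[H]) ▷ W ⊗≫ 𝟙 _ := by simp only [box11, box21]; monoidal
    _ = _ := by
      rw [HopfObj.mul_antipode, MonoidalCategory.tensorHom_def]
      simp only [box11, box21, box22]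
      monoidal

theorem tail_coevaluation_evaluation {W : C} : Hd ◁ (box02 (η_ H Hd) W) ≫ box20 (ε_ H Hd) _ = 𝟙 _
    := by
  calc
    _ = 𝟙 _ ⊗≫ (Hd ◁ η_ H Hd ≫ (α_ _ _ _).inv ≫ ε_ H Hd ▷ Hd) ▷ W ⊗≫ 𝟙 _ := by
      simp only [box02, box20]
      monoidal
    _ = _ := by rw [ExactPairing.coevaluation_evaluation]; monoidal

theorem tail_evaluation_coevaluation {W : C} : box02 (η_ H Hd) (H ⊗ W) ≫ _ ◁ (box20 (ε_ H Hd) _) =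
    𝟙 _ := by
  calc
    _ = 𝟙 _ ⊗≫ (η_ H Hd ▷ H ≫ (α_ _ _ _).hom ≫ H ◁ ε_ H Hd) ▷ W ⊗≫ 𝟙 _ := by
      simp only [box02, box20]
      monoidal
    _ = _ := by rw [ExactPairing.evaluation_coevaluation]; monoidal

/-- This and the other `tail_` lemmas about named maps only unfold a definition into a composite of
boxes. -/
theorem tail_dualMul {W : C} : box21 (dualMul H Hd) W = _ ◁ (_ ◁ (box02 (η_ H Hd) _)) ≫ _ ◁ (_ ◁
    (box12 Δ[H] _)) ≫ _ ◁ (box20 (ε_ H Hd) _) ≫ box20 (ε_ H Hd) _ := by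
  calc
    _ = 𝟙 _ ⊗≫ (dualMul H Hd) ▷ W ⊗≫ 𝟙 _ := by simp only [box21]; monoidal
    _ = _ := by rw [dualMul]; simp only [box02, box12, box20]; monoidal

theorem tail_dualComul {W : C} : box12 (dualComul H Hd) W = _ ◁ (box02 (η_ H Hd) _) ≫ _ ◁ (_ ◁
    (box02 (η_ H Hd) _)) ≫ _ ◁ (box21 μ[H] _) ≫ box20 (ε_ H Hd) _ := by
  calc
    _ = 𝟙 _ ⊗≫ (dualComul H Hd) ▷ W ⊗≫ 𝟙 _ := by simp only [box12]; monoidal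
    _ = _ := by rw [dualComul]; simp only [box02, box20, box21]; monoidal

theorem tail_hatMul {W : C} : box21 (hatMul H Hd) W = swap Hd Hd _ ≫ box21 (dualMul H Hd) _ := by
  calc
    _ = 𝟙 _ ⊗≫ (hatMul H Hd) ▷ W ⊗≫ 𝟙 _ := by simp only [box21]; monoidal
    _ = _ := by rw [hatMul]; simp only [box21, box22]; monoidal

theorem tail_hatComul {W : C} : box12 (hatComul H Hd) W = box12 (dualComul H Hd) _ ≫ swap Hd Hd _
    := by
  calc
    _ = 𝟙 _ ⊗≫ (hatComul H Hd) ▷ W ⊗≫ 𝟙 _ := by simp only [box12]; monoidal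
    _ = _ := by rw [hatComul]; simp only [box12, box22]; monoidal

theorem tail_dualOne {W : C} : box01 (dualOne H Hd) W = box02 (η_ H Hd) _ ≫ box10 ε[H] _ := by
  calc
    _ = 𝟙 _ ⊗≫ (dualOne H Hd) ▷ W ⊗≫ 𝟙 _ := by simp only [box01]; monoidal
    _ = _ := by rw [dualOne]; simp only [box02, box10]; monoidal

theorem tail_hatAct {W : C} : box21 (hatAct H Hd) W = _ ◁ (box12 Δ[H] _) ≫ swap Hd H _ ≫ _ ◁
    (box20 (ε_ H Hd) _) := by
  calc
    _ = 𝟙 _ ⊗≫ (hatAct H Hd) ▷ W ⊗≫ 𝟙 _ := by simp only [box21]; monoidal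
    _ = _ := by rw [hatAct]; simp only [box12, box20, box22]; monoidal

theorem tail_antipode_inv {W : C} [IsIso 𝒮[H]] : box11 𝒮[H] W ≫ box11 (inv 𝒮[H]) _ = 𝟙 _ := by
  calc
    _ = 𝟙 _ ⊗≫ (𝒮[H] ≫ inv 𝒮[H]) ▷ W ⊗≫ 𝟙 _ := by simp only [box11]; monoidal
    _ = _ := by rw [IsIso.hom_inv_id]; monoidal

theorem tail_inv_antipode {W : C} [IsIso 𝒮[H]] : box11 (inv 𝒮[H]) W ≫ box11 𝒮[H] _ = 𝟙 _ := by
  calc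
    _ = 𝟙 _ ⊗≫ (inv 𝒮[H] ≫ 𝒮[H]) ▷ W ⊗≫ 𝟙 _ := by simp only [box11]; monoidal
    _ = _ := by rw [IsIso.inv_hom_id]; monoidal

theorem tail_mul_act {W : C} [ModuleAlgebra H R] : box21 μ[H] (R ⊗ W) ≫ box21 (ModuleAlgebra.act H
    R) _ = _ ◁ (box21 (ModuleAlgebra.act H R) _) ≫ box21 (ModuleAlgebra.act H R) _ := by
  calc
    _ = 𝟙 _ ⊗≫ (μ[H] ▷ R ≫ ModuleAlgebra.act H R) ▷ W ⊗≫ 𝟙 _ := by simp only [box21]; monoidal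
    _ = _ := by
      rw [(ModuleAlgebra.isModuleAlgebra (H := H) (R := R)).mul_act]
      simp only [box21]
      monoidal

theorem tail_one_act {W : C} [ModuleAlgebra H R] : box01 η[H] (R ⊗ W) ≫ box21 (ModuleAlgebra.act H
    R) _ = 𝟙 _ := by
  calc
    _ = 𝟙 _ ⊗≫ (η[H] ▷ R ≫ ModuleAlgebra.act H R) ▷ W ⊗≫ 𝟙 _ := by
      simp only [box01, box21]
      monoidal
    _ = _ := by rw [(ModuleAlgebra.isModuleAlgebra (H := H) (R := R)).one_act]; monoidal

theorem tail_act_mul {W : C} [ModuleAlgebra H R] : H ◁ (box21 μ[R] W) ≫ box21 (ModuleAlgebra.act H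
    R) _ = box12 Δ[H] _ ≫ _ ◁ (swap H R _) ≫ box21 (ModuleAlgebra.act H R) _ ≫ _ ◁ (box21
    (ModuleAlgebra.act H R) _) ≫ box21 μ[R] _ := by
  calc
    _ = 𝟙 _ ⊗≫ (H ◁ μ[R] ≫ ModuleAlgebra.act H R) ▷ W ⊗≫ 𝟙 _ := by simp only [box21]; monoidal
    _ = _ := by
      rw [(ModuleAlgebra.isModuleAlgebra (H := H) (R := R)).act_mul, tensorμ,
        MonoidalCategory.tensorHom_def]
      simp only [box12, box21, box22]
      monoidal

theorem tail_act_one {W : C} [ModuleAlgebra H R] : H ◁ (box01 η[R] W) ≫ box21 (ModuleAlgebra.act H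
    R) _ = box10 ε[H] _ ≫ box01 η[R] _ := by
  calc
    _ = 𝟙 _ ⊗≫ (H ◁ η[R] ≫ ModuleAlgebra.act H R) ▷ W ⊗≫ 𝟙 _ := by
      simp only [box01, box21]
      monoidal
    _ = _ := by
      rw [(ModuleAlgebra.isModuleAlgebra (H := H) (R := R)).act_one]
      simp only [box01, box10]
      monoidal

theorem tail_entwine {W : C} [ModuleAlgebra H R] : box22 (entwine H R) W = box12 Δ[H] _ ≫ _ ◁
    (swap H R _) ≫ box21 (ModuleAlgebra.act H R) _ := by
  calc
    _ = 𝟙 _ ⊗≫ (entwine H R) ▷ W ⊗≫ 𝟙 _ := by simp only [box22]; monoidal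
    _ = _ := by rw [entwine]; simp only [box12, box21, box22]; monoidal

theorem tail_entwineInv {W : C} [IsIso 𝒮[H]] [ModuleAlgebra H R] : box22 (entwineInv H R) W =
    swapInv R H _ ≫ box12 Δ[H] _ ≫ swap H H _ ≫ _ ◁ (box11 (inv 𝒮[H]) _) ≫ _ ◁ (box21
    (ModuleAlgebra.act H R) _) := by
  calc
    _ = 𝟙 _ ⊗≫ (entwineInv H R) ▷ W ⊗≫ 𝟙 _ := by simp only [box22]; monoidal
    _ = _ := by rw [entwineInv]; simp only [box11, box12, box21, box22]; monoidal

theorem tail_actDual {W : C} : box22 (actDual H Hd) W = _ ◁ (_ ◁ (box02 (η_ H Hd) _)) ≫ _ ◁ (box21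
    (hatAct H Hd) _) ≫ box21 μ[H] _ := by
  calc
    _ = 𝟙 _ ⊗≫ (actDual H Hd) ▷ W ⊗≫ 𝟙 _ := by simp only [box22]; monoidal
    _ = _ := by rw [actDual]; simp only [box02, box21]; monoidal

theorem tail_actDualInv {W : C} [IsIso 𝒮[H]] : box22 (actDualInv H Hd) W = _ ◁ (_ ◁ (box02 (η_ H
    Hd) _)) ≫ _ ◁ (_ ◁ (box12 Δ[H] _)) ≫ _ ◁ (swap Hd H _) ≫ _ ◁ (box11 (inv 𝒮[H]) _) ≫ _ ◁ (_ ◁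
    (box20 (ε_ H Hd) _)) ≫ box21 μ[H] _ := by
  calc
    _ = 𝟙 _ ⊗≫ (actDualInv H Hd) ▷ W ⊗≫ 𝟙 _ := by simp only [box22]; monoidal
    _ = _ := by rw [actDualInv]; simp only [box02, box11, box12, box20, box21, box22]; monoidal

theorem tail_dualAct {W : C} : box21 (dualAct H Hd) W = swap H Hd _ ≫ _ ◁ (box11 𝒮[H] _) ≫ _ ◁ (_
    ◁ (box02 (η_ H Hd) _)) ≫ _ ◁ (box21 μ[H] _) ≫ box20 (ε_ H Hd) _ := by
  calc
    _ = 𝟙 _ ⊗≫ (dualAct H Hd) ▷ W ⊗≫ 𝟙 _ := by simp only [box21]; monoidal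
    _ = _ := by rw [dualAct]; simp only [box02, box11, box20, box21, box22]; monoidal

theorem tail_dualCoact {W : C} : box12 (dualCoact H Hd) W = _ ◁ (box02 (η_ H Hd) _) ≫ _ ◁ (box12
    Δ[H] _) ≫ box20 (ε_ H Hd) _ := by
  calc
    _ = 𝟙 _ ⊗≫ (dualCoact H Hd) ▷ W ⊗≫ 𝟙 _ := by simp only [box12]; monoidal
    _ = _ := by rw [dualCoact]; simp only [box02, box12, box20]; monoidal

theorem tail_dualProj {W : C} : box11 (dualProj H Hd) W = box12 (dualCoact H Hd) _ ≫ box11 𝒮[H] _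
    ≫ box21 (dualAct H Hd) _ := by
  calc
    _ = 𝟙 _ ⊗≫ (dualProj H Hd) ▷ W ⊗≫ 𝟙 _ := by simp only [box11]; monoidal
    _ = _ := by rw [dualProj]; simp only [box11, box12, box21]; monoidal

end Axioms

end BraidedDuality

namespace BraidedDuality

universe v₁ u₁

/-! ### Diagram calculations in a braided monoidal category -/

section Diagrams

open CategoryTheory MonoidalCategory
open scoped MonObj ComonObj HopfObj

set_option linter.unusedSectionVars false

variable {C : Type u₁} [Category.{v₁} C] [MonoidalCategory C] [BraidedCategory C]

variable {H Hd R : C} [HopfObj H] [ExactPairing H Hd] [MonObj R]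

-- Each proof below is a chain of equalities in which one line is one local move of the diagram:
-- where it takes place (`pre`, `whisker`), which block it replaces (`post`), and the rule that is
-- applied.
local infixr:50 " ⟫ " => Eq.trans

/-- The coevaluation slides through a strand `H`, so the double braiding of both of its legs with
that strand is trivial. On the leg `H` it is trivial by assumption and may be inserted freely; hence
it is trivial on the leg `Hd`. -/
theorem tail_coevaluation_evaluation_swap_swap {W : C} [SelfSymmetric H] : Hd ◁ (box02 (η_ H Hd)
    (H ⊗ W)) ≫ box20 (ε_ H Hd) _ ≫ swap Hd H _ ≫ swap H Hd _ = _ ◁ (box02 (η_ H Hd) _) ≫ box20 (ε_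
    H Hd) _ :=
  pre1 (post22 box20_exchange') ⟫
  pre2 box20_exchange' ⟫
  -- The missing double crossing on the leg `H` is inserted, so that the whole coevaluation can be
  -- pulled out.
  pre2 (post02 (whisker02 tail_swap_swap.symm)) ⟫
  post31 (whisker31 swap_right02.symm) ⟫
  post31 (whisker31 swap_left02.symm)

theorem tail_swap_swap_dual {W : C} [SelfSymmetric H] : swap Hd H W ≫ swap H Hd _ = 𝟙 _ :=
  post02 ((tail_coevaluation_evaluation (H := H)).symm) ⟫
  tail_coevaluation_evaluation_swap_swap ⟫
  tail_coevaluation_evaluation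

theorem tail_swap_dual_swap {W : C} [SelfSymmetric H] : swap H Hd W ≫ swap Hd H W = 𝟙 _ :=
  swap_swap_symm (fun _ => tail_swap_swap_dual) W

/-- The same argument with a strand `Hd` in place of `H`, now using that double braidings of `H`
with `Hd` are trivial. -/
theorem tail_coevaluation_evaluation_swap_swap_dual {W : C} [SelfSymmetric H] : Hd ◁ (box02 (η_ H
    Hd) (Hd ⊗ W)) ≫ box20 (ε_ H Hd) _ ≫ swap Hd Hd _ ≫ swap Hd Hd _ = _ ◁ (box02 (η_ H Hd) _) ≫
    box20 (ε_ H Hd) _ :=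
  pre1 (post22 box20_exchange') ⟫
  pre2 (post02 (whisker02 tail_swap_dual_swap.symm)) ⟫
  pre4 box20_exchange' ⟫
  post31 (whisker31 swap_right02.symm) ⟫
  post31 (whisker31 swap_left02.symm)

theorem tail_swap_swap_dual_dual {W : C} [SelfSymmetric H] : swap Hd Hd W ≫ swap Hd Hd _ = 𝟙 _ :=
  post02 ((tail_coevaluation_evaluation (H := H)).symm) ⟫
  tail_coevaluation_evaluation_swap_swap_dual ⟫
  tail_coevaluation_evaluation

/-! ### The action of `H^` on `H` -/

theorem tail_dualMul_evaluation {W : C} : box21 (dualMul H Hd) (H ⊗ W) ≫ box20 (ε_ H Hd) _ = _ ◁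
    (_ ◁ (box12 Δ[H] _)) ≫ _ ◁ (box20 (ε_ H Hd) _) ≫ box20 (ε_ H Hd) _ :=
  post14 tail_dualMul ⟫
  pre3 box20_exchange' ⟫
  pre2 (post22 (whisker22 box20_exchange')) ⟫
  pre1 (post22 (whisker22 (whisker22 box12_exchange'))) ⟫
  post20 (whisker20 (whisker20 tail_evaluation_coevaluation))

/-- The zigzag identities remove the coevaluations from the transposed maps. The evaluations are
nested, which reverses the order: `⟨f₂, x⟩ ⟨f₁, y⟩ = ⟨f, x y⟩`, and likewise the product of `f` and
`g` pairs with `h` to `⟨g, h₁⟩ ⟨f, h₂⟩`. -/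
theorem tail_dualComul_evaluation {W : C} : box12 (dualComul H Hd) (H ⊗ (H ⊗ W)) ≫ _ ◁ (box20 (ε_
    H Hd) _) ≫ box20 (ε_ H Hd) _ = _ ◁ (box21 μ[H] _) ≫ box20 (ε_ H Hd) _ :=
  post14 tail_dualComul ⟫
  pre3 (post22 box20_exchange') ⟫
  pre2 (post22 (whisker22 box21_exchange')) ⟫
  pre1 (post22 (whisker22 (whisker22 box02_exchange'))) ⟫
  post20 (whisker20 tail_evaluation_coevaluation) ⟫
  pre2 box20_exchange' ⟫
  pre1 (post22 (whisker22 box21_exchange')) ⟫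
  post20 (whisker20 (whisker20 tail_evaluation_coevaluation))

/-- Naturality moves `H` past the whole pairing. The crossing of `H` with `Hd` then goes to the
other side as a crossing of two copies of `H`, because the double crossing is trivial. -/
theorem tail_swap_evaluation {W : C} [SelfSymmetric H] : swap Hd H (H ⊗ W) ≫ _ ◁ (box20 (ε_ H Hd)
    _) = _ ◁ (swap H H _) ≫ box20 (ε_ H Hd) _ :=
  pre1 swap_left20.symm ⟫
  post20 tail_swap_swap_dual

theorem tail_swap_evaluation_dual {W : C} [SelfSymmetric H] : swap Hd Hd (H ⊗ W) ≫ _ ◁ (box20 (ε_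
    H Hd) _) = _ ◁ (swap Hd H _) ≫ box20 (ε_ H Hd) _ :=
  pre1 swap_left20.symm ⟫
  post20 (tail_swap_swap_dual_dual (H := H))

theorem tail_swap_dual_evaluation_evaluation {W : C} [SelfSymmetric H] : swap Hd Hd (H ⊗ (H ⊗ W))
    ≫ _ ◁ (box20 (ε_ H Hd) _) ≫ box20 (ε_ H Hd) _ = _ ◁ (_ ◁ (swap H H _)) ≫ _ ◁ (box20 (ε_ H Hd)
    _) ≫ box20 (ε_ H Hd) _ :=
  post22 tail_swap_evaluation_dual ⟫
  pre1 box20_exchange' ⟫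
  post22 (whisker22 tail_swap_evaluation)

theorem tail_hatAct' {W : C} [SelfSymmetric H] : box21 (hatAct H Hd) W = _ ◁ (box12 Δ[H] _) ≫ _ ◁
    (swap H H _) ≫ box20 (ε_ H Hd) _ :=
  tail_hatAct ⟫
  pre1 tail_swap_evaluation

theorem tail_dualOne_hatAct {W : C} [SelfSymmetric H] : box01 (dualOne H Hd) (H ⊗ W) ≫ box21
    (hatAct H Hd) _ = 𝟙 _ :=
  pre1 tail_hatAct' ⟫
  post22 box01_exchange' ⟫
  pre1 (post22 box01_exchange') ⟫
  pre2 (post12 tail_dualOne) ⟫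
  pre3 box10_exchange' ⟫
  pre2 (post20 tail_evaluation_coevaluation) ⟫
  pre1 swap_left10 ⟫
  tail_comul_counit_right

/-- Passing to the opposite multiplication undoes the reversal caused by the nested evaluations: the
pairing becomes `⟨f, h₁⟩ ⟨g, h₂⟩`. -/
theorem tail_hatMul_evaluation {W : C} [SelfSymmetric H] : box21 (hatMul H Hd) (H ⊗ W) ≫ box20 (ε_
    H Hd) _ = _ ◁ (_ ◁ (box12 Δ[H] _)) ≫ _ ◁ (_ ◁ (swap H H _)) ≫ _ ◁ (box20 (ε_ H Hd) _) ≫ box20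
    (ε_ H Hd) _ :=
  post12 tail_hatMul ⟫
  pre1 tail_dualMul_evaluation ⟫
  post22 box22_exchange' ⟫
  pre1 tail_swap_dual_evaluation_evaluation

/-- Both sides are `h₁ ⟨f, h₂⟩ ⟨g, h₃⟩`, by coassociativity. -/
theorem tail_hatMul_hatAct {W : C} [SelfSymmetric H] : box21 (hatMul H Hd) (H ⊗ W) ≫ box21 (hatAct
    H Hd) _ = _ ◁ (box21 (hatAct H Hd) _) ≫ box21 (hatAct H Hd) _ :=
  pre1 tail_hatAct' ⟫
  post22 box21_exchange' ⟫
  pre1 (post22 box21_exchange') ⟫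
  pre2 tail_hatMul_evaluation ⟫
  pre1 (post23 (whisker23 (whisker23 swap_left12))) ⟫
  pre2 (post33 (whisker33 (whisker33 swap_left22))) ⟫
  post22 (whisker22 (whisker22 tail_comul_comul)) ⟫
  pre1 (post32 (whisker32 (whisker32 swap_right12.symm))) ⟫
  pre3 (post22 (whisker22 box20_exchange)) ⟫
  pre2 (post22 (whisker22 box20_exchange)) ⟫
  pre3 tail_hatAct'.symm ⟫
  post31 (whisker31 tail_hatAct'.symm)

/-- A normal form for two actions on neighbouring factors: the coproducts first, then the crossings
of copies of `H`, and the two pairings last. In this form the coproduct of `H^` can be applied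
directly. -/
theorem tail_swap_hatAct_hatAct {W : C} [SelfSymmetric H] : Hd ◁ (swap Hd H (H ⊗ W)) ≫ box21
    (hatAct H Hd) _ ≫ _ ◁ (box21 (hatAct H Hd) _) = _ ◁ (_ ◁ (box12 Δ[H] _)) ≫ _ ◁ (_ ◁ (_ ◁ (_ ◁
    (box12 Δ[H] _)))) ≫ _ ◁ (_ ◁ (_ ◁ (_ ◁ (swap H H _)))) ≫ _ ◁ (_ ◁ (_ ◁ (swap H H _))) ≫ _ ◁ (_
    ◁ (swap H H _)) ≫ _ ◁ (_ ◁ (_ ◁ (swap H H _))) ≫ _ ◁ (box20 (ε_ H Hd) _) ≫ box20 (ε_ H Hd) _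
    :=
  pre1 (post13 tail_hatAct') ⟫
  pre4 (whisker13 tail_hatAct') ⟫
  pre3 (post22 box20_exchange') ⟫
  pre2 (post22 (whisker22 box22_exchange')) ⟫
  pre1 (post22 (whisker22 box12_exchange')) ⟫
  pre4 (post22 box20_exchange') ⟫
  pre3 (post22 (whisker22 box22_exchange')) ⟫
  post22 (whisker22 box22_exchange') ⟫
  pre1 (post23 (whisker23 swap_left12)) ⟫
  post22 (whisker22 (whisker22 box12_exchange)) ⟫
  pre1 (post22 (whisker22 box22_exchange)) ⟫
  pre2 (post22 (whisker22 (whisker22 box22_exchange))) ⟫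
  pre6 box20_exchange' ⟫
  pre2 (post22 (whisker22 (whisker22 box22_exchange'))) ⟫
  pre3 (post22 (whisker22 (whisker22 box22_exchange'))) ⟫
  pre5 (post22 (whisker22 box22_exchange')) ⟫
  pre4 (post22 (whisker22 (whisker22 tail_swap_evaluation))) ⟫
  pre1 (post22 (whisker22 box22_exchange')) ⟫
  pre2 (post22 (whisker22 box22_exchange')) ⟫
  pre3 (post22 (whisker22 box22_exchange')) ⟫
  pre4 (post22 (whisker22 tail_swap_evaluation)) ⟫
  pre5 (post22 (whisker22 box20_exchange'))

/-- Passing to the co-opposite undoes the reversal of the nested evaluations, as for the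
multiplication: `⟨f₂, x⟩ ⟨f₁, y⟩ = ⟨f, y x⟩`. -/
theorem tail_hatComul_evaluation {W : C} [SelfSymmetric H] : box12 (hatComul H Hd) (H ⊗ (H ⊗ W)) ≫
    _ ◁ (box20 (ε_ H Hd) _) ≫ box20 (ε_ H Hd) _ = _ ◁ (swap H H _) ≫ _ ◁ (box21 μ[H] _) ≫ box20
    (ε_ H Hd) _ :=
  post12 tail_hatComul ⟫
  pre1 tail_swap_dual_evaluation_evaluation ⟫
  post22 box12_exchange' ⟫
  pre1 tail_dualComul_evaluation

theorem tail_hatComul_swap_hatAct_hatAct {W : C} [SelfSymmetric H] : box12 (hatComul H Hd) (H ⊗ (H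
    ⊗ W)) ≫ _ ◁ (swap Hd H _) ≫ box21 (hatAct H Hd) _ ≫ _ ◁ (box21 (hatAct H Hd) _) = _ ◁ (box12
    Δ[H] _) ≫ _ ◁ (_ ◁ (_ ◁ (box12 Δ[H] _))) ≫ _ ◁ (_ ◁ (_ ◁ (swap H H _))) ≫ _ ◁ (_ ◁ (swap H H
    _)) ≫ _ ◁ (swap H H _) ≫ _ ◁ (_ ◁ (swap H H _)) ≫ _ ◁ (swap H H _) ≫ _ ◁ (box21 μ[H] _) ≫
    box20 (ε_ H Hd) _ :=
  pre1 tail_swap_hatAct_hatAct ⟫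
  post22 box12_exchange' ⟫
  pre1 (post22 box12_exchange') ⟫
  pre2 (post22 box12_exchange') ⟫
  pre3 (post22 box12_exchange') ⟫
  pre4 (post22 box12_exchange') ⟫
  pre5 (post22 box12_exchange') ⟫
  pre6 tail_hatComul_evaluation

/-- By multiplicativity of the coproduct, `f ⇀ x y = x₁ y₁ ⟨f, x₂ y₂⟩`, and `⟨f, x₂ y₂⟩` is `⟨f₁,
x₂⟩ ⟨f₂, y₂⟩` in `H^`. With the unit and associativity laws above, `H` is a module algebra over
`H^`. -/
theorem tail_mul_hatAct {W : C} [SelfSymmetric H] : Hd ◁ (box21 μ[H] W) ≫ box21 (hatAct H Hd) _ =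
    box12 (hatComul H Hd) _ ≫ _ ◁ (swap Hd H _) ≫ box21 (hatAct H Hd) _ ≫ _ ◁ (box21 (hatAct H Hd)
    _) ≫ box21 μ[H] _ :=
  pre1 tail_hatAct' ⟫
  post25 (whisker25 tail_mul_comul) ⟫
  post22 (whisker22 box12_exchange) ⟫
  pre4 (post23 (whisker23 swap_left21.symm)) ⟫
  pre3 (post23 (whisker23 swap_right21.symm)) ⟫
  pre5 (post23 (whisker23 (whisker23 swap_right21.symm))) ⟫
  pre7 (post22 (whisker22 box21_exchange)) ⟫
  pre2 (post20 (whisker20 (whisker20 tail_swap_swap))) ⟫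
  pre2 (post22 (whisker22 box22_exchange')) ⟫
  pre6 box20_exchange ⟫
  -- A trivial double crossing is inserted to reach the crossings in
  -- `tail_hatComul_swap_hatAct_hatAct`.
  pre5 (post02 (whisker02 tail_swap_swap.symm)) ⟫
  pre3 (post33 (whisker33 swap_left22)) ⟫
  post94 tail_hatComul_swap_hatAct_hatAct.symm

/-! ### The inverse antipode and the commutation of `H` with `R` -/

theorem tail_one_inv_antipode {W : C} [IsIso 𝒮[H]] : box01 η[H] W ≫ box11 (inv 𝒮[H]) _ = box01
    η[H] _ :=
  post12 tail_one_antipode.symm ⟫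
  end20 tail_antipode_inv

/-- Applying the antihomomorphism `S` to `S⁻¹(h₂) h₁` gives `S(h₁) h₂ = ε(h)`. The crossing that `S`
creates cancels the one in the statement because the braiding of `H` is symmetric. -/
theorem tail_inv_antipode_left {W : C} [SelfSymmetric H] [IsIso 𝒮[H]] : box12 Δ[H] W ≫ swap H H _
    ≫ box11 (inv 𝒮[H]) _ ≫ box21 μ[H] _ = box10 ε[H] _ ≫ box01 η[H] _ :=
  pre3 (end02 tail_antipode_inv.symm) ⟫
  pre3 (post24 tail_mul_antipode) ⟫
  pre2 (post20 tail_inv_antipode) ⟫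
  pre1 (post22 swap_right11) ⟫
  pre2 (post20 tail_swap_swap) ⟫
  post32 tail_antipode_left ⟫
  pre1 tail_one_inv_antipode

/-- Likewise, `S` sends `h₂ S⁻¹(h₁)` to `h₁ S(h₂) = ε(h)`. -/
theorem tail_inv_antipode_right {W : C} [SelfSymmetric H] [IsIso 𝒮[H]] : box12 Δ[H] W ≫ swap H H _
    ≫ _ ◁ (box11 (inv 𝒮[H]) _) ≫ box21 μ[H] _ = box10 ε[H] _ ≫ box01 η[H] _ :=
  pre3 (end02 tail_antipode_inv.symm) ⟫
  pre3 (post24 tail_mul_antipode) ⟫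
  pre2 (post22 box11_exchange) ⟫
  pre3 (post20 (whisker20 tail_inv_antipode)) ⟫
  pre1 (post22 swap_left11) ⟫
  pre2 (post20 tail_swap_swap) ⟫
  post32 tail_antipode_right ⟫
  pre1 tail_one_inv_antipode

/-- Naturality of the braiding with the inverse crossings brought to the opposite sides; the
crossing of the two copies of `H` is its own inverse and so appears as `swap`. -/
theorem tail_act_swapInv {W : C} [SelfSymmetric H] [ModuleAlgebra H R] : box21 (ModuleAlgebra.act
    H R) (H ⊗ W) ≫ swapInv R H _ = _ ◁ (swapInv R H _) ≫ swap H H _ ≫ _ ◁ (box21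
    (ModuleAlgebra.act H R) _) :=
  post02 (whisker02 tail_swapInv_swap.symm) ⟫
  pre1 (post02 tail_swap_swap.symm) ⟫
  pre2 (post32 swap_left21) ⟫
  pre2 (end20 tail_swap_swapInv)

/-- The composite sends `r ⊗ h` to `h₂ S⁻¹(h₁) r ⊗ h₃ = r ⊗ h`. -/
theorem tail_entwineInv_entwine {W : C} [SelfSymmetric H] [IsIso 𝒮[H]] [ModuleAlgebra H R] : box22
    (entwineInv H R) W ≫ box22 (entwine H R) _ = 𝟙 _ :=
  post15 tail_entwineInv ⟫
  pre5 tail_entwine ⟫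
  pre4 (post22 box12_exchange) ⟫
  pre5 (post23 (whisker23 swap_left21.symm)) ⟫
  pre3 (post22 box12_exchange) ⟫
  pre2 (post23 swap_left12) ⟫
  pre4 (post22 (whisker22 swap_right11)) ⟫
  pre5 (post20 (whisker20 tail_swap_swap)) ⟫
  pre6 tail_mul_act.symm ⟫
  pre5 (post22 box21_exchange) ⟫
  pre1 (post22 tail_comul_comul) ⟫
  pre2 (post42 tail_inv_antipode_right) ⟫
  pre1 (post20 tail_comul_counit_left) ⟫
  post22 box01_exchange ⟫
  pre1 (post20 (whisker20 tail_swapInv_swap)) ⟫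
  tail_one_act

/-- The composite sends `h ⊗ r` to `h₃ ⊗ S⁻¹(h₂) h₁ r = h ⊗ r`. -/
theorem tail_entwine_entwineInv {W : C} [SelfSymmetric H] [IsIso 𝒮[H]] [ModuleAlgebra H R] : box22
    (entwine H R) W ≫ box22 (entwineInv H R) _ = 𝟙 _ :=
  post13 tail_entwine ⟫
  pre3 tail_entwineInv ⟫
  pre2 (post23 tail_act_swapInv) ⟫
  pre1 (post20 (whisker20 tail_swap_swapInv)) ⟫
  pre2 (post22 box12_exchange) ⟫
  pre3 (post22 box22_exchange) ⟫
  pre4 (post22 (whisker22 box11_exchange)) ⟫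
  pre1 (post23 swap_left12) ⟫
  pre4 (post22 swap_right11) ⟫
  pre6 (whisker22 tail_mul_act.symm) ⟫
  pre3 (post22 box11_exchange) ⟫
  pre4 (post32 swap_right21) ⟫
  post22 tail_comul_comul ⟫
  pre1 (post42 tail_inv_antipode_left) ⟫
  post20 tail_comul_counit_left ⟫
  post21 swap_right01.symm ⟫
  whisker20 tail_one_act

theorem tail_entwine_one {W : C} [ModuleAlgebra H R] : H ◁ (box01 η[R] W) ≫ box22 (entwine H R) _
    = box01 η[R] _ :=
  pre1 tail_entwine ⟫
  post22 box12_exchange ⟫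
  pre1 (post21 (whisker21 swap_left01.symm)) ⟫
  pre1 tail_act_one ⟫
  post20 tail_comul_counit_left

/-- In `R # H` this is `h · (r r') = (h · r) · r'`: both are `(h₁ r)(h₂ r') # h₃`, by the module
algebra axiom and coassociativity. -/
theorem tail_entwine_mul {W : C} [ModuleAlgebra H R] : H ◁ (box21 μ[R] W) ≫ box22 (entwine H R) _
    = box22 (entwine H R) _ ≫ _ ◁ (box22 (entwine H R) _) ≫ box21 μ[R] _ :=
  pre1 tail_entwine ⟫
  post22 box12_exchange ⟫
  pre1 (post23 (whisker23 swap_left21.symm)) ⟫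
  pre3 tail_act_mul ⟫
  pre2 (post22 box12_exchange) ⟫
  pre1 (post22 box12_exchange) ⟫
  post22 tail_comul_comul.symm ⟫
  pre3 (post22 (whisker22 box22_exchange)) ⟫
  pre1 (post32 (whisker32 swap_right12.symm)) ⟫
  pre3 (post22 box21_exchange) ⟫
  pre2 (post22 box21_exchange) ⟫
  pre3 (post31 (whisker31 tail_entwine.symm)) ⟫
  post31 tail_entwine.symm

/-- In `R # H` this is `(h h') · r = h · (h' · r)`, from the bialgebra axiom and the associativity
of the action. -/
theorem tail_mul_entwine {W : C} [ModuleAlgebra H R] : box21 μ[H] (R ⊗ W) ≫ box22 (entwine H R) _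
    = _ ◁ (box22 (entwine H R) _) ≫ box22 (entwine H R) _ ≫ _ ◁ (box21 μ[H] _) :=
  pre1 tail_entwine ⟫
  post25 tail_mul_comul ⟫
  pre4 (post23 (whisker23 swap_right21.symm)) ⟫
  pre3 (post22 box21_exchange') ⟫
  pre4 (post22 box21_exchange') ⟫
  pre6 box21_exchange ⟫
  pre5 (post22 tail_mul_act) ⟫
  pre2 (post22 (whisker22 box22_exchange')) ⟫
  pre3 (post32 (whisker32 swap_left21)) ⟫
  pre1 (post22 box12_exchange') ⟫
  pre2 (post22 box12_exchange') ⟫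
  pre3 (post31 tail_entwine.symm) ⟫
  post31 (whisker31 tail_entwine.symm)

/-- `tail_entwine_mul` conjugated by the inverse map; it expresses that the identification of `R #
H` with `H ⊗ R` respects right multiplication by `R`. -/
theorem tail_mul_entwineInv {W : C} [SelfSymmetric H] [IsIso 𝒮[H]] [ModuleAlgebra H R] : box21
    μ[R] (H ⊗ W) ≫ box22 (entwineInv H R) _ = _ ◁ (box22 (entwineInv H R) _) ≫ box22 (entwineInv H
    R) _ ≫ _ ◁ (box21 μ[R] _) :=
  post02 (whisker02 tail_entwineInv_entwine.symm) ⟫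
  pre1 (post02 tail_entwineInv_entwine.symm) ⟫
  pre2 (post32 tail_entwine_mul.symm) ⟫
  pre2 (end20 tail_entwine_entwineInv)

theorem tail_one_entwineInv {W : C} [SelfSymmetric H] [IsIso 𝒮[H]] [ModuleAlgebra H R] : box01
    η[R] (H ⊗ W) ≫ box22 (entwineInv H R) _ = _ ◁ (box01 η[R] _) :=
  post12 tail_entwine_one.symm ⟫
  end20 tail_entwine_entwineInv

/-- The action of `H^` on `R # H` commutes with right multiplication by `R`: both sides are `h₁ r #
h₂ ⟨f, h₃⟩`, by coassociativity. This is why the iterated smash product acts by `R`-linear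
operators. No symmetry of a braiding is needed. -/
theorem tail_hatAct_entwine {W : C} [ModuleAlgebra H R] : box21 (hatAct H Hd) (R ⊗ W) ≫ box22
    (entwine H R) _ = _ ◁ (box22 (entwine H R) _) ≫ swap Hd R _ ≫ _ ◁ (box21 (hatAct H Hd) _) :=
  post13 tail_hatAct ⟫
  pre3 tail_entwine ⟫
  pre2 (post22 box12_exchange) ⟫
  pre1 (post23 swap_left12) ⟫
  post22 (whisker22 tail_comul_comul.symm) ⟫
  pre4 (post13 (whisker13 (whisker13 swap_right20.symm))) ⟫
  pre3 (post22 (whisker22 box22_exchange')) ⟫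
  pre2 (post22 box22_exchange') ⟫
  pre6 (post22 (whisker22 box22_exchange)) ⟫
  pre7 box21_exchange ⟫
  pre4 (post33 (whisker33 swap_right22.symm)) ⟫
  pre6 (post22 box21_exchange) ⟫
  pre3 (post22 box22_exchange') ⟫
  pre1 (post32 (whisker32 (whisker32 swap_right12.symm))) ⟫
  pre2 (post22 box22_exchange) ⟫
  pre3 (post22 (whisker22 box22_exchange)) ⟫
  pre4 (post22 box21_exchange) ⟫
  pre5 (whisker31 tail_hatAct.symm) ⟫
  pre2 (post32 swap_left21) ⟫
  post31 (whisker31 tail_entwine.symm)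

/-- The heart of the theorem: the operators on `H ⊗ R ≅ R # H` multiply as the elements of `(R # H)
# H^` do. On the left the second element is applied to `x ∈ H`, and the first one to the resulting
vector of `H ⊗ R`, whose `R`-component is multiplied on the right; on the right the product of the
two elements is applied to `x`. -/
theorem tail_smash_mul {W : C} [SelfSymmetric H] [IsIso 𝒮[H]] [ModuleAlgebra H R] : R ◁ (H ◁ (Hd ◁
    (R ◁ (H ◁ (box21 (hatAct H Hd) W))))) ≫ _ ◁ (_ ◁ (_ ◁ (_ ◁ (box21 μ[H] _)))) ≫ _ ◁ (_ ◁ (_ ◁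
    (box22 (entwineInv H R) _))) ≫ _ ◁ (_ ◁ (box21 (hatAct H Hd) _)) ≫ _ ◁ (box21 μ[H] _) ≫ box22
    (entwineInv H R) _ ≫ _ ◁ (box21 μ[R] _) = _ ◁ (_ ◁ (box12 (hatComul H Hd) _)) ≫ _ ◁ (_ ◁ (_ ◁
    (swap Hd R _))) ≫ _ ◁ (_ ◁ (_ ◁ (_ ◁ (swap Hd H _)))) ≫ _ ◁ (_ ◁ (swap Hd R _)) ≫ _ ◁ (_ ◁ (_
    ◁ (box21 (hatAct H Hd) _))) ≫ _ ◁ (box22 (entwine H R) _) ≫ box21 μ[R] _ ≫ _ ◁ (box21 μ[H] _)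
    ≫ _ ◁ (_ ◁ (box21 (hatMul H Hd) _)) ≫ _ ◁ (_ ◁ (box21 (hatAct H Hd) _)) ≫ _ ◁ (box21 μ[H] _) ≫
    box22 (entwineInv H R) _ :=
  -- The vector of `H ⊗ R` is rewritten in `R # H`, so that right multiplication by its
  -- `R`-component can be moved inward past `h` and then past `f`.
  pre5 (post02 (whisker02 tail_entwine_entwineInv.symm)) ⟫
  pre6 tail_mul_entwineInv.symm ⟫
  pre4 (post23 (whisker23 tail_mul_entwine)) ⟫
  pre3 (post23 (whisker23 (whisker23 tail_hatAct_entwine))) ⟫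
  -- The inner identification of `H ⊗ R` with `R # H` now cancels, and only products in `R # H`
  -- remain.
  pre2 (post20 (whisker20 (whisker20 (whisker20 tail_entwineInv_entwine)))) ⟫
  pre1 (post22 (whisker22 (whisker22 box22_exchange))) ⟫
  -- The action of `f` on the product `h' (f' ⇀ x)` produces the coproduct of `f` that occurs in the
  -- smash product.
  pre2 (post25 (whisker25 (whisker25 (whisker25 tail_mul_hatAct)))) ⟫
  pre1 (post23 (whisker23 (whisker23 swap_right12))) ⟫
  post22 (whisker22 (whisker22 box12_exchange)) ⟫
  pre1 (post22 (whisker22 (whisker22 (whisker22 box22_exchange)))) ⟫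
  pre2 (post22 (whisker22 (whisker22 box22_exchange))) ⟫
  pre3 (post22 (whisker22 (whisker22 (whisker22 (whisker22 box22_exchange))))) ⟫
  pre4 (post22 (whisker22 (whisker22 (whisker22 box21_exchange)))) ⟫
  pre7 (post22 (whisker22 box22_exchange)) ⟫
  pre8 (post22 (whisker22 (whisker22 tail_mul_mul))) ⟫
  pre6 (post22 (whisker22 box22_exchange)) ⟫
  pre5 (post22 (whisker22 box22_exchange)) ⟫
  pre7 (post22 (whisker22 (whisker22 box21_exchange))) ⟫
  pre6 (post22 (whisker22 (whisker22 box21_exchange))) ⟫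
  pre9 (post22 box21_exchange) ⟫
  pre8 (post22 box21_exchange) ⟫
  pre7 (post22 box21_exchange) ⟫
  pre6 (post22 box21_exchange) ⟫
  -- The second leg of the coproduct of `f` acts after `f'`, so the two combine in the product of
  -- `H^`.
  pre8 (post22 (whisker22 (whisker22 tail_hatMul_hatAct.symm))) ⟫
  pre2 (post22 (whisker22 (whisker22 box22_exchange')))

/-- `x ↦ Σ (x · bᵢ) ⊗ bⁱ` is multiplicative into `H ⊗ R ⊗ Hd`. In the product of two images, the
pairing inserts the vector produced by the second element into the first operator, which is the
situation of `tail_smash_mul`. -/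
theorem tail_toPair_mul {W : C} [SelfSymmetric H] [IsIso 𝒮[H]] [ModuleAlgebra H R] : R ◁ (H ◁ (Hd
    ◁ (box02 (η_ H Hd) (R ⊗ (H ⊗ (Hd ⊗ W)))))) ≫ _ ◁ (_ ◁ (box21 (hatAct H Hd) _)) ≫ _ ◁ (box21
    μ[H] _) ≫ box22 (entwineInv H R) _ ≫ _ ◁ (_ ◁ (_ ◁ (_ ◁ (_ ◁ (_ ◁ (box02 (η_ H Hd) _)))))) ≫ _
    ◁ (_ ◁ (_ ◁ (_ ◁ (_ ◁ (box21 (hatAct H Hd) _))))) ≫ _ ◁ (_ ◁ (_ ◁ (_ ◁ (box21 μ[H] _)))) ≫ _ ◁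
    (_ ◁ (_ ◁ (box22 (entwineInv H R) _))) ≫ _ ◁ (_ ◁ (box20 (ε_ H Hd) _)) ≫ _ ◁ (box21 μ[R] _) =
    _ ◁ (_ ◁ (box12 (hatComul H Hd) _)) ≫ _ ◁ (_ ◁ (_ ◁ (swap Hd R _))) ≫ _ ◁ (_ ◁ (_ ◁ (_ ◁ (swap
    Hd H _)))) ≫ _ ◁ (_ ◁ (swap Hd R _)) ≫ _ ◁ (_ ◁ (_ ◁ (box21 (hatAct H Hd) _))) ≫ _ ◁ (box22
    (entwine H R) _) ≫ box21 μ[R] _ ≫ _ ◁ (box21 μ[H] _) ≫ _ ◁ (_ ◁ (box21 (hatMul H Hd) _)) ≫ _ ◁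
    (_ ◁ (_ ◁ (box02 (η_ H Hd) _))) ≫ _ ◁ (_ ◁ (box21 (hatAct H Hd) _)) ≫ _ ◁ (box21 μ[H] _) ≫
    box22 (entwineInv H R) _ :=
  pre3 (post22 box22_exchange') ⟫
  pre2 (post22 (whisker22 box21_exchange')) ⟫
  pre1 (post22 (whisker22 (whisker22 box21_exchange'))) ⟫
  post22 (whisker22 (whisker22 (whisker22 box02_exchange'))) ⟫
  pre4 (post22 box22_exchange') ⟫
  pre3 (post22 (whisker22 box21_exchange')) ⟫
  pre2 (post22 (whisker22 (whisker22 box21_exchange'))) ⟫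
  pre1 (post22 (whisker22 (whisker22 (whisker22 box02_exchange')))) ⟫
  pre5 (post22 box22_exchange') ⟫
  pre4 (post22 (whisker22 box21_exchange')) ⟫
  pre3 (post22 (whisker22 (whisker22 box21_exchange'))) ⟫
  pre2 (post22 (whisker22 (whisker22 (whisker22 box02_exchange')))) ⟫
  pre6 (post22 box22_exchange') ⟫
  pre5 (post22 (whisker22 box21_exchange')) ⟫
  pre4 (post22 (whisker22 (whisker22 box21_exchange'))) ⟫
  pre3 (post22 (whisker22 (whisker22 (whisker22 box02_exchange')))) ⟫
  pre7 (post22 box22_exchange') ⟫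
  pre6 (post22 (whisker22 box21_exchange')) ⟫
  pre5 (post22 (whisker22 (whisker22 box21_exchange'))) ⟫
  -- Once the other morphisms are out of the way, the coevaluation of the first factor meets the
  -- pairing and the zigzag identity removes both.
  pre4 (post20 (whisker20 (whisker20 (whisker20 tail_evaluation_coevaluation)))) ⟫
  pre1 tail_smash_mul ⟫
  post22 (whisker22 (whisker22 box12_exchange)) ⟫
  pre1 (post22 (whisker22 (whisker22 (whisker22 box22_exchange)))) ⟫
  pre2 (post22 (whisker22 (whisker22 (whisker22 (whisker22 box22_exchange))))) ⟫
  pre3 (post22 (whisker22 (whisker22 box22_exchange))) ⟫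
  pre4 (post22 (whisker22 (whisker22 (whisker22 box21_exchange)))) ⟫
  pre5 (post22 (whisker22 box22_exchange)) ⟫
  pre6 (post22 box21_exchange) ⟫
  pre7 (post22 (whisker22 box21_exchange)) ⟫
  pre8 (post22 (whisker22 (whisker22 box21_exchange)))

/-- The unit acts as the identity operator, which corresponds to `Σ bᵢ ⊗ 1 ⊗ bⁱ`. -/
theorem tail_toPair_one {W : C} [SelfSymmetric H] [IsIso 𝒮[H]] [ModuleAlgebra H R] : box01 η[R] W
    ≫ _ ◁ (box01 η[H] _) ≫ _ ◁ (_ ◁ (box01 (dualOne H Hd) _)) ≫ _ ◁ (_ ◁ (_ ◁ (box02 (η_ H Hd)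
    _))) ≫ _ ◁ (_ ◁ (box21 (hatAct H Hd) _)) ≫ _ ◁ (box21 μ[H] _) ≫ box22 (entwineInv H R) _ =
    box02 (η_ H Hd) _ ≫ _ ◁ (box01 η[R] _) :=
  pre2 (post22 (whisker22 (whisker22 box01_exchange'))) ⟫
  pre3 (post20 (whisker20 (whisker20 tail_dualOne_hatAct))) ⟫
  pre1 (post22 (whisker22 box01_exchange')) ⟫
  pre2 (post20 (whisker20 tail_one_mul)) ⟫
  post22 box01_exchange' ⟫
  pre1 tail_one_entwineInv

/-- Naturality of the braiding carries `H` past the pairing and past the product of `R`. This turns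
the product `⟨f, h'⟩ h ⊗ r r' ⊗ f'` into that of the braided tensor product, for an arbitrary
braiding of `H` with `R`. -/
theorem tail_pair_mul_swap {W : C} : H ◁ (R ◁ (box20 (ε_ H Hd) (R ⊗ (Hd ⊗ W)))) ≫ _ ◁ (box21 μ[R]
    _) ≫ swap H R _ = swap H R _ ≫ _ ◁ (_ ◁ (_ ◁ (swap H R _))) ≫ _ ◁ (_ ◁ (swap Hd R _)) ≫ _ ◁
    (swap H R _) ≫ box21 μ[R] _ ≫ _ ◁ (_ ◁ (box20 (ε_ H Hd) _)) :=
  post13 (whisker13 (whisker13 swap_right20.symm)) ⟫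
  pre2 (post22 (whisker22 box21_exchange)) ⟫
  pre3 box22_exchange ⟫
  pre2 (post23 swap_left21.symm) ⟫
  pre1 (post22 box22_exchange) ⟫
  post22 box22_exchange

theorem tail_pair_one_swap {W : C} : box02 (η_ H Hd) W ≫ _ ◁ (box01 η[R] _) ≫ swap H R _ = box02
    (η_ H Hd) _ ≫ box01 η[R] _ :=
  pre1 swap_left01.symm

/-- The zigzag identity replaces `bᵢ` by the argument `x`, so the value at `x` is `h S⁻¹(x₁) ⟨f,
x₂⟩`. -/
theorem tail_actDualInv_evaluation {W : C} [SelfSymmetric H] [IsIso 𝒮[H]] : box22 (actDualInv H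
    Hd) (H ⊗ W) ≫ _ ◁ (box20 (ε_ H Hd) _) = _ ◁ (_ ◁ (box12 Δ[H] _)) ≫ _ ◁ (_ ◁ (swap H H _)) ≫ _
    ◁ (_ ◁ (_ ◁ (box11 (inv 𝒮[H]) _))) ≫ _ ◁ (box20 (ε_ H Hd) _) ≫ box21 μ[H] _ :=
  post16 tail_actDualInv ⟫
  pre5 box21_exchange' ⟫
  pre4 (post22 (whisker22 (whisker22 box20_exchange'))) ⟫
  pre3 (post22 (whisker22 box11_exchange')) ⟫
  pre2 (post22 (whisker22 box22_exchange')) ⟫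
  pre1 (post22 (whisker22 (whisker22 box12_exchange'))) ⟫
  post20 (whisker20 (whisker20 tail_evaluation_coevaluation)) ⟫
  pre2 (post22 (whisker22 box11_exchange')) ⟫
  pre1 (post22 (whisker22 tail_swap_evaluation)) ⟫
  pre2 (post22 (whisker22 box20_exchange'))

/-- The composite is `Σ h S⁻¹(bᵢ₂) bᵢ₁ ⟨f, bᵢ₃⟩ ⊗ bⁱ = Σ h ⟨f, bᵢ⟩ ⊗ bⁱ = h ⊗ f`. Only this order of
composition is computed; the other one will follow from finite dimension. -/
theorem tail_actDualInv_actDual {W : C} [SelfSymmetric H] [IsIso 𝒮[H]] : box22 (actDualInv H Hd) W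
    ≫ box22 (actDual H Hd) _ = 𝟙 _ :=
  pre1 tail_actDual ⟫
  pre2 (post13 (whisker13 tail_hatAct')) ⟫
  post22 box22_exchange' ⟫
  pre1 (post22 box22_exchange') ⟫
  pre2 (post22 box22_exchange') ⟫
  pre3 (post25 tail_actDualInv_evaluation) ⟫
  pre2 (post23 (whisker23 (whisker23 swap_left12))) ⟫
  pre5 (post22 (whisker22 (whisker22 swap_right11))) ⟫
  pre8 tail_mul_mul.symm ⟫
  pre4 (post22 (whisker22 (whisker22 box11_exchange))) ⟫
  pre7 (post22 (whisker22 box20_exchange')) ⟫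
  pre5 (post32 (whisker32 (whisker32 swap_right21))) ⟫
  pre1 (post22 (whisker22 (whisker22 tail_comul_comul))) ⟫
  pre2 (post42 (whisker42 (whisker42 tail_inv_antipode_left))) ⟫
  pre1 (post20 (whisker20 (whisker20 tail_comul_counit_left))) ⟫
  pre1 (post21 (whisker21 (whisker21 swap_right01.symm))) ⟫
  pre1 (post22 (whisker22 box20_exchange)) ⟫
  post20 (whisker20 tail_coevaluation_evaluation) ⟫
  tail_mul_one

/-- Combines multiplicativity into `H ⊗ R ⊗ Hd` with the comparison to the braided tensor product,
and collects the coevaluations back into `actDual`. -/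
theorem tail_smash_mul_toTensor {W : C} [SelfSymmetric H] [IsIso 𝒮[H]] [ModuleAlgebra H R] : R ◁
    (H ◁ (box12 (hatComul H Hd) (R ⊗ (H ⊗ (Hd ⊗ W))))) ≫ _ ◁ (_ ◁ (_ ◁ (swap Hd R _))) ≫ _ ◁ (_ ◁
    (_ ◁ (_ ◁ (swap Hd H _)))) ≫ _ ◁ (_ ◁ (swap Hd R _)) ≫ _ ◁ (_ ◁ (_ ◁ (box21 (hatAct H Hd) _)))
    ≫ _ ◁ (box22 (entwine H R) _) ≫ box21 μ[R] _ ≫ _ ◁ (box21 μ[H] _) ≫ _ ◁ (_ ◁ (box21 (hatMul H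
    Hd) _)) ≫ _ ◁ (box22 (actDual H Hd) _) ≫ box22 (entwineInv H R) _ ≫ swap H R _ = _ ◁ (box22
    (actDual H Hd) _) ≫ box22 (entwineInv H R) _ ≫ swap H R _ ≫ _ ◁ (_ ◁ (_ ◁ (_ ◁ (box22 (actDual
    H Hd) _)))) ≫ _ ◁ (_ ◁ (_ ◁ (box22 (entwineInv H R) _))) ≫ _ ◁ (_ ◁ (_ ◁ (swap H R _))) ≫ _ ◁
    (_ ◁ (swap Hd R _)) ≫ _ ◁ (swap H R _) ≫ box21 μ[R] _ ≫ _ ◁ (_ ◁ (box20 (ε_ H Hd) _)) :=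
  pre9 (post13 (whisker13 tail_actDual)) ⟫
  post1310 tail_toPair_mul.symm ⟫
  pre8 tail_pair_mul_swap ⟫
  pre4 (post31 (whisker31 (whisker31 (whisker31 (whisker31 tail_actDual.symm))))) ⟫
  pre5 (post22 box22_exchange) ⟫
  pre4 (post22 box22_exchange) ⟫
  post31 (whisker31 tail_actDual.symm)

theorem tail_smash_one_toTensor {W : C} [SelfSymmetric H] [IsIso 𝒮[H]] [ModuleAlgebra H R] : box01
    η[R] W ≫ _ ◁ (box01 η[H] _) ≫ _ ◁ (_ ◁ (box01 (dualOne H Hd) _)) ≫ _ ◁ (box22 (actDual H Hd)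
    _) ≫ box22 (entwineInv H R) _ ≫ swap H R _ = box02 (η_ H Hd) _ ≫ box01 η[R] _ :=
  pre3 (post13 (whisker13 tail_actDual)) ⟫
  post72 tail_toPair_one ⟫
  tail_pair_one_swap

/-! ### The dual as a Hopf module over `H` -/

theorem tail_dualAct_evaluation {W : C} : box21 (dualAct H Hd) (H ⊗ W) ≫ box20 (ε_ H Hd) _ = swap
    H Hd _ ≫ _ ◁ (box11 𝒮[H] _) ≫ _ ◁ (box21 μ[H] _) ≫ box20 (ε_ H Hd) _ :=
  post15 tail_dualAct ⟫
  pre4 box20_exchange' ⟫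
  pre3 (post22 (whisker22 box21_exchange')) ⟫
  pre2 (post20 (whisker20 (whisker20 tail_evaluation_coevaluation)))

/-- The coaction is characterised by `f₋₁ ⟨f₀, x⟩ = ⟨f, x₁⟩ x₂`, as the action is by `⟨h f, x⟩ = ⟨f,
S(h) x⟩`. Identities between maps into `Hd` are proved by pairing with `x` and removing the pairing
by the zigzag identity. -/
theorem tail_dualCoact_evaluation {W : C} : box12 (dualCoact H Hd) (H ⊗ W) ≫ _ ◁ (box20 (ε_ H Hd)
    _) = _ ◁ (box12 Δ[H] _) ≫ box20 (ε_ H Hd) _ :=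
  post13 tail_dualCoact ⟫
  pre2 box20_exchange' ⟫
  pre1 (post22 (whisker22 box12_exchange')) ⟫
  post20 (whisker20 tail_evaluation_coevaluation)

/-- `S` is an antihomomorphism, so `⟨f, S(h h') x⟩ = ⟨f, S(h') S(h) x⟩`. -/
theorem tail_mul_dualAct_evaluation {W : C} : box21 μ[H] (Hd ⊗ (H ⊗ W)) ≫ box21 (dualAct H Hd) _ ≫
    box20 (ε_ H Hd) _ = _ ◁ (box21 (dualAct H Hd) _) ≫ box21 (dualAct H Hd) _ ≫ box20 (ε_ H Hd) _
    :=
  pre1 tail_dualAct_evaluation ⟫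
  post23 swap_right21.symm ⟫
  pre2 (post24 (whisker24 tail_mul_antipode)) ⟫
  pre3 (post22 (whisker22 swap_left11.symm)) ⟫
  pre2 (post22 (whisker22 swap_right11.symm)) ⟫
  pre3 (post22 (whisker22 box11_exchange)) ⟫
  pre5 (post22 (whisker22 tail_mul_mul.symm)) ⟫
  post33 swap_left22.symm ⟫
  pre3 (post22 (whisker22 box11_exchange')) ⟫
  pre2 (post22 box22_exchange') ⟫
  pre4 (post22 (whisker22 box11_exchange')) ⟫
  pre3 (post22 box22_exchange') ⟫
  pre4 tail_dualAct_evaluation.symm ⟫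
  pre3 (post22 box21_exchange) ⟫
  pre2 (post22 box21_exchange) ⟫
  post32 swap_left21 ⟫
  pre1 tail_dualAct_evaluation.symm

theorem tail_mul_dualAct {W : C} : box21 μ[H] (Hd ⊗ W) ≫ box21 (dualAct H Hd) _ = _ ◁ (box21
    (dualAct H Hd) _) ≫ box21 (dualAct H Hd) _ :=
  pre1 (end02 ((tail_coevaluation_evaluation (H := H)).symm)) ⟫
  pre1 (post22 box21_exchange') ⟫
  post22 box21_exchange' ⟫
  pre1 tail_mul_dualAct_evaluation ⟫
  post22 (whisker22 box21_exchange) ⟫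
  pre1 (post22 box21_exchange) ⟫
  pre1 (end20 tail_coevaluation_evaluation)

theorem tail_one_dualAct {W : C} : box01 η[H] (Hd ⊗ W) ≫ box21 (dualAct H Hd) _ = 𝟙 _ :=
  pre1 tail_dualAct ⟫
  post21 swap_right01.symm ⟫
  post21 (whisker21 tail_one_antipode) ⟫
  post22 (whisker22 box01_exchange') ⟫
  pre1 (post20 (whisker20 tail_one_mul)) ⟫
  tail_coevaluation_evaluation

theorem tail_dualCoact_counit {W : C} : box12 (dualCoact H Hd) W ≫ box10 ε[H] _ = 𝟙 _ :=
  post13 tail_dualCoact ⟫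
  pre2 box20_exchange' ⟫
  pre1 (post20 (whisker20 tail_comul_counit_right)) ⟫
  tail_coevaluation_evaluation

/-- Coassociativity of `H`: both sides pair with `x` to the last two legs of the coproduct of `x`,
the first leg being paired with `f`. -/
theorem tail_dualCoact_comul {W : C} : box12 (dualCoact H Hd) W ≫ box12 Δ[H] _ = box12 (dualCoact
    H Hd) _ ≫ _ ◁ (box12 (dualCoact H Hd) _) :=
  post13 tail_dualCoact ⟫
  pre2 box20_exchange' ⟫
  pre1 (post22 (whisker22 tail_comul_comul)) ⟫
  pre2 tail_dualCoact_evaluation.symm ⟫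
  pre1 (post22 box12_exchange) ⟫
  post22 box12_exchange ⟫
  pre1 (whisker31 tail_dualCoact.symm)

/-- The computation behind the Hopf module axiom: `S` reverses the coproduct, so the left side is
`S(h₃) x₁ ⊗ h₁ S(h₂) x₂`, and `h₁ S(h₂)` collapses to the counit. -/
theorem tail_comul_antipode_mul_comul {W : C} : box12 Δ[H] (H ⊗ W) ≫ _ ◁ (box11 𝒮[H] _) ≫ _ ◁
    (box21 μ[H] _) ≫ _ ◁ (box12 Δ[H] _) ≫ swap H H _ ≫ _ ◁ (box21 μ[H] _) = _ ◁ (box12 Δ[H] _) ≫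
    box11 𝒮[H] _ ≫ box21 μ[H] _ :=
  pre2 (post25 (whisker25 tail_mul_comul)) ⟫
  pre1 (post22 (whisker22 box11_exchange')) ⟫
  pre2 (post24 (whisker24 tail_antipode_comul)) ⟫
  pre1 (post22 (whisker22 box12_exchange)) ⟫
  pre2 (post22 (whisker22 box22_exchange)) ⟫
  pre3 (post22 (whisker22 box11_exchange)) ⟫
  pre4 (post22 (whisker22 (whisker22 box11_exchange))) ⟫
  pre3 (post22 (whisker22 box11_exchange')) ⟫
  pre2 (post22 (whisker22 swap_right11)) ⟫
  pre7 (post22 (whisker22 box21_exchange')) ⟫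
  pre8 (post23 swap_left21.symm) ⟫
  pre4 (post22 (whisker22 box11_exchange')) ⟫
  pre5 (post22 (whisker22 box11_exchange')) ⟫
  pre6 (post22 (whisker22 box11_exchange')) ⟫
  pre7 (post22 swap_left11.symm) ⟫
  pre6 (post22 box22_exchange) ⟫
  pre7 (post22 box11_exchange) ⟫
  pre8 (post22 (whisker22 box22_exchange)) ⟫
  pre9 (post22 box21_exchange) ⟫
  pre9 (pre1 (whisker22 tail_mul_mul)) ⟫
  pre3 (post22 (whisker22 box22_exchange')) ⟫
  pre2 (post22 (whisker22 box11_exchange')) ⟫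
  pre1 (post22 (whisker22 box12_exchange')) ⟫
  post22 box12_exchange' ⟫
  pre5 (post22 box22_exchange) ⟫
  pre7 (post22 box11_exchange') ⟫
  pre9 (post22 box21_exchange') ⟫
  pre8 (post22 box11_exchange') ⟫
  pre6 (post32 (whisker32 swap_right21)) ⟫
  pre4 (post32 swap_right21) ⟫
  pre1 (post22 tail_comul_comul) ⟫
  pre2 (post32 tail_antipode_right) ⟫
  pre1 (post20 tail_comul_counit_left) ⟫
  pre1 (post21 swap_right01.symm) ⟫
  pre1 (post21 (whisker21 swap_right01.symm)) ⟫
  pre1 (post22 box11_exchange) ⟫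
  pre2 (post22 box21_exchange) ⟫
  pre2 (end20 (whisker20 tail_one_mul))

/-- Pairing `h₁ f₋₁ ⊗ h₂ f₀` with `x` gives `⟨f, (S(h₂) x)₁⟩ h₁ (S(h₂) x)₂`, which
`tail_comul_antipode_mul_comul` simplifies to `⟨f, S(h) x₁⟩ x₂`. -/
theorem tail_dualAct_dualCoact_evaluation {W : C} : box12 Δ[H] (Hd ⊗ (H ⊗ W)) ≫ _ ◁ (_ ◁ (box12
    (dualCoact H Hd) _)) ≫ _ ◁ (swap H H _) ≫ box21 μ[H] _ ≫ _ ◁ (box21 (dualAct H Hd) _) ≫ _ ◁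
    (box20 (ε_ H Hd) _) = box21 (dualAct H Hd) _ ≫ box12 (dualCoact H Hd) _ ≫ _ ◁ (box20 (ε_ H Hd)
    _) :=
  pre4 (whisker24 tail_dualAct_evaluation) ⟫
  pre3 (post22 box21_exchange') ⟫
  pre4 (post22 box21_exchange') ⟫
  pre5 (post22 box21_exchange') ⟫
  pre1 (post32 (whisker32 swap_left12.symm)) ⟫
  pre2 (post22 (whisker22 box12_exchange')) ⟫
  pre3 (post22 (whisker22 box12_exchange')) ⟫
  pre5 box21_exchange' ⟫
  pre4 (post22 (whisker22 tail_dualCoact_evaluation)) ⟫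
  pre5 (post13 swap_left20.symm) ⟫
  pre4 (post22 box22_exchange) ⟫
  pre3 (post22 box22_exchange) ⟫
  pre2 (post22 box22_exchange) ⟫
  post32 swap_right12.symm ⟫
  pre6 box20_exchange' ⟫
  pre1 (post63 (whisker63 tail_comul_antipode_mul_comul)) ⟫
  post22 box22_exchange' ⟫
  pre1 tail_dualAct_evaluation.symm ⟫
  post22 box21_exchange ⟫
  pre1 tail_dualCoact_evaluation.symm

/-- The Hopf module axiom: the coaction of `h f` is `h₁ f₋₁ ⊗ h₂ f₀`. -/
theorem tail_dualAct_dualCoact {W : C} : box21 (dualAct H Hd) W ≫ box12 (dualCoact H Hd) _ = box12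
    Δ[H] _ ≫ _ ◁ (_ ◁ (box12 (dualCoact H Hd) _)) ≫ _ ◁ (swap H H _) ≫ box21 μ[H] _ ≫ _ ◁ (box21
    (dualAct H Hd) _) :=
  pre1 (end02 (whisker02 ((tail_coevaluation_evaluation (H := H)).symm))) ⟫
  pre1 (post22 box12_exchange') ⟫
  post22 box21_exchange' ⟫
  pre1 tail_dualAct_dualCoact_evaluation.symm ⟫
  post22 box12_exchange ⟫
  pre1 (post22 (whisker22 (whisker22 box12_exchange))) ⟫
  pre2 (post22 (whisker22 box22_exchange)) ⟫
  pre3 (post22 box21_exchange) ⟫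
  pre4 (post22 (whisker22 box21_exchange)) ⟫
  pre4 (end20 (whisker20 tail_coevaluation_evaluation))

/-- `f₋₁ P(f₀) = f₋₂ S(f₋₁) f₀ = f`. In particular the dual vanishes if `P` does. -/
theorem tail_dualCoact_dualProj_dualAct {W : C} : box12 (dualCoact H Hd) W ≫ _ ◁ (box11 (dualProj
    H Hd) _) ≫ box21 (dualAct H Hd) _ = 𝟙 _ :=
  pre1 (post13 (whisker13 tail_dualProj)) ⟫
  pre3 tail_mul_dualAct.symm ⟫
  post22 tail_dualCoact_comul.symm ⟫
  pre1 (post32 tail_antipode_right) ⟫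
  post20 tail_dualCoact_counit ⟫
  tail_one_dualAct

/-- The image of `P` is coinvariant: the coaction of `S(f₋₁) f₀` contains a factor `S(f₋₂) f₋₁` next
to the legs that form `P`, and this factor collapses. -/
theorem tail_dualProj_dualCoact {W : C} : box11 (dualProj H Hd) W ≫ box12 (dualCoact H Hd) _ =
    box11 (dualProj H Hd) _ ≫ box01 η[H] _ :=
  post13 tail_dualProj ⟫
  pre2 tail_dualAct_dualCoact ⟫
  pre1 (post24 tail_antipode_comul) ⟫
  pre4 (post22 (whisker22 box11_exchange')) ⟫
  pre3 (post22 box11_exchange') ⟫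
  pre2 (post22 box22_exchange') ⟫
  pre1 (post22 box12_exchange') ⟫
  post22 tail_dualCoact_comul.symm ⟫
  pre1 (post22 tail_comul_comul.symm) ⟫
  pre5 (post22 (whisker22 swap_right11.symm)) ⟫
  pre4 (post22 box11_exchange') ⟫
  pre4 (post22 box11_exchange) ⟫
  pre3 (post22 swap_left11) ⟫
  pre6 (post22 box21_exchange) ⟫
  pre4 (post32 swap_left21) ⟫
  pre2 (post32 (whisker32 tail_antipode_left)) ⟫
  pre1 (post20 tail_comul_counit_right) ⟫
  pre1 (post21 swap_left01.symm) ⟫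
  pre1 (post22 box01_exchange') ⟫
  pre2 box01_exchange' ⟫
  post31 tail_dualProj.symm

/-- Since `P(f)` is coinvariant, the coaction of `h P(f)` is `h₁ ⊗ h₂ P(f)`; then `h₁ ⊗ S(h₂) h₃
P(f) = h ⊗ P(f)`. Thus `h ⊗ P(f)` is recovered from `h P(f)`. -/
theorem tail_dualProj_dualAct_dualCoact {W : C} : H ◁ (box11 (dualProj H Hd) W) ≫ box21 (dualAct H
    Hd) _ ≫ box12 (dualCoact H Hd) _ ≫ box12 Δ[H] _ ≫ _ ◁ (box11 𝒮[H] _) ≫ _ ◁ (box21 (dualAct H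
    Hd) _) = _ ◁ (box11 (dualProj H Hd) _) :=
  pre1 (post25 tail_dualAct_dualCoact) ⟫
  post22 box12_exchange ⟫
  pre1 (post22 (whisker22 (whisker22 tail_dualProj_dualCoact))) ⟫
  post22 box12_exchange' ⟫
  pre2 (post21 (whisker21 swap_left01.symm)) ⟫
  pre2 (post20 tail_mul_one) ⟫
  pre2 (post22 box12_exchange) ⟫
  pre3 (post22 (whisker22 box11_exchange)) ⟫
  pre1 (post22 tail_comul_comul.symm) ⟫
  pre4 (whisker22 tail_mul_dualAct.symm) ⟫
  pre2 (post32 (whisker32 tail_antipode_left)) ⟫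
  pre1 (post20 tail_comul_counit_right) ⟫
  end20 (whisker20 tail_one_dualAct)

/-- With the antipode moved to the front, the action visibly factors through `S` on `H`. -/
theorem tail_dualAct' {W : C} : box21 (dualAct H Hd) W = box11 𝒮[H] _ ≫ swap H Hd _ ≫ _ ◁ (_ ◁
    (box02 (η_ H Hd) _)) ≫ _ ◁ (box21 μ[H] _) ≫ box20 (ε_ H Hd) _ :=
  tail_dualAct ⟫
  post22 swap_right11

/-- The key to injectivity of `S`: the tensor `h ⊗ P(f)` is a function of `S(h) ⊗ f`. -/
theorem tail_dualProj_eq_antipode_comp {W : C} : H ◁ (box11 (dualProj H Hd) W) = box11 𝒮[H] _ ≫ _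
    ◁ (box11 (dualProj H Hd) _) ≫ swap H Hd _ ≫ _ ◁ (_ ◁ (box02 (η_ H Hd) _)) ≫ _ ◁ (box21 μ[H] _)
    ≫ box20 (ε_ H Hd) _ ≫ box12 (dualCoact H Hd) _ ≫ box12 Δ[H] _ ≫ _ ◁ (box11 𝒮[H] _) ≫ _ ◁
    (box21 (dualAct H Hd) _) :=
  tail_dualProj_dualAct_dualCoact.symm ⟫
  pre1 (post15 tail_dualAct') ⟫
  post22 box11_exchange

end Diagrams

end BraidedDuality

namespace BraidedDuality

universe v₁ u₁

/-! ### The isomorphism with the braided tensor product -/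

section SmashIso

open CategoryTheory MonoidalCategory
open scoped MonObj ComonObj HopfObj

variable {C : Type u₁} [Category.{v₁} C] [MonoidalCategory C] [BraidedCategory C]

/-- Taking the unit object as last factor loses nothing, so identities between boxes return to
identities between morphisms. -/
theorem eq_id_of_box22 {X Y : C} {f : X ⊗ Y ⟶ X ⊗ Y} (h : box22 f (𝟙_ C) = 𝟙 _) : f = 𝟙 _ := by
  calc
    f = 𝟙 _ ⊗≫ box22 f (𝟙_ C) ⊗≫ 𝟙 _ := by simp only [box22]; monoidal
    _ = 𝟙 _ := by rw [h]; monoidal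

variable (H Hd R : C) [HopfObj H] [ExactPairing H Hd] [MonObj R]

/-- The map `entwine` as an isomorphism. -/
noncomputable def entwineIso [SelfSymmetric H] [IsIso 𝒮[H]] [ModuleAlgebra H R] :
    H ⊗ R ≅ R ⊗ H where
  hom := entwine H R
  inv := entwineInv H R
  hom_inv_id := eq_id_of_box22 ((box22_comp _ _).symm.trans tail_entwine_entwineInv)
  inv_hom_id := eq_id_of_box22 ((box22_comp _ _).symm.trans tail_entwineInv_entwine)

theorem actDualInv_actDual [SelfSymmetric H] [IsIso 𝒮[H]] :
    actDualInv H Hd ≫ actDual H Hd = 𝟙 _ :=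
  eq_id_of_box22 ((box22_comp _ _).symm.trans tail_actDualInv_actDual)

/-- The isomorphism from the iterated smash product to the braided tensor product. -/
noncomputable def smashIso [SelfSymmetric H] [IsIso 𝒮[H]] [IsIso (actDual H Hd)]
    [ModuleAlgebra H R] : (R ⊗ H) ⊗ Hd ≅ R ⊗ (H ⊗ Hd) :=
  -- `r ⊗ h ⊗ f` goes to `Σ r # h (f ⇀ bᵢ) ⊗ bⁱ`; then `R # H` is identified with `H ⊗ R`, and `H`
  -- is braided past `R`.
  α_ _ _ _ ≪≫ whiskerLeftIso R (asIso (actDual H Hd)) ≪≫ (α_ _ _ _).symm ≪≫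
    whiskerRightIso ((entwineIso H R).symm ≪≫ β_ H R) Hd ≪≫ α_ _ _ _

theorem smashIso_mul [SelfSymmetric H] [IsIso 𝒮[H]] [IsIso (actDual H Hd)] [ModuleAlgebra H R] :
    doubleSmashMul R H Hd (ModuleAlgebra.act H R) ≫ (smashIso H Hd R).hom =
      ((smashIso H Hd R).hom ⊗ₘ (smashIso H Hd R).hom) ≫ tensorMul μ[R] (pairMul H Hd) := by
  have h := tail_smash_mul_toTensor (H := H) (Hd := Hd) (R := R) (W := 𝟙_ C)
  -- The diagram identity, taken with unit last factor, is padded with coherence isomorphisms on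
  -- both ends. After unfolding, each side differs from the wanted one only by associators and
  -- unitors.
  have e := congrArg (fun f => 𝟙 (((R ⊗ H) ⊗ Hd) ⊗ ((R ⊗ H) ⊗ Hd)) ⊗≫ f ⊗≫ 𝟙 (R ⊗ (H ⊗ Hd))) h
  simp only [box21, box12, box22, box20, entwine] at e
  refine Eq.trans ?_ (e.trans ?_)
  · simp only [doubleSmashMul, smashMul, hatActSmash, smashIso, entwineIso, Iso.trans_hom,
      BraidedCategory.braiding_tensor_right_hom, whiskerLeftIso_hom, whiskerRightIso_hom,
      asIso_hom, Iso.symm_hom, MonoidalCategory.tensorHom_def]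
    monoidal
  · simp only [tensorMul, pairMul, tensorμ, smashIso, entwineIso, Iso.trans_hom,
      BraidedCategory.braiding_tensor_left_hom, whiskerLeftIso_hom, whiskerRightIso_hom,
      asIso_hom, Iso.symm_hom, MonoidalCategory.tensorHom_def]
    monoidal

theorem smashIso_one [SelfSymmetric H] [IsIso 𝒮[H]] [IsIso (actDual H Hd)] [ModuleAlgebra H R] :
    doubleSmashOne R H Hd ≫ (smashIso H Hd R).hom = tensorOne η[R] (pairOne H Hd) := by
  have h := tail_smash_one_toTensor (H := H) (Hd := Hd) (R := R) (W := 𝟙_ C)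
  have e := congrArg (fun f => f ⊗≫ 𝟙 (R ⊗ (H ⊗ Hd))) h
  simp only [box01, box22, box02] at e
  refine Eq.trans ?_ (e.trans ?_)
  · simp only [doubleSmashOne, tensorOne, smashIso, entwineIso, Iso.trans_hom,
      whiskerLeftIso_hom, whiskerRightIso_hom,
      asIso_hom, Iso.symm_hom, MonoidalCategory.tensorHom_def]
    monoidal
  · simp only [tensorOne, pairOne, MonoidalCategory.tensorHom_def']
    monoidal

theorem smashIso_isAlgebraIso [SelfSymmetric H] [IsIso 𝒮[H]] [IsIso (actDual H Hd)]
    [ModuleAlgebra H R] :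
    IsAlgebraIso (doubleSmashMul R H Hd (ModuleAlgebra.act H R)) (doubleSmashOne R H Hd)
      (tensorMul μ[R] (pairMul H Hd)) (tensorOne η[R] (pairOne H Hd)) (smashIso H Hd R) :=
  ⟨smashIso_mul H Hd R, smashIso_one H Hd R⟩

end SmashIso

end BraidedDuality

namespace BraidedDuality

universe u v w

/-! ### Dual objects are dual vector spaces -/

section Linear

open CategoryTheory MonoidalCategory
open scoped MonObj ComonObj HopfObj TensorProduct

namespace BraidedKind

variable {k : Type u} [Field k] {D : BraidedKind.{u, w} k}

theorem comp_lin {X Y Z : D.Obj} (f : X ⟶ Y) (g : Y ⟶ Z) : (f ≫ g).lin = g.lin ∘ₗ f.lin := rfl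

theorem comp_lin_apply {X Y Z : D.Obj} (f : X ⟶ Y) (g : Y ⟶ Z) (x : X.carrier) :
    (f ≫ g).lin x = g.lin (f.lin x) := rfl

/-- A bijective morphism is an isomorphism. -/
theorem isIso_of_bijective {X Y : D.Obj} (f : X ⟶ Y) (hf : Function.Bijective f.lin) : IsIso f :=
  (mkIso (LinearEquiv.ofBijective f.lin hf) f.isHom).isIso_hom

section Pairing

variable {H Hd : D.Obj} [ExactPairing H Hd]

/-- The map `f ↦ ⟨f, ·⟩` to the dual space. -/
noncomputable def toDual (H Hd : D.Obj) [ExactPairing H Hd] : Hd.carrier →ₗ[k] H.carrier →ₗ[k] k :=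
  TensorProduct.curry (ε_ H Hd).lin

theorem toDual_apply (f : Hd.carrier) (x : H.carrier) : toDual H Hd f x = pairing f x := rfl

/-- The coevaluation at `1`. -/
def coev (H Hd : D.Obj) [ExactPairing H Hd] : H.carrier ⊗[k] Hd.carrier := (η_ H Hd).lin (1 : k)

/-- The zigzag identity on `Hd`, evaluated at an element: `Σ ⟨f, bᵢ⟩ bⁱ = f`. -/
theorem toDual_coev (f : Hd.carrier) :
    TensorProduct.lid k _ ((toDual H Hd f).rTensor Hd.carrier (coev H Hd)) = f := by
  have h := congrArg Hom.lin (ExactPairing.coevaluation_evaluation H Hd)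
  have h1 := LinearMap.congr_fun h (f ⊗ₜ[k] (1 : k))
  -- The zigzag with the coevaluation replaced by a variable tensor: both sides are then linear in
  -- it and can be compared on pure tensors.
  have h2 : (show Hd.carrier ⊗[k] (H.carrier ⊗[k] Hd.carrier) →ₗ[k] Hd.carrier from
      ((α_ Hd H Hd).inv ≫ ε_ H Hd ▷ Hd ≫ (λ_ Hd).hom).lin) ∘ₗ TensorProduct.mk k _ _ f =
        (TensorProduct.lid k _).toLinearMap ∘ₗ (toDual H Hd f).rTensor Hd.carrier :=
    TensorProduct.ext' fun x y => rfl
  have h3 := congrArg (λ_ Hd).hom.lin h1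
  refine (LinearMap.congr_fun h2 _).symm.trans (h3.trans ?_)
  exact (one_smul k _).trans (one_smul k f)

/-- The zigzag identity on `H`, followed by `φ`: `Σ φ(bᵢ) ⟨bⁱ, x⟩ = φ(x)`. -/
theorem coev_toDual (φ : H.carrier →ₗ[k] k) :
    toDual H Hd (TensorProduct.lid k _ (φ.rTensor Hd.carrier (coev H Hd))) = φ := by
  ext x
  have h := congrArg Hom.lin (ExactPairing.evaluation_coevaluation H Hd)
  have h1 := LinearMap.congr_fun h ((1 : k) ⊗ₜ[k] x)
  have h2 : φ ∘ₗ (show (H.carrier ⊗[k] Hd.carrier) ⊗[k] H.carrier →ₗ[k] H.carrier from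
      ((α_ H Hd H).hom ≫ H ◁ ε_ H Hd ≫ (ρ_ H).hom).lin) ∘ₗ
        (TensorProduct.mk k _ H.carrier).flip x =
      (toDual H Hd).flip x ∘ₗ (TensorProduct.lid k _).toLinearMap ∘ₗ φ.rTensor Hd.carrier :=
    TensorProduct.ext' fun y f => by
      change φ (toDual H Hd f x • y) = toDual H Hd (φ y • f) x
      simp [mul_comm]
  have h3 := congrArg (fun z => φ ((ρ_ H).hom.lin z)) h1
  refine (LinearMap.congr_fun h2 _).symm.trans (h3.trans ?_)
  exact congrArg φ ((one_smul k _).trans (one_smul k x))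

/-- A left dual is the dual space. -/
noncomputable def dualEquiv (H Hd : D.Obj) [ExactPairing H Hd] :
    Hd.carrier ≃ₗ[k] (H.carrier →ₗ[k] k) :=
  { toDual H Hd with
    invFun := fun φ => TensorProduct.lid k _ (φ.rTensor Hd.carrier (coev H Hd))
    left_inv := toDual_coev
    right_inv := coev_toDual }

theorem finite_of_exactPairing (H Hd : D.Obj) [ExactPairing H Hd] [Module.Finite k H.carrier] :
    Module.Finite k Hd.carrier :=
  Module.Finite.equiv (dualEquiv H Hd).symm

end Pairing

end BraidedKind

end Linear

end BraidedDuality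

namespace BraidedDuality

universe u v w

/-! ### Invertibility of the antipode of `H` -/

section Antipode

open CategoryTheory MonoidalCategory
open scoped MonObj ComonObj HopfObj TensorProduct

/-- If `w ≠ 0`, a functional `φ` with `φ(w) ≠ 0` maps `v ⊗ w` to `φ(w) v`. -/
theorem eq_zero_of_tmul_eq_zero {k V W : Type*} [Field k] [AddCommGroup V] [Module k V]
    [AddCommGroup W] [Module k W] {v : V} {w : W} (h : v ⊗ₜ[k] w = 0) : v = 0 ∨ w = 0 := by
  by_contra! hc
  obtain ⟨φ, hφ⟩ := not_forall.1 (mt (Module.forall_dual_apply_eq_zero_iff k w).1 hc.2)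
  have := congrArg (TensorProduct.rid k V ∘ φ.lTensor V) h
  simp at this
  tauto

namespace BraidedKind

variable {k : Type u} [Field k] {D : BraidedKind.{u, w} k}

/-- The antipode of a Hopf algebra with a left dual is injective. -/
theorem antipode_injective (H Hd : D.Obj) [HopfObj H] [ExactPairing H Hd] [SelfSymmetric H] :
    Function.Injective (𝒮[H]).lin := by
  refine (injective_iff_map_eq_zero _).2 fun z hz => ?_
  -- `z ⊗ P(f)` is the image of `S(z) ⊗ f = 0` under a linear map. The extra factor `1` is the unit
  -- object used as last factor.
  have h (f : Hd.carrier) : z = 0 ∨ (dualProj H Hd).lin f = 0 := by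
    have h1 := LinearMap.congr_fun (congrArg Hom.lin
      (tail_dualProj_eq_antipode_comp (H := H) (Hd := Hd) (W := 𝟙_ D.Obj)))
      (z ⊗ₜ[k] (f ⊗ₜ[k] (1 : k)))
    have h2 : z ⊗ₜ[k] ((dualProj H Hd).lin f ⊗ₜ[k] (1 : k)) = 0 := by
      refine h1.trans ((comp_lin_apply _ _ _).trans ((congrArg _ ?_).trans (map_zero _)))
      exact (congrArg (· ⊗ₜ[k] (f ⊗ₜ[k] (1 : k))) hz).trans (TensorProduct.zero_tmul _ _)
    refine (eq_zero_of_tmul_eq_zero h2).imp id fun h3 => ?_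
    exact (eq_zero_of_tmul_eq_zero h3).resolve_right one_ne_zero
  by_contra hz0
  -- For `z ≠ 0`, the preceding alternative gives `P = 0`.
  have hP : (H ◁ box11 (dualProj H Hd) (𝟙_ D.Obj)).lin = 0 :=
    TensorProduct.ext' fun x y => by
      have : (box11 (dualProj H Hd) (𝟙_ D.Obj)).lin = 0 := TensorProduct.ext' fun f c =>
        (congrArg (· ⊗ₜ[k] c) ((h f).resolve_left hz0)).trans (TensorProduct.zero_tmul _ _)
      exact (congrArg (x ⊗ₜ[k] ·) (LinearMap.congr_fun this y)).trans (TensorProduct.tmul_zero _ _)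
  -- The identity of `Hd` factors through `P = 0`, so `Hd = 0`; hence every functional on `H`
  -- vanishes, and `z = 0` after all.
  have hf (f : Hd.carrier) : f = 0 := by
    have h1 := congrArg Hom.lin
      (tail_dualCoact_dualProj_dualAct (H := H) (Hd := Hd) (W := 𝟙_ D.Obj))
    rw [comp_lin, comp_lin, hP, LinearMap.comp_zero, LinearMap.zero_comp] at h1
    exact (eq_zero_of_tmul_eq_zero
      (LinearMap.congr_fun h1 (f ⊗ₜ[k] (1 : k))).symm).resolve_right one_ne_zero
  refine hz0 ((Module.forall_dual_apply_eq_zero_iff k z).1 fun φ => ?_)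
  have := (dualEquiv H Hd).symm.injective (a₁ := φ) (a₂ := 0) ((hf _).trans (hf _).symm)
  rw [this]; rfl

theorem isIso_antipode (H Hd : D.Obj) [HopfObj H] [ExactPairing H Hd] [SelfSymmetric H]
    [Module.Finite k H.carrier] : IsIso 𝒮[H] :=
  isIso_of_bijective _ ⟨antipode_injective H Hd,
    LinearMap.injective_iff_surjective.1 (antipode_injective H Hd)⟩

/-- The one-sided inverse gives surjectivity, and an endomorphism of a finite-dimensional space that
is surjective is injective. -/
theorem isIso_actDual (H Hd : D.Obj) [HopfObj H] [ExactPairing H Hd] [SelfSymmetric H]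
    [Module.Finite k H.carrier] [IsIso 𝒮[H]] : IsIso (actDual H Hd) := by
  have : Module.Finite k Hd.carrier := finite_of_exactPairing H Hd
  have h : Function.Surjective (actDual H Hd).lin := fun x =>
    ⟨(actDualInv H Hd).lin x, LinearMap.congr_fun (congrArg Hom.lin (actDualInv_actDual H Hd)) x⟩
  have : Module.Finite k (H ⊗ Hd).carrier :=
    inferInstanceAs (Module.Finite k (H.carrier ⊗[k] Hd.carrier))
  exact isIso_of_bijective _ ⟨LinearMap.injective_iff_surjective.2 h, h⟩

end BraidedKind

end Antipode

end BraidedDuality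

namespace BraidedDuality

/-! ### The endomorphism algebra `H ⊗ R ⊗ H*` and the braided tensor product -/

section Twist

universe v₁ u₁

open CategoryTheory MonoidalCategory
open scoped MonObj ComonObj

variable {C : Type u₁} [Category.{v₁} C] [MonoidalCategory C] [BraidedCategory C]

theorem IsAlgebraIso.trans {A B E : C} {mA : A ⊗ A ⟶ A} {uA : 𝟙_ C ⟶ A} {mB : B ⊗ B ⟶ B}
    {uB : 𝟙_ C ⟶ B} {mE : E ⊗ E ⟶ E} {uE : 𝟙_ C ⟶ E} {Φ : A ≅ B} {Ψ : B ≅ E}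
    (h : IsAlgebraIso mA uA mB uB Φ) (h' : IsAlgebraIso mB uB mE uE Ψ) :
    IsAlgebraIso mA uA mE uE (Φ ≪≫ Ψ) where
  mul := by
    rw [Iso.trans_hom, ← Category.assoc, h.mul, Category.assoc, h'.mul,
      ← MonoidalCategory.tensorHom_comp_tensorHom_assoc]
  one := by rw [Iso.trans_hom, ← Category.assoc, h.one, h'.one]

/-- Transport of an algebra structure along an isomorphism. -/
theorem isAlgebraIso_transport {A B : C} (mA : A ⊗ A ⟶ A) (uA : 𝟙_ C ⟶ A) (Φ : A ≅ B) :
    IsAlgebraIso mA uA ((Φ.inv ⊗ₘ Φ.inv) ≫ mA ≫ Φ.hom) (uA ≫ Φ.hom) Φ where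
  mul := by simp
  one := rfl

/-- The multiplication `(h ⊗ r ⊗ f)(h' ⊗ r' ⊗ f') = ⟨f, h'⟩ h ⊗ r r' ⊗ f'` on `H ⊗ (R ⊗ Hd)`. -/
def sandwichMul (H Hd R : C) [ExactPairing H Hd] [MonObj R] :
    (H ⊗ (R ⊗ Hd)) ⊗ (H ⊗ (R ⊗ Hd)) ⟶ H ⊗ (R ⊗ Hd) :=
  (α_ _ _ _).hom ≫ H ◁ (α_ _ _ _).hom ≫ H ◁ (R ◁ box20 (ε_ H Hd) _) ≫ H ◁ box21 μ[R] Hd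

/-- The unit of `sandwichMul`. -/
def sandwichOne (H Hd R : C) [ExactPairing H Hd] [MonObj R] : 𝟙_ C ⟶ H ⊗ (R ⊗ Hd) :=
  (η_ H Hd) ≫ H ◁ box01 η[R] Hd

/-- The braiding that identifies `H ⊗ (R ⊗ Hd)` and `R ⊗ (H ⊗ Hd)`. -/
def sandwichIso (H Hd R : C) : H ⊗ (R ⊗ Hd) ≅ R ⊗ (H ⊗ Hd) :=
  (α_ _ _ _).symm ≪≫ whiskerRightIso (β_ H R) Hd ≪≫ α_ _ _ _

/-- Only naturality of the braiding is used, through `tail_pair_mul_swap` and `tail_pair_one_swap`.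
The point is that matrices multiply like `H ⊗ R ⊗ Hd`, where the paired factors are separated by `R`
and no crossing occurs. -/
theorem sandwichIso_isAlgebraIso (H Hd R : C) [HopfObj H] [ExactPairing H Hd] [MonObj R] :
    IsAlgebraIso (sandwichMul H Hd R) (sandwichOne H Hd R) (tensorMul μ[R] (pairMul H Hd))
      (tensorOne η[R] (pairOne H Hd)) (sandwichIso H Hd R) where
  mul := by
    have e := congrArg (fun f => 𝟙 ((H ⊗ (R ⊗ Hd)) ⊗ (H ⊗ (R ⊗ Hd))) ⊗≫ f ⊗≫ 𝟙 (R ⊗ (H ⊗ Hd)))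
      (tail_pair_mul_swap (H := H) (Hd := Hd) (R := R) (W := 𝟙_ C))
    simp only [box21, box22, box20] at e
    refine Eq.trans ?_ (e.trans ?_)
    · simp only [sandwichMul, sandwichIso, box21, box20, Iso.trans_hom, whiskerRightIso_hom,
        Iso.symm_hom]
      monoidal
    · simp only [tensorMul, pairMul, tensorμ, sandwichIso, Iso.trans_hom, whiskerRightIso_hom,
        BraidedCategory.braiding_tensor_left_hom, Iso.symm_hom, MonoidalCategory.tensorHom_def]
      monoidal
  one := by
    have e := congrArg (fun f => f ⊗≫ 𝟙 (R ⊗ (H ⊗ Hd)))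
      (tail_pair_one_swap (H := H) (Hd := Hd) (R := R) (W := 𝟙_ C))
    simp only [box01, box22, box02] at e
    refine Eq.trans ?_ (e.trans ?_)
    · simp only [sandwichOne, sandwichIso, box01, Iso.trans_hom, whiskerRightIso_hom,
        Iso.symm_hom]
      monoidal
    · simp only [tensorOne, pairOne, MonoidalCategory.tensorHom_def']
      monoidal

/-- Braiding past the unit of `R` is trivial; this gives the prescribed matrices for `1 ⊗ v ⊗ f`. -/
theorem one_sandwichIso (H Hd R : C) [MonObj R] :
    H ◁ box01 η[R] Hd ≫ (sandwichIso H Hd R).hom = box01 η[R] (H ⊗ Hd) :=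
  swap_left01.symm

end Twist

universe u v w

/-! ### Coordinates: `H ⊗ R ⊗ H*` as matrices over `R` -/

section Matrices

open CategoryTheory MonoidalCategory
open scoped MonObj ComonObj HopfObj TensorProduct

namespace BraidedKind

variable {k : Type u} [Field k] {D : BraidedKind.{u, w} k}

variable {n : Type*} [Fintype n] [DecidableEq n]

variable (H Hd R : D.Obj) [ExactPairing H Hd]

/-- The linear isomorphism `h ⊗ r ⊗ f ↦ (e^i(h) ⟨f, e_j⟩ r)` to the matrices over `R`. -/
noncomputable def matrixEquiv (e : Module.Basis n k H.carrier) :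
    H.carrier ⊗[k] (R.carrier ⊗[k] Hd.carrier) ≃ₗ[k] Matrix n n R.carrier :=
  TensorProduct.congr e.equivFun (TensorProduct.congr (LinearEquiv.refl k R.carrier)
      (dualEquiv H Hd ≪≫ₗ (e.constr k).symm) ≪≫ₗ TensorProduct.piScalarRight k k R.carrier n) ≪≫ₗ
    TensorProduct.comm k _ _ ≪≫ₗ TensorProduct.piScalarRight k k (n → R.carrier) n ≪≫ₗ
    Matrix.ofLinearEquiv k

theorem matrixEquiv_tmul (e : Module.Basis n k H.carrier) (h : H.carrier) (r : R.carrier)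
    (f : Hd.carrier) : matrixEquiv H Hd R e (h ⊗ₜ[k] (r ⊗ₜ[k] f)) =
      Matrix.of fun i j => (e.repr h i * pairing f (e j)) • r := by
  ext i j
  simp [matrixEquiv, mul_smul]
  rfl

variable {H Hd R}

variable (R) in
/-- The multiplication of an algebra as a linear map. -/
def mulLin [MonObj R] : R.carrier ⊗[k] R.carrier →ₗ[k] R.carrier := (μ[R]).lin

theorem mulLin_smul_tmul_smul [MonObj R] (a b : k) (r r' : R.carrier) :
    mulLin R ((a • r) ⊗ₜ[k] (b • r')) = (a * b) • mulLin R (r ⊗ₜ[k] r') := by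
  rw [TensorProduct.smul_tmul_smul, map_smul]

theorem sandwichMul_lin_tmul [MonObj R] (h h' : H.carrier) (r r' : R.carrier) (f f' : Hd.carrier) :
    (sandwichMul H Hd R).lin ((h ⊗ₜ[k] (r ⊗ₜ[k] f)) ⊗ₜ[k] (h' ⊗ₜ[k] (r' ⊗ₜ[k] f'))) =
      h ⊗ₜ[k] ((pairing f h' • mulLin R (r ⊗ₜ[k] r')) ⊗ₜ[k] f') := by
  change h ⊗ₜ[k] (mulLin R (r ⊗ₜ[k] (pairing f h' • r')) ⊗ₜ[k] f') = _
  rw [TensorProduct.tmul_smul, map_smul]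

/-- A linear map on a tensor square is determined by its values on pure tensors. -/
theorem eq_of_eq_on_tmul {V W U N : Type*} [AddCommGroup V] [Module k V] [AddCommGroup W]
    [Module k W] [AddCommGroup U] [Module k U] [AddCommGroup N] [Module k N]
    (F : (V ⊗[k] (W ⊗[k] U)) ⊗[k] (V ⊗[k] (W ⊗[k] U)) →ₗ[k] N)
    (G : V ⊗[k] (W ⊗[k] U) → V ⊗[k] (W ⊗[k] U) → N)
    (hl : ∀ x y z, G (x + y) z = G x z + G y z) (hr : ∀ x y z, G x (y + z) = G x y + G x z)
    (h : ∀ v w u v' w' u', F ((v ⊗ₜ[k] (w ⊗ₜ[k] u)) ⊗ₜ[k] (v' ⊗ₜ[k] (w' ⊗ₜ[k] u'))) =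
      G (v ⊗ₜ[k] (w ⊗ₜ[k] u)) (v' ⊗ₜ[k] (w' ⊗ₜ[k] u'))) (x y) : F (x ⊗ₜ[k] y) = G x y := by
  have hl0 y : G 0 y = 0 := by simpa using hl 0 0 y
  have hr0 x : G x 0 = 0 := by simpa using hr x 0 0
  induction x with
  | zero => simp [hl0]
  | add x x' hx hx' => rw [TensorProduct.add_tmul, map_add, hx, hx', hl]
  | tmul v z =>
  induction z with
  | zero => simp [hl0]
  | add x x' hx hx' => rw [TensorProduct.tmul_add, TensorProduct.add_tmul, map_add, hx, hx', hl]
  | tmul w u =>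
  induction y with
  | zero => simp [hr0]
  | add x x' hx hx' => rw [TensorProduct.tmul_add, map_add, hx, hx', hr]
  | tmul v' z =>
  induction z with
  | zero => simp [hr0]
  | add x x' hx hx' => rw [TensorProduct.tmul_add, TensorProduct.tmul_add, map_add, hx, hx', hr]
  | tmul w' u' => exact h _ _ _ _ _ _

theorem ringOf_smul_mul_smul [MonObj R] (a b : k) (r r' : R.carrier) :
    letI := ringOf R
    (a • r) * (b • r') = (a * b) • (r * r') :=
  mulLin_smul_tmul_smul a b r r'

/-- Expanding `h` in the basis turns the pairing into the sum over the middle index of a matrix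
product. -/
theorem sum_coord_mul_pairing (e : Module.Basis n k H.carrier) (f : Hd.carrier) (h : H.carrier) :
    ∑ j, pairing f (e j) * e.repr h j = pairing f h := by
  conv_rhs => rw [← toDual_apply, ← e.sum_repr h, map_sum]
  simp [toDual_apply, mul_comm]

/-- On pure tensors the entry `(i, j)` of the product of matrices is `Σ_l eⁱ(h) ⟨f, e_l⟩ eˡ(h') ⟨f',
e_j⟩ r r'`, and the sum over `l` is `⟨f, h'⟩`. -/
theorem matrixEquiv_sandwichMul [MonObj R] (e : Module.Basis n k H.carrier)
    (x y : H.carrier ⊗[k] (R.carrier ⊗[k] Hd.carrier)) :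
    letI := ringOf R
    matrixEquiv H Hd R e ((sandwichMul H Hd R).lin (x ⊗ₜ[k] y)) =
      matrixEquiv H Hd R e x * matrixEquiv H Hd R e y := by
  let _ := ringOf R
  refine eq_of_eq_on_tmul ((matrixEquiv H Hd R e).toLinearMap ∘ₗ (sandwichMul H Hd R).lin)
    (fun x y => matrixEquiv H Hd R e x * matrixEquiv H Hd R e y) (fun x y z => ?_)
    (fun x y z => ?_) (fun h r f h' r' f' => ?_) x y
  · exact (congrArg (· * _) (map_add (matrixEquiv H Hd R e) x y)).trans (Matrix.add_mul _ _ _)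
  · exact (congrArg (_ * ·) (map_add (matrixEquiv H Hd R e) y z)).trans (Matrix.mul_add _ _ _)
  · refine (congrArg (matrixEquiv H Hd R e) (sandwichMul_lin_tmul h h' r r' f f')).trans ?_
    simp only [matrixEquiv_tmul]
    ext i j
    rw [Matrix.mul_apply]
    simp only [Matrix.of_apply]
    refine Eq.trans ?_ (Finset.sum_congr rfl fun l _ => (ringOf_smul_mul_smul _ _ r r').symm)
    refine Eq.trans ?_ (Finset.sum_smul (R := k) (M := R.carrier))
    rw [smul_smul, ← sum_coord_mul_pairing e f h', Finset.mul_sum]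
    refine congrArg (· • _) (Finset.sum_congr rfl fun l _ => ?_)
    ring

/-- The unit is `Σ b_m ⊗ 1 ⊗ bᵐ`, whose entry `(i, j)` is `Σ_m eⁱ(b_m) ⟨bᵐ, e_j⟩ = eⁱ(e_j)`. -/
theorem matrixEquiv_sandwichOne [MonObj R] (e : Module.Basis n k H.carrier) :
    letI := ringOf R
    matrixEquiv H Hd R e ((sandwichOne H Hd R).lin (1 : k)) = 1 := by
  let _ := ringOf R
  ext i j
  -- An entry is written as a linear map on all of `H ⊗ Hd`, because the coevaluation is not given
  -- as an explicit sum of pure tensors.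
  have h : LinearMap.proj j ∘ₗ LinearMap.proj i ∘ₗ (Matrix.ofLinearEquiv k).symm.toLinearMap ∘ₗ
      (matrixEquiv H Hd R e).toLinearMap ∘ₗ (H ◁ box01 η[R] Hd).lin =
      LinearMap.toSpanSingleton k R.carrier 1 ∘ₗ (toDual H Hd).flip (e j) ∘ₗ
        (TensorProduct.lid k _).toLinearMap ∘ₗ (e.coord i).rTensor Hd.carrier := by
    refine TensorProduct.ext' fun x f => ?_
    refine (congrFun (congrFun (matrixEquiv_tmul H Hd R e x 1 f) i) j).trans ?_
    simp [toDual_apply]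
  refine (LinearMap.congr_fun h (coev H Hd)).trans ?_
  have h' := LinearMap.congr_fun (coev_toDual (H := H) (Hd := Hd) (e.coord i)) (e j)
  refine (congrArg (· • (1 : R.carrier)) h').trans ?_
  rw [Matrix.one_apply, e.coord_apply, e.repr_self, Finsupp.single_apply]
  by_cases hij : i = j
  · simp [hij]
  · simp [hij, Ne.symm hij]

end BraidedKind

end Matrices

end BraidedDuality

namespace BraidedDuality

universe u v w

/-! ### The duality theorem for structures that can be transported -/

section DualityTheorem

open CategoryTheory MonoidalCategory
open scoped MonObj ComonObj HopfObj TensorProduct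

namespace BraidedKind

variable {k : Type u} [Field k]

/-- The structures of the kind `D` can be transported along linear isomorphisms. -/
def Transports (D : BraidedKind.{u, w} k) : Prop :=
  ∀ {V W : Type u} [AddCommGroup V] [Module k V] [AddCommGroup W] [Module k W] (a : D.Str V)
    (e : V ≃ₗ[k] W), ∃ b : D.Str W, D.IsHom a b e.toLinearMap

variable {D : BraidedKind.{u, w} k}

/-- The linear isomorphism underlying an isomorphism. -/
def linEquiv {X Y : D.Obj} (f : X ≅ Y) : X.carrier ≃ₗ[k] Y.carrier :=
  LinearEquiv.ofLinearMap f.hom.lin f.inv.lin (congrArg Hom.lin f.inv_hom_id)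
    (congrArg Hom.lin f.hom_inv_id)

/-- All the content is in the two algebra isomorphisms out of the iterated smash product and out of
`H ⊗ R ⊗ Hd`. The matrix algebra receives structure, product and unit by transport from `R ⊗ (H ⊗
Hd)`; it remains to see that the transported product and unit are the usual ones. -/
theorem Transports.dualityTheorem (hD : Transports D) : DualityTheorem D := by
  intro H Hd R _ _ _ act _ hβ hact e
  let _ := ringOf R
  have : SelfSymmetric H := ⟨by nth_rewrite 2 [hβ]; exact (β_ H H).hom_inv_id⟩
  let _ : ModuleAlgebra H R := ⟨act, hact⟩
  have := isIso_antipode H Hd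
  have := isIso_actDual H Hd
  let L := matrixEquiv H Hd R e
  -- The transport is along the inverse braiding followed by matrix coordinates, and not along
  -- coordinates of `R ⊗ (H ⊗ Hd)` itself, since it is on `H ⊗ R ⊗ Hd` that the product is the
  -- matrix product.
  obtain ⟨s, hs⟩ := hD (R ⊗ (H ⊗ Hd)).str ((linEquiv (sandwichIso H Hd R)).symm ≪≫ₗ L)
  let M : D.Obj := ⟨_, s⟩
  let Θ : R ⊗ (H ⊗ Hd) ≅ M := mkIso _ hs
  let mM : M ⊗ M ⟶ M := (Θ.inv ⊗ₘ Θ.inv) ≫ tensorMul μ[R] (pairMul H Hd) ≫ Θ.hom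
  let uM : 𝟙_ D.Obj ⟶ M := tensorOne η[R] (pairOne H Hd) ≫ Θ.hom
  have hΘ : IsAlgebraIso _ _ mM uM Θ := isAlgebraIso_transport (tensorMul μ[R] (pairMul H Hd))
    (tensorOne η[R] (pairOne H Hd)) Θ
  -- By the choice of `Θ`, the composite from `H ⊗ R ⊗ Hd` is just the coordinate map, so statements
  -- about `mM`, `uM` and `Θ` can be checked there.
  have hL (x : (H ⊗ (R ⊗ Hd)).carrier) : (sandwichIso H Hd R ≪≫ Θ).hom.lin x = L x :=
    congrArg L ((linEquiv (sandwichIso H Hd R)).symm_apply_apply x)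
  have hS := (sandwichIso_isAlgebraIso H Hd R).trans hΘ
  refine ⟨s, mM, uM, Θ, smashIso H Hd R ≪≫ Θ, fun x y => ?_, ?_, hΘ, fun v f => ?_,
    (smashIso_isAlgebraIso H Hd R).trans hΘ⟩
  · obtain ⟨x, rfl⟩ := L.surjective x
    obtain ⟨y, rfl⟩ := L.surjective y
    refine Eq.trans ?_ (matrixEquiv_sandwichMul e x y)
    have h := LinearMap.congr_fun (congrArg Hom.lin hS.mul) (x ⊗ₜ[k] y)
    refine Eq.trans ?_ (h.symm.trans (hL _))
    exact (congrArg₂ (fun a b : M.carrier => mM.lin (a ⊗ₜ[k] b)) (hL x) (hL y)).symm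
  · have h := LinearMap.congr_fun (congrArg Hom.lin hS.one) (1 : k)
    have h' : uM.lin (1 : k) = L ((sandwichOne H Hd R).lin (1 : k)) :=
      h.symm.trans (hL ((sandwichOne H Hd R).lin (1 : k)))
    exact h'.trans (matrixEquiv_sandwichOne e)
  · have h := LinearMap.congr_fun (congrArg Hom.lin (one_sandwichIso H Hd R)) (v ⊗ₜ[k] f)
    have h' : Θ.hom.lin ((1 : R.carrier) ⊗ₜ[k] (v ⊗ₜ[k] f)) =
        L ((H ◁ box01 η[R] Hd).lin (v ⊗ₜ[k] f)) :=
      (congrArg Θ.hom.lin h.symm).trans (hL ((H ◁ box01 η[R] Hd).lin (v ⊗ₜ[k] f)))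
    exact h'.trans (matrixEquiv_tmul H Hd R e v 1 f)

end BraidedKind

end DualityTheorem

end BraidedDuality

namespace BraidedDuality

universe u v w

/-! ### Transport of the four kinds of structure along linear isomorphisms -/

section Transport

open scoped TensorProduct
open TensorProduct LinearMap

variable {k : Type u} [Field k] {B : Type v} [Ring B] [HopfAlgebra k B]
variable {V W : Type u} [AddCommGroup V] [Module k V] [AddCommGroup W] [Module k W]

/-- The coaction on `W` is `ρ` conjugated by `e`. The coproduct and counit act on the factor `B`
only and commute with `e`, so the comodule axioms for `ρ` pass to `σ`. -/
theorem IsLeftCoaction.transport {ρ : V →ₗ[k] B ⊗[k] V} (hρ : IsLeftCoaction ρ) (e : V ≃ₗ[k] W)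
    {σ : W →ₗ[k] B ⊗[k] W} (he : ∀ v, e.toLinearMap.lTensor B (ρ v) = σ (e v)) :
    IsLeftCoaction σ where
  coassoc w := by
    obtain ⟨v, rfl⟩ := e.surjective w
    have h1 (x : B ⊗[k] V) : TensorProduct.assoc k B B W
        ((Coalgebra.comul (R := k)).rTensor W (e.toLinearMap.lTensor B x)) =
        (e.toLinearMap.lTensor B).lTensor B
          (TensorProduct.assoc k B B V ((Coalgebra.comul (R := k)).rTensor V x)) := by
      induction x with
      | zero => simp
      | add x y hx hy => simp only [map_add, hx, hy]
      | tmul b v =>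
        simp only [lTensor_tmul, rTensor_tmul]
        induction (Coalgebra.comul (R := k) b) with
        | zero => simp
        | add x y hx hy => simp only [map_add, add_tmul, hx, hy]
        | tmul p q => simp
    have h2 (x : B ⊗[k] V) : (e.toLinearMap.lTensor B).lTensor B (ρ.lTensor B x) =
        σ.lTensor B (e.toLinearMap.lTensor B x) := by
      rw [← LinearMap.comp_apply, ← LinearMap.comp_apply, ← lTensor_comp, ← lTensor_comp]
      congr 2
      exact LinearMap.ext he
    rw [← he, h1, hρ.coassoc, h2]
  counit w := by
    obtain ⟨v, rfl⟩ := e.surjective w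
    rw [← he, ← LinearMap.comp_apply, rTensor_comp_lTensor, ← lTensor_comp_rTensor,
      LinearMap.comp_apply, hρ.counit, lTensor_tmul]
    rfl

theorem IsRightCoaction.transport {ρ : V →ₗ[k] V ⊗[k] B} (hρ : IsRightCoaction ρ) (e : V ≃ₗ[k] W)
    {σ : W →ₗ[k] W ⊗[k] B} (he : ∀ v, e.toLinearMap.rTensor B (ρ v) = σ (e v)) :
    IsRightCoaction σ where
  coassoc w := by
    obtain ⟨v, rfl⟩ := e.surjective w
    have h1 (x : V ⊗[k] B) : TensorProduct.assoc k W B B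
        (σ.rTensor B (e.toLinearMap.rTensor B x)) = e.toLinearMap.rTensor (B ⊗[k] B)
          (TensorProduct.assoc k V B B (ρ.rTensor B x)) := by
      induction x with
      | zero => simp
      | add x y hx hy => simp only [map_add, hx, hy]
      | tmul v b =>
        simp only [rTensor_tmul, LinearEquiv.coe_coe, ← he]
        induction ρ v with
        | zero => simp
        | add x y hx hy => simp only [map_add, add_tmul, hx, hy]
        | tmul p q => simp
    rw [← he, h1, hρ.coassoc]
    exact LinearMap.congr_fun ((rTensor_comp_lTensor _ e.toLinearMap _).trans
      (lTensor_comp_rTensor _ e.toLinearMap _).symm) (ρ v)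
  counit w := by
    obtain ⟨v, rfl⟩ := e.surjective w
    rw [← he, ← LinearMap.comp_apply, lTensor_comp_rTensor, ← rTensor_comp_lTensor,
      LinearMap.comp_apply, hρ.counit, rTensor_tmul]
    rfl

/-- Both sides of the Yetter-Drinfeld condition are natural in `V`, so `e` carries the condition
over. -/
theorem IsYDLeftLeft.transport {a : B →ₐ[k] Module.End k V} {ρ : V →ₗ[k] B ⊗[k] V}
    (h : IsYDLeftLeft a ρ) (e : V ≃ₗ[k] W) {b : B →ₐ[k] Module.End k W} {σ : W →ₗ[k] B ⊗[k] W}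
    (ha : ∀ x v, e (a x v) = b x (e v)) (he : ∀ v, e.toLinearMap.lTensor B (ρ v) = σ (e v)) :
    IsYDLeftLeft b σ := by
  intro x w
  obtain ⟨v, rfl⟩ := e.surjective w
  have h1 (z : B ⊗[k] B) (y : B ⊗[k] V) :
      map₂ (LinearMap.mul k B) b.toLinearMap z (e.toLinearMap.lTensor B y) =
        e.toLinearMap.lTensor B (map₂ (LinearMap.mul k B) a.toLinearMap z y) := by
    induction z with
    | zero => simp
    | add z z' hz hz' => simp only [map_add, LinearMap.add_apply, hz, hz']
    | tmul p q =>
      induction y with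
      | zero => simp
      | add y y' hy hy' => simp only [map_add, hy, hy']
      | tmul c v => simp [ha]
  have h2 (z : B ⊗[k] B) : e.toLinearMap.lTensor B (ydLeft a ρ v z) = ydLeft b σ (e v) z := by
    induction z with
    | zero => simp
    | add z z' hz hz' => simp only [map_add, hz, hz']
    | tmul p q =>
      simp only [ydLeft, LinearMap.comp_apply, rTensor_tmul, LinearMap.flip_apply,
        AlgHom.toLinearMap_apply, ← ha, ← he, LinearEquiv.coe_coe]
      induction ρ (a p v) with
      | zero => simp
      | add z z' hz hz' => simp only [map_add, add_tmul, hz, hz']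
      | tmul c v => simp
  rw [← he, h1, h x v, h2]

theorem IsYDLeftRight.transport {a : B →ₐ[k] Module.End k V} {ρ : V →ₗ[k] V ⊗[k] B}
    (h : IsYDLeftRight a ρ) (e : V ≃ₗ[k] W) {b : B →ₐ[k] Module.End k W} {σ : W →ₗ[k] W ⊗[k] B}
    (ha : ∀ x v, e (a x v) = b x (e v)) (he : ∀ v, e.toLinearMap.rTensor B (ρ v) = σ (e v)) :
    IsYDLeftRight b σ := by
  intro x w
  obtain ⟨v, rfl⟩ := e.surjective w
  have h1 (z : B ⊗[k] B) (y : V ⊗[k] B) :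
      map₂ b.toLinearMap (LinearMap.mul k B) z (e.toLinearMap.rTensor B y) =
        e.toLinearMap.rTensor B (map₂ a.toLinearMap (LinearMap.mul k B) z y) := by
    induction z with
    | zero => simp
    | add z z' hz hz' => simp only [map_add, LinearMap.add_apply, hz, hz']
    | tmul p q =>
      induction y with
      | zero => simp
      | add y y' hy hy' => simp only [map_add, hy, hy']
      | tmul c v => simp [ha]
  have h2 (z : B ⊗[k] B) : e.toLinearMap.rTensor B (ydRight a ρ v z) = ydRight b σ (e v) z := by
    induction z with
    | zero => simp
    | add z z' hz hz' => simp only [map_add, hz, hz']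
    | tmul p q =>
      simp only [ydRight, LinearMap.comp_apply, rTensor_tmul, LinearMap.flip_apply, comm_tmul,
        AlgHom.toLinearMap_apply, ← ha, ← he, LinearEquiv.coe_coe]
      induction ρ (a q v) with
      | zero => simp
      | add z z' hz hz' => simp only [map_add, add_tmul, hz, hz']
      | tmul c v => simp
  rw [← he, h1, h x v, h2]

/-- The action transported along a linear isomorphism. -/
noncomputable def conjAct (a : B →ₐ[k] Module.End k V) (e : V ≃ₗ[k] W) :
    B →ₐ[k] Module.End k W :=
  (e.conjAlgEquiv k).toAlgHom.comp a

theorem conjAct_apply (a : B →ₐ[k] Module.End k V) (e : V ≃ₗ[k] W) (h : B) (v : V) :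
    e (a h v) = conjAct a e h (e v) := by
  simp [conjAct]

theorem conj_lTensor (ρ : V →ₗ[k] B ⊗[k] V) (e : V ≃ₗ[k] W) (v : V) :
    e.toLinearMap.lTensor B (ρ v) = (e.toLinearMap.lTensor B ∘ₗ ρ ∘ₗ e.symm.toLinearMap) (e v) := by
  simp

theorem conj_rTensor (ρ : V →ₗ[k] V ⊗[k] B) (e : V ≃ₗ[k] W) (v : V) :
    e.toLinearMap.rTensor B (ρ v) = (e.toLinearMap.rTensor B ∘ₗ ρ ∘ₗ e.symm.toLinearMap) (e v) := by
  simp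

namespace BraidedKind

theorem transports_moduleKind (Q : QuasiTriangular k B) : Transports (moduleKind Q) :=
  fun a e => ⟨conjAct a e, conjAct_apply a e⟩

theorem transports_comoduleKind (r : CoquasiTriangular k B) : Transports (comoduleKind r) :=
  fun a e => ⟨⟨_, a.2.transport e (conj_lTensor a.1 e)⟩, conj_lTensor a.1 e⟩

theorem transports_yetterDrinfeldLeftLeftKind
    (hS : Function.Bijective (HopfAlgebra.antipode k (A := B))) :
    Transports (yetterDrinfeldLeftLeftKind hS) :=
  fun a e => ⟨⟨(_, _), a.2.1.transport e (conj_lTensor a.1.2 e),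
    a.2.2.transport e (conjAct_apply a.1.1 e) (conj_lTensor a.1.2 e)⟩,
    conjAct_apply a.1.1 e, conj_lTensor a.1.2 e⟩

theorem transports_yetterDrinfeldLeftRightKind :
    Transports (yetterDrinfeldLeftRightKind.{u, v} k B) :=
  fun a e => ⟨⟨(_, _), a.2.1.transport e (conj_rTensor a.1.2 e),
    a.2.2.transport e (conjAct_apply a.1.1 e) (conj_rTensor a.1.2 e)⟩,
    conjAct_apply a.1.1 e, conj_rTensor a.1.2 e⟩

end BraidedKind

end Transport

end BraidedDuality

namespace BraidedDuality

universe u v w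

/-! ### The antipode of `B` and the coproduct -/

section Antipode

open scoped TensorProduct
open TensorProduct LinearMap WithConv

variable {k : Type u} [Field k] {B : Type v} [Ring B] [HopfAlgebra k B]

local notation "𝑺" => HopfAlgebra.antipode k (A := B)
local notation "δ" => Coalgebra.comul (R := k) (A := B)

/-- `S(h₁) h₂ ⊗ h₃ = 1 ⊗ h`, by coassociativity and the antipode axiom. -/
theorem mul_rTensor_antipode_comul (h : B) :
    (mul' k B).rTensor B ((TensorProduct.assoc k B B B).symm (map 𝑺 δ (δ h))) =
      (1 : B) ⊗ₜ[k] h := by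
  have h1 (z : B ⊗[k] B) : (TensorProduct.assoc k B B B).symm (map 𝑺 δ z) =
      rTensor B (rTensor B 𝑺) ((TensorProduct.assoc k B B B).symm (lTensor B δ z)) := by
    induction z with
    | zero => simp
    | add x y hx hy => simp only [map_add, hx, hy]
    | tmul p q =>
      simp only [map_tmul, lTensor_tmul]
      induction δ q with
      | zero => simp
      | add x y hx hy => simp only [map_add, tmul_add, hx, hy]
      | tmul p q => simp
  have h2 : (mul' k B).rTensor B ∘ₗ rTensor B (rTensor B 𝑺) ∘ₗ rTensor B δ =
      (Algebra.linearMap k B).rTensor B ∘ₗ (Coalgebra.counit (R := k)).rTensor B := by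
    simp only [← rTensor_comp, HopfAlgebra.mul_antipode_rTensor_comul]
  rw [h1, ← Coalgebra.coassoc_apply, LinearEquiv.symm_apply_apply]
  refine (LinearMap.congr_fun h2 _).trans ?_
  rw [LinearMap.comp_apply, Coalgebra.rTensor_counit_comul]
  simp

/-- The product `S(h₂) h₃ ⊗ S(h₁) h₄` collapses from the inside: first `S(h₂) h₃`, then `S(h₁) h₂`.
This makes `(S ⊗ S) Δᶜᵒᵖ` a left convolution inverse of `Δ`. -/
theorem mul_map_antipode_comul (h : B) :
    mul' k (B ⊗[k] B) (map (map 𝑺 𝑺 ∘ₗ (TensorProduct.comm k B B).toLinearMap ∘ₗ δ) δ (δ h)) =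
      algebraMap k (B ⊗[k] B) (Coalgebra.counit (R := k) h) := by
  have h1 (p q : B) : mul' k (B ⊗[k] B)
      (map (map 𝑺 𝑺 ∘ₗ (TensorProduct.comm k B B).toLinearMap ∘ₗ δ) δ (p ⊗ₜ q)) =
      mul' k (B ⊗[k] B) (map (TensorProduct.mk k B B 1 ∘ₗ 𝑺)
        ((mul' k B).rTensor B ∘ₗ (TensorProduct.assoc k B B B).symm.toLinearMap ∘ₗ map 𝑺 δ)
        (TensorProduct.assoc k B B B (δ p ⊗ₜ q))) := by
    simp only [map_tmul, LinearMap.comp_apply, LinearEquiv.coe_coe]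
    induction δ p with
    | zero => simp
    | add x y hx hy => simp only [map_add, add_tmul, hx, hy]
    | tmul a b =>
      simp only [comm_tmul, map_tmul, assoc_tmul, LinearMap.comp_apply, LinearEquiv.coe_coe,
        mul'_apply, mk_apply]
      induction δ q with
      | zero => simp
      | add x y hx hy => simp only [map_add, tmul_add, mul_add, hx, hy]
      | tmul c d => simp
  have h2 (z : B ⊗[k] B) : mul' k (B ⊗[k] B)
      (map (map 𝑺 𝑺 ∘ₗ (TensorProduct.comm k B B).toLinearMap ∘ₗ δ) δ z) =
      mul' k (B ⊗[k] B) (map (TensorProduct.mk k B B 1 ∘ₗ 𝑺)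
        ((mul' k B).rTensor B ∘ₗ (TensorProduct.assoc k B B B).symm.toLinearMap ∘ₗ map 𝑺 δ)
        (TensorProduct.assoc k B B B (rTensor B δ z))) := by
    induction z with
    | zero => simp
    | add x y hx hy => simp only [map_add, hx, hy]
    | tmul p q => exact h1 p q
  have h3 (z : B ⊗[k] B) : map (TensorProduct.mk k B B 1 ∘ₗ 𝑺)
      ((mul' k B).rTensor B ∘ₗ (TensorProduct.assoc k B B B).symm.toLinearMap ∘ₗ map 𝑺 δ)
      (lTensor B δ z) = map (TensorProduct.mk k B B 1 ∘ₗ 𝑺) (TensorProduct.mk k B B 1) z := by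
    induction z with
    | zero => simp
    | add x y hx hy => simp only [map_add, hx, hy]
    | tmul p q =>
      exact congrArg (((1 : B) ⊗ₜ[k] 𝑺 p) ⊗ₜ[k] ·) (mul_rTensor_antipode_comul q)
  have h4 (z : B ⊗[k] B) : mul' k (B ⊗[k] B)
      (map (TensorProduct.mk k B B 1 ∘ₗ 𝑺) (TensorProduct.mk k B B 1) z) =
      TensorProduct.mk k B B 1 (mul' k B (rTensor B 𝑺 z)) := by
    induction z with
    | zero => simp
    | add x y hx hy => simp only [map_add, hx, hy]
    | tmul p q => simp
  rw [h2, Coalgebra.coassoc_apply, h3, h4, HopfAlgebra.mul_antipode_rTensor_comul_apply]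
  rw [Algebra.algebraMap_eq_smul_one, Algebra.algebraMap_eq_smul_one, map_smul]
  rfl

/-- The antipode is an antihomomorphism of coalgebras. -/
theorem comul_antipode (h : B) :
    δ (𝑺 h) = map 𝑺 𝑺 (TensorProduct.comm k B B (δ h)) := by
  have h1 : toConv (map 𝑺 𝑺 ∘ₗ (TensorProduct.comm k B B).toLinearMap ∘ₗ δ) * toConv δ = 1 := by
    apply WithConv.ext
    ext h
    exact mul_map_antipode_comul h
  -- `Δ ∘ S` is a right convolution inverse of `Δ`, and a left and a right inverse agree.
  have h2 := left_inv_eq_right_inv h1 (LinearMap.comul_right_inv (R := k) (C := B))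
  exact (LinearMap.congr_fun (congrArg WithConv.ofConv h2) h).symm

theorem antipodeInv_mul_antidistrib (hS : Function.Bijective 𝑺) (x y : B) :
    antipodeInv hS (x * y) = antipodeInv hS y * antipodeInv hS x := by
  apply hS.injective
  simp only [HopfAlgebra.antipode_mul_antidistrib, antipode_antipodeInv]

theorem antipodeInv_one (hS : Function.Bijective 𝑺) : antipodeInv hS 1 = 1 := by
  apply hS.injective
  simp only [HopfAlgebra.antipode_one, antipode_antipodeInv]

end Antipode

end BraidedDuality

namespace BraidedDuality

universe u v w

/-! ### Coactions and Yetter-Drinfeld conditions in terms of matrices over `B` -/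

section Coordinates

set_option linter.unusedSectionVars false

open scoped TensorProduct
open TensorProduct LinearMap Module

variable {k : Type u} [Field k] {B : Type v} [Ring B] [HopfAlgebra k B]
variable {V : Type u} [AddCommGroup V] [Module k V]
variable {ι : Type*} [Fintype ι] [DecidableEq ι] (e : Basis ι k V)

theorem sum_tmul_basis_inj {M : Type*} [AddCommGroup M] [Module k M] {x y : ι → M} :
    ∑ i, x i ⊗ₜ[k] e i = ∑ i, y i ⊗ₜ[k] e i ↔ x = y := by
  refine ⟨fun h => funext fun i => ?_, fun h => by rw [h]⟩
  have := congrArg ((TensorProduct.rid k M).toLinearMap ∘ₗ (e.coord i).lTensor M) h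
  simpa [Finsupp.single_apply, ite_smul] using this

theorem sum_basis_tmul_inj {M : Type*} [AddCommGroup M] [Module k M] {x y : ι → M} :
    ∑ i, e i ⊗ₜ[k] x i = ∑ i, e i ⊗ₜ[k] y i ↔ x = y := by
  refine ⟨fun h => (sum_tmul_basis_inj e).1 ?_, fun h => by rw [h]⟩
  simpa using congrArg (TensorProduct.comm k V M) h

theorem exists_sum_tmul_basis {M : Type*} [AddCommGroup M] [Module k M] (z : M ⊗[k] V) :
    ∃ x : ι → M, z = ∑ i, x i ⊗ₜ[k] e i := by
  induction z with
  | zero => exact ⟨0, by simp⟩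
  | add z z' hz hz' =>
    obtain ⟨x, rfl⟩ := hz
    obtain ⟨y, rfl⟩ := hz'
    exact ⟨x + y, by simp [add_tmul, Finset.sum_add_distrib]⟩
  | tmul m v =>
    refine ⟨fun i => e.repr v i • m, ?_⟩
    conv_lhs => rw [← e.sum_repr v, tmul_sum]
    simp [smul_tmul']

/-- The linear map `e j ↦ ∑ i, t i j ⊗ e i`. -/
noncomputable def leftMap (t : Matrix ι ι B) : V →ₗ[k] B ⊗[k] V :=
  e.constr k fun j => ∑ i, t i j ⊗ₜ[k] e i

theorem leftMap_basis (t : Matrix ι ι B) (j : ι) : leftMap e t (e j) = ∑ i, t i j ⊗ₜ[k] e i :=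
  e.constr_basis k _ j

theorem exists_leftMap (ρ : V →ₗ[k] B ⊗[k] V) : ∃ t : Matrix ι ι B, ρ = leftMap e t := by
  choose t ht using fun j => exists_sum_tmul_basis e (ρ (e j))
  exact ⟨Matrix.of fun i j => t j i, e.ext fun j => by simp [leftMap_basis, ht]⟩

/-- The linear map `e j ↦ ∑ i, e i ⊗ t i j`. -/
noncomputable def rightMap (t : Matrix ι ι B) : V →ₗ[k] V ⊗[k] B :=
  e.constr k fun j => ∑ i, e i ⊗ₜ[k] t i j

theorem rightMap_basis (t : Matrix ι ι B) (j : ι) : rightMap e t (e j) = ∑ i, e i ⊗ₜ[k] t i j :=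
  e.constr_basis k _ j

theorem exists_rightMap (ρ : V →ₗ[k] V ⊗[k] B) : ∃ t : Matrix ι ι B, ρ = rightMap e t := by
  choose t ht using fun j => exists_sum_tmul_basis e (TensorProduct.comm k V B (ρ (e j)))
  refine ⟨Matrix.of fun i j => t j i, e.ext fun j => ?_⟩
  rw [rightMap_basis, ← (TensorProduct.comm k V B).symm_apply_apply (ρ (e j)), ht]
  simp

/-- Comparing the coefficients of `e i` on both sides of the comodule axioms. The legs of the
coproduct of `t i j` appear in the order opposite to matrix multiplication, since the coaction is on
the left while `t` acts on columns; for right coactions the order is the usual one. -/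
theorem isLeftCoaction_leftMap {t : Matrix ι ι B} : IsLeftCoaction (leftMap e t) ↔
    (∀ i j, Coalgebra.comul (R := k) (t i j) = ∑ l, t l j ⊗ₜ[k] t i l) ∧
      ∀ i j, Coalgebra.counit (R := k) (t i j) = (1 : Matrix ι ι k) i j := by
  have h1 (j : ι) : TensorProduct.assoc k B B V (Coalgebra.comul.rTensor V (leftMap e t (e j))) =
      (leftMap e t).lTensor B (leftMap e t (e j)) ↔
      ∀ i, Coalgebra.comul (R := k) (t i j) = ∑ l, t l j ⊗ₜ[k] t i l := by
    rw [← (TensorProduct.assoc k B B V).eq_symm_apply, ← funext_iff, ← sum_tmul_basis_inj e]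
    simp only [leftMap_basis, map_sum, rTensor_tmul, lTensor_tmul, tmul_sum, assoc_symm_tmul,
      sum_tmul]
    rw [Finset.sum_comm (f := fun l i => (t l j ⊗ₜ[k] t i l) ⊗ₜ[k] e i)]
  have h2 (j : ι) : Coalgebra.counit.rTensor V (leftMap e t (e j)) = (1 : k) ⊗ₜ[k] e j ↔
      ∀ i, Coalgebra.counit (R := k) (t i j) = (1 : Matrix ι ι k) i j := by
    have : (1 : k) ⊗ₜ[k] e j = ∑ i, (1 : Matrix ι ι k) i j ⊗ₜ[k] e i := by
      simp [Matrix.one_apply, ite_tmul]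
    rw [this, ← funext_iff, ← sum_tmul_basis_inj e]
    simp only [leftMap_basis, map_sum, rTensor_tmul]
  constructor
  · intro h
    exact ⟨fun i j => (h1 j).1 (h.coassoc (e j)) i, fun i j => (h2 j).1 (h.counit (e j)) i⟩
  · intro h
    refine ⟨LinearMap.congr_fun (f := (TensorProduct.assoc k B B V).toLinearMap ∘ₗ
      Coalgebra.comul.rTensor V ∘ₗ leftMap e t) (g := (leftMap e t).lTensor B ∘ₗ leftMap e t)
      (e.ext fun j => (h1 j).2 fun i => h.1 i j), LinearMap.congr_fun
      (f := Coalgebra.counit.rTensor V ∘ₗ leftMap e t) (g := TensorProduct.mk k k V 1)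
      (e.ext fun j => (h2 j).2 fun i => h.2 i j)⟩

theorem isRightCoaction_rightMap {t : Matrix ι ι B} : IsRightCoaction (rightMap e t) ↔
    (∀ i j, Coalgebra.comul (R := k) (t i j) = ∑ l, t i l ⊗ₜ[k] t l j) ∧
      ∀ i j, Coalgebra.counit (R := k) (t i j) = (1 : Matrix ι ι k) i j := by
  have h1 (j : ι) : TensorProduct.assoc k V B B ((rightMap e t).rTensor B (rightMap e t (e j))) =
      Coalgebra.comul.lTensor V (rightMap e t (e j)) ↔
      ∀ i, Coalgebra.comul (R := k) (t i j) = ∑ l, t i l ⊗ₜ[k] t l j := by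
    rw [eq_comm, ← funext_iff, ← sum_basis_tmul_inj e]
    simp only [rightMap_basis, map_sum, rTensor_tmul, lTensor_tmul, tmul_sum, assoc_tmul,
      sum_tmul]
    rw [Finset.sum_comm (f := fun l i => e i ⊗ₜ[k] (t i l ⊗ₜ[k] t l j))]
  have h2 (j : ι) : Coalgebra.counit.lTensor V (rightMap e t (e j)) = e j ⊗ₜ[k] (1 : k) ↔
      ∀ i, Coalgebra.counit (R := k) (t i j) = (1 : Matrix ι ι k) i j := by
    have : e j ⊗ₜ[k] (1 : k) = ∑ i, e i ⊗ₜ[k] (1 : Matrix ι ι k) i j := by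
      simp [Matrix.one_apply, tmul_ite]
    rw [this, ← funext_iff, ← sum_basis_tmul_inj e]
    simp only [rightMap_basis, map_sum, lTensor_tmul]
  constructor
  · intro h
    exact ⟨fun i j => (h1 j).1 (h.coassoc (e j)) i, fun i j => (h2 j).1 (h.counit (e j)) i⟩
  · intro h
    refine ⟨LinearMap.congr_fun (f := (TensorProduct.assoc k V B B).toLinearMap ∘ₗ
      (rightMap e t).rTensor B ∘ₗ rightMap e t) (g := Coalgebra.comul.lTensor V ∘ₗ rightMap e t)
      (e.ext fun j => (h1 j).2 fun i => h.1 i j), LinearMap.congr_fun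
      (f := Coalgebra.counit.lTensor V ∘ₗ rightMap e t) (g := (TensorProduct.mk k V k).flip 1)
      (e.ext fun j => (h2 j).2 fun i => h.2 i j)⟩

/-- The matrix coefficients of an action. -/
noncomputable def coeff (a : B →ₐ[k] Module.End k V) (i j : ι) : B →ₗ[k] k :=
  e.coord i ∘ₗ a.toLinearMap.flip (e j)

theorem sum_coeff (a : B →ₐ[k] Module.End k V) (h : B) (j : ι) :
    ∑ i, coeff e a i j h • e i = a h (e j) :=
  e.sum_repr _

/-- The matrix `h₁ a(h₂)`. -/
noncomputable def coeffRight (a : B →ₐ[k] Module.End k V) (z : B ⊗[k] B) : Matrix ι ι B :=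
  Matrix.of fun i j => TensorProduct.rid k B ((coeff e a i j).lTensor B z)

/-- The matrix `a(h₁) h₂`. -/
noncomputable def coeffLeft (a : B →ₐ[k] Module.End k V) (z : B ⊗[k] B) : Matrix ι ι B :=
  Matrix.of fun i j => TensorProduct.lid k B ((coeff e a i j).rTensor B z)

/-- The map `ydLeft` as a function of the vector. -/
noncomputable def ydLeftMap (a : B →ₐ[k] Module.End k V) (ρ : V →ₗ[k] B ⊗[k] V) (z : B ⊗[k] B) :
    V →ₗ[k] B ⊗[k] V where
  toFun v := ydLeft a ρ v z
  map_add' v w := by simp [ydLeft, rTensor_add, comp_add]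
  map_smul' c v := by simp [ydLeft, rTensor_smul, comp_smul]

/-- The map `ydRight` as a function of the vector. -/
noncomputable def ydRightMap (a : B →ₐ[k] Module.End k V) (ρ : V →ₗ[k] V ⊗[k] B)
    (z : B ⊗[k] B) : V →ₗ[k] V ⊗[k] B where
  toFun v := ydRight a ρ v z
  map_add' v w := by simp [ydRight, rTensor_add, comp_add]
  map_smul' c v := by simp [ydRight, rTensor_smul, comp_smul]

/-- In coordinates the condition compares `h₁ a(h₂) t` with `t a(h₁) h₂` as matrices over `B`. This
form is suited to dualising, where transposition and antipode reverse products. -/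
theorem isYDLeftLeft_leftMap {a : B →ₐ[k] Module.End k V} {t : Matrix ι ι B} :
    IsYDLeftLeft a (leftMap e t) ↔ ∀ h, coeffRight e a (Coalgebra.comul (R := k) h) * t =
      t * coeffLeft e a (Coalgebra.comul (R := k) h) := by
  have h1 (z : B ⊗[k] B) (j : ι) : map₂ (LinearMap.mul k B) a.toLinearMap z (leftMap e t (e j)) =
      ∑ i, (coeffRight e a z * t) i j ⊗ₜ[k] e i := by
    simp only [Matrix.mul_apply]
    induction z with
    | zero => simp [coeffRight]
    | add z z' hz hz' =>
      simp only [map_add, LinearMap.add_apply, hz, hz', coeffRight, Matrix.of_apply, add_mul,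
        Finset.sum_add_distrib, add_tmul]
    | tmul p q =>
      have hq (l : ι) : (p * t l j) ⊗ₜ[k] a q (e l) =
          ∑ i, (coeff e a i l q • p * t l j) ⊗ₜ[k] e i := by
        rw [← sum_coeff e, tmul_sum]
        simp [smul_tmul']
      simp only [leftMap_basis, map_sum, map₂_apply_tmul, coeffRight, lTensor_tmul, rid_tmul,
        Matrix.of_apply, sum_tmul]
      rw [Finset.sum_comm]
      exact Finset.sum_congr rfl fun l _ => hq l
  have h2 (z : B ⊗[k] B) (j : ι) : ydLeft a (leftMap e t) (e j) z =
      ∑ i, (t * coeffLeft e a z) i j ⊗ₜ[k] e i := by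
    simp only [Matrix.mul_apply]
    induction z with
    | zero => simp [coeffLeft]
    | add z z' hz hz' =>
      simp only [map_add, hz, hz', coeffLeft, Matrix.of_apply, mul_add,
        Finset.sum_add_distrib, add_tmul]
    | tmul p q =>
      simp only [ydLeft, LinearMap.comp_apply, rTensor_tmul, LinearMap.flip_apply,
        AlgHom.toLinearMap_apply, ← sum_coeff e a p, map_sum, map_smul, leftMap_basis,
        sum_tmul, coeffLeft, lid_tmul, Matrix.of_apply, Finset.smul_sum, LinearEquiv.coe_coe]
      rw [Finset.sum_comm]
      simp [smul_tmul']
  have h3 (h : B) (j : ι) : map₂ (LinearMap.mul k B) a.toLinearMap (Coalgebra.comul (R := k) h)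
      (leftMap e t (e j)) = ydLeft a (leftMap e t) (e j) (Coalgebra.comul (R := k) h) ↔
      ∀ i, (coeffRight e a (Coalgebra.comul (R := k) h) * t) i j =
        (t * coeffLeft e a (Coalgebra.comul (R := k) h)) i j := by
    rw [h1, h2, sum_tmul_basis_inj, funext_iff]
  constructor
  · intro H h
    ext i j
    exact (h3 h j).1 (H h (e j)) i
  · intro H h
    refine LinearMap.congr_fun (f := map₂ (LinearMap.mul k B) a.toLinearMap
      (Coalgebra.comul (R := k) h) ∘ₗ leftMap e t)
      (g := ydLeftMap a (leftMap e t) (Coalgebra.comul (R := k) h)) (e.ext fun j => ?_)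
    exact (h3 h j).2 fun i => congrFun (congrFun (H h) i) j

theorem isYDLeftRight_rightMap {a : B →ₐ[k] Module.End k V} {t : Matrix ι ι B} :
    IsYDLeftRight a (rightMap e t) ↔ ∀ h, coeffLeft e a (Coalgebra.comul (R := k) h) * t =
      t * coeffRight e a (Coalgebra.comul (R := k) h) := by
  have h1 (z : B ⊗[k] B) (j : ι) : map₂ a.toLinearMap (LinearMap.mul k B) z (rightMap e t (e j)) =
      ∑ i, e i ⊗ₜ[k] (coeffLeft e a z * t) i j := by
    simp only [Matrix.mul_apply]
    induction z with
    | zero => simp [coeffLeft]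
    | add z z' hz hz' =>
      simp only [map_add, LinearMap.add_apply, hz, hz', coeffLeft, Matrix.of_apply, add_mul,
        Finset.sum_add_distrib, tmul_add]
    | tmul p q =>
      have hp (l : ι) : a p (e l) ⊗ₜ[k] (q * t l j) =
          ∑ i, e i ⊗ₜ[k] (coeff e a i l p • q * t l j) := by
        rw [← sum_coeff e, sum_tmul]
        simp [smul_tmul']
      simp only [rightMap_basis, map_sum, map₂_apply_tmul, coeffLeft, rTensor_tmul, lid_tmul,
        Matrix.of_apply, tmul_sum]
      rw [Finset.sum_comm]
      exact Finset.sum_congr rfl fun l _ => hp l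
  have h2 (z : B ⊗[k] B) (j : ι) : ydRight a (rightMap e t) (e j) z =
      ∑ i, e i ⊗ₜ[k] (t * coeffRight e a z) i j := by
    simp only [Matrix.mul_apply]
    induction z with
    | zero => simp [coeffRight]
    | add z z' hz hz' =>
      simp only [map_add, hz, hz', coeffRight, Matrix.of_apply, mul_add, Finset.sum_add_distrib,
        tmul_add]
    | tmul p q =>
      simp only [ydRight, LinearMap.comp_apply, rTensor_tmul, LinearMap.flip_apply, comm_tmul,
        AlgHom.toLinearMap_apply, ← sum_coeff e a q, map_sum, map_smul, rightMap_basis,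
        sum_tmul, tmul_sum, coeffRight, Matrix.of_apply, Finset.smul_sum,
        LinearEquiv.coe_coe]
      rw [Finset.sum_comm]
      simp [smul_tmul']
  have h3 (h : B) (j : ι) : map₂ a.toLinearMap (LinearMap.mul k B) (Coalgebra.comul (R := k) h)
      (rightMap e t (e j)) = ydRight a (rightMap e t) (e j) (Coalgebra.comul (R := k) h) ↔
      ∀ i, (coeffLeft e a (Coalgebra.comul (R := k) h) * t) i j =
        (t * coeffRight e a (Coalgebra.comul (R := k) h)) i j := by
    rw [h1, h2, sum_basis_tmul_inj, funext_iff]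
  constructor
  · intro H h
    ext i j
    exact (h3 h j).1 (H h (e j)) i
  · intro H h
    refine LinearMap.congr_fun (f := map₂ a.toLinearMap (LinearMap.mul k B)
      (Coalgebra.comul (R := k) h) ∘ₗ rightMap e t)
      (g := ydRightMap a (rightMap e t) (Coalgebra.comul (R := k) h)) (e.ext fun j => ?_)
    exact (h3 h j).2 fun i => congrFun (congrFun (H h) i) j

end Coordinates

end BraidedDuality

namespace BraidedDuality

universe u v w

/-! ### Actions and coactions on the dual space -/

section DualStructures

open scoped TensorProduct
open TensorProduct LinearMap Module

variable {k : Type u} [Field k] {B : Type v} [Ring B] [HopfAlgebra k B]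
variable {V : Type u} [AddCommGroup V] [Module k V]
variable {ι : Type*} [Fintype ι] [DecidableEq ι] (e : Basis ι k V)

local notation "𝑺" => HopfAlgebra.antipode k (A := B)

section Action

variable (a : B →ₐ[k] Module.End k V) (s : B →ₗ[k] B) (h1 : s 1 = 1)
  (hs : ∀ x y, s (x * y) = s y * s x)

/-- The action `h f = f ∘ s(h)` on the dual space, for a linear antihomomorphism `s`. -/
noncomputable def dualSpaceAct : B →ₐ[k] Module.End k (Dual k V) :=
  AlgHom.ofLinearMap (Dual.transpose ∘ₗ a.toLinearMap ∘ₗ s)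
    (by ext f v; simp [h1, Dual.transpose_apply])
    (fun x y => by ext f v; simp [hs, Dual.transpose_apply])

theorem dualSpaceAct_apply (h : B) (f : Dual k V) (v : V) :
    dualSpaceAct a s h1 hs h f v = f (a (s h) v) := rfl

/-- The action moves across the pairing, and only `s(z₁) z₂` is left to act on `v`. So on `V* ⊗ V`
invariance calls for `s = S`; on `V ⊗ V*` the product is `s(z₂) z₁` and calls for `S⁻¹`. -/
theorem contractLeft_twoAct (z : B ⊗[k] B) (f : Dual k V) (v : V) :
    contractLeft k V (twoAct (dualSpaceAct a s h1 hs) a z (f ⊗ₜ v)) =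
      f (a (mul' k B (s.rTensor B z)) v) := by
  induction z with
  | zero => simp
  | add z z' hz hz' => simp only [map_add, LinearMap.add_apply, hz, hz']
  | tmul p q => simp [dualSpaceAct_apply]

theorem contractRight_twoAct (z : B ⊗[k] B) (f : Dual k V) (v : V) :
    contractRight k V (twoAct a (dualSpaceAct a s h1 hs) z (v ⊗ₜ f)) =
      f (a (mul' k B (s.rTensor B (TensorProduct.comm k B B z))) v) := by
  induction z with
  | zero => simp
  | add z z' hz hz' => simp only [map_add, LinearMap.add_apply, hz, hz']
  | tmul p q => simp [dualSpaceAct_apply]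

/-- The canonical element `Σ eᵢ ⊗ eⁱ` lets an endomorphism pass from one factor to its transpose on
the other. -/
theorem sum_map_dualMap (g : Module.End k V) (p : Module.End k V) :
    ∑ i, p (e i) ⊗ₜ[k] (e.coord i ∘ₗ g) = ∑ i, p (g (e i)) ⊗ₜ[k] e.coord i := by
  have h (i : ι) : e.coord i ∘ₗ g = ∑ j, e.coord i (g (e j)) • e.coord j :=
    e.ext fun l => by simp [Finsupp.single_apply]
  have h' (j : ι) : p (g (e j)) = ∑ i, e.coord i (g (e j)) • p (e i) := by
    conv_lhs => rw [← e.sum_repr (g (e j))]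
    simp only [map_sum, map_smul, Basis.coord_apply]
  calc _ = ∑ i, ∑ j, e.coord i (g (e j)) • (p (e i) ⊗ₜ[k] e.coord j) :=
        Finset.sum_congr rfl fun i _ => by rw [h]; simp only [tmul_sum, tmul_smul]
    _ = _ := by
        rw [Finset.sum_comm]
        exact Finset.sum_congr rfl fun j _ => by rw [h']; simp only [sum_tmul, smul_tmul']

theorem twoAct_sum_tmul_coord (z : B ⊗[k] B) :
    twoAct a (dualSpaceAct a s h1 hs) z (∑ i, e i ⊗ₜ[k] e.coord i) =
      ∑ i, a (mul' k B (s.lTensor B z)) (e i) ⊗ₜ[k] e.coord i := by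
  induction z with
  | zero => simp
  | add z z' hz hz' =>
    simp only [map_add, LinearMap.add_apply, hz, hz', add_tmul, Finset.sum_add_distrib]
  | tmul p q =>
    rw [lTensor_tmul, mul'_apply, map_mul]
    refine Eq.trans ?_ (sum_map_dualMap e (a (s q)) (a p))
    simp only [twoAct_tmul, map_sum, map_tmul]
    rfl

theorem twoAct_sum_coord_tmul (z : B ⊗[k] B) :
    twoAct (dualSpaceAct a s h1 hs) a z (∑ i, e.coord i ⊗ₜ[k] e i) =
      ∑ i, e.coord i ⊗ₜ[k] a (mul' k B (s.lTensor B (TensorProduct.comm k B B z))) (e i) := by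
  apply (TensorProduct.comm k _ _).injective
  rw [comm_twoAct]
  simpa using twoAct_sum_tmul_coord e a s h1 hs (TensorProduct.comm k B B z)

end Action

section Coaction

variable (t : Matrix ι ι B)

/-- The matrix of the dual coaction. -/
noncomputable def antipodeTranspose : Matrix ι ι B := Matrix.of fun i j => 𝑺 (t j i)

variable {t}

/-- `S` reverses the coproduct and transposition exchanges the indices, so the two effects
compensate and `S(tᵀ)` satisfies the same comatrix identities as `t`. -/
theorem IsLeftCoaction.dual (h : IsLeftCoaction (leftMap e t)) :
    IsLeftCoaction (leftMap e.dualBasis (antipodeTranspose (k := k) t)) := by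
  rw [isLeftCoaction_leftMap] at h ⊢
  refine ⟨fun i j => ?_, fun i j => ?_⟩
  · simp only [antipodeTranspose, Matrix.of_apply, comul_antipode, h.1, map_sum, comm_tmul,
      map_tmul]
  · simp only [antipodeTranspose, Matrix.of_apply, HopfAlgebra.counit_antipode, h.2,
      Matrix.one_apply, eq_comm]

theorem IsRightCoaction.dual (h : IsRightCoaction (rightMap e t)) :
    IsRightCoaction (rightMap e.dualBasis (antipodeTranspose (k := k) t)) := by
  rw [isRightCoaction_rightMap] at h ⊢
  refine ⟨fun i j => ?_, fun i j => ?_⟩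
  · simp only [antipodeTranspose, Matrix.of_apply, comul_antipode, h.1, map_sum, comm_tmul,
      map_tmul]
  · simp only [antipodeTranspose, Matrix.of_apply, HopfAlgebra.counit_antipode, h.2,
      Matrix.one_apply, eq_comm]

/-- The antipode axiom applied to the coproduct of an entry `t i j`. -/
theorem IsLeftCoaction.sum_mul_antipode (h : IsLeftCoaction (leftMap e t)) (i j : ι) :
    ∑ l, t l j * 𝑺 (t i l) = algebraMap k B ((1 : Matrix ι ι k) i j) := by
  rw [isLeftCoaction_leftMap] at h
  simpa [h.1, h.2] using HopfAlgebra.mul_antipode_lTensor_comul_apply (R := k) (t i j)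

theorem IsLeftCoaction.sum_antipode_mul (h : IsLeftCoaction (leftMap e t)) (i j : ι) :
    ∑ l, 𝑺 (t l j) * t i l = algebraMap k B ((1 : Matrix ι ι k) i j) := by
  rw [isLeftCoaction_leftMap] at h
  simpa [h.1, h.2] using HopfAlgebra.mul_antipode_rTensor_comul_apply (R := k) (t i j)

theorem IsRightCoaction.sum_mul_antipode (h : IsRightCoaction (rightMap e t)) (i j : ι) :
    ∑ l, t i l * 𝑺 (t l j) = algebraMap k B ((1 : Matrix ι ι k) i j) := by
  rw [isRightCoaction_rightMap] at h
  simpa [h.1, h.2] using HopfAlgebra.mul_antipode_lTensor_comul_apply (R := k) (t i j)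

theorem IsRightCoaction.sum_antipode_mul (h : IsRightCoaction (rightMap e t)) (i j : ι) :
    ∑ l, 𝑺 (t i l) * t l j = algebraMap k B ((1 : Matrix ι ι k) i j) := by
  rw [isRightCoaction_rightMap] at h
  simpa [h.1, h.2] using HopfAlgebra.mul_antipode_rTensor_comul_apply (R := k) (t i j)

/-- On `V ⊗ V*` the coefficients multiply to `Σ t S(t)` in the order of the antipode axiom. The
order `V* ⊗ V` would need `S⁻¹`; this is why the pairing is built in reverse order and exchanged by
the braiding afterwards. -/
theorem IsLeftCoaction.contractRight (h : IsLeftCoaction (leftMap e t)) (x : V ⊗[k] Dual k V) :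
    (contractRight k V).lTensor B (tensorCoact (leftMap e t)
      (leftMap e.dualBasis (antipodeTranspose (k := k) t)) x) =
      trivCoact k B (contractRight k V x) := by
  refine LinearMap.congr_fun (f := (LinearMap.lTensor B (_root_.contractRight k V)) ∘ₗ
    tensorCoact (leftMap e t) (leftMap e.dualBasis (antipodeTranspose (k := k) t)))
    (g := trivCoact k B ∘ₗ _root_.contractRight k V) ?_ x
  refine (e.tensorProduct e.dualBasis).ext fun ⟨j, i⟩ => ?_
  simp only [Basis.tensorProduct_apply, LinearMap.comp_apply, tensorCoact_tmul, leftMap_basis,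
    map_sum, LinearMap.sum_apply, mulCo_tmul, lTensor_tmul, antipodeTranspose, Matrix.of_apply,
    contractRight_apply, Basis.dualBasis_apply_self, trivCoact_apply]
  have := congrArg (· ⊗ₜ[k] (1 : k)) (h.sum_mul_antipode e i j)
  simpa [sum_tmul, tmul_ite, Matrix.one_apply, eq_comm, apply_ite (algebraMap k B),
    ite_tmul] using this

/-- Here the coaction on a tensor product multiplies coefficients in reverse order, so `V ⊗ V*`
again gives an antipode identity, now `Σ S(t) t`. -/
theorem IsRightCoaction.contractRight (h : IsRightCoaction (rightMap e t)) (x : V ⊗[k] Dual k V) :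
    (contractRight k V).rTensor B (tensorCoactR (rightMap e t)
      (rightMap e.dualBasis (antipodeTranspose (k := k) t)) x) =
      trivCoactR k B (contractRight k V x) := by
  refine LinearMap.congr_fun (f := (LinearMap.rTensor B (_root_.contractRight k V)) ∘ₗ
    tensorCoactR (rightMap e t) (rightMap e.dualBasis (antipodeTranspose (k := k) t)))
    (g := trivCoactR k B ∘ₗ _root_.contractRight k V) ?_ x
  refine (e.tensorProduct e.dualBasis).ext fun ⟨j, i⟩ => ?_
  simp only [Basis.tensorProduct_apply, LinearMap.comp_apply, tensorCoactR_tmul, rightMap_basis,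
    map_sum, LinearMap.sum_apply, mulCoR_tmul, rTensor_tmul, antipodeTranspose, Matrix.of_apply,
    contractRight_apply, Basis.dualBasis_apply_self, trivCoactR_apply]
  have := congrArg ((1 : k) ⊗ₜ[k] ·) (h.sum_antipode_mul e i j)
  simpa [tmul_sum, ite_tmul, Matrix.one_apply, eq_comm, apply_ite (algebraMap k B),
    tmul_ite] using this

theorem IsLeftCoaction.tensorCoact_sum (h : IsLeftCoaction (leftMap e t)) :
    tensorCoact (leftMap e.dualBasis (antipodeTranspose (k := k) t)) (leftMap e t)
      (∑ j, e.dualBasis j ⊗ₜ[k] e j) = 1 ⊗ₜ[k] ∑ j, e.dualBasis j ⊗ₜ[k] e j := by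
  simp only [tensorCoact_tmul, leftMap_basis,
    map_sum, LinearMap.sum_apply, mulCo_tmul, antipodeTranspose, Matrix.of_apply]
  have h1 (m : ι) : (1 : B) ⊗ₜ[k] (e.dualBasis m ⊗ₜ[k] e m) =
      ∑ l, (∑ j, 𝑺 (t j m) * t l j) ⊗ₜ[k] (e.dualBasis m ⊗ₜ[k] e l) := by
    simp [h.sum_antipode_mul e, Matrix.one_apply, apply_ite (algebraMap k B), ite_tmul]
  simp only [tmul_sum, h1, sum_tmul]
  rw [Finset.sum_comm]
  conv_lhs => enter [2, l]; rw [Finset.sum_comm]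
  rw [Finset.sum_comm]

theorem IsRightCoaction.tensorCoactR_sum (h : IsRightCoaction (rightMap e t)) :
    tensorCoactR (rightMap e.dualBasis (antipodeTranspose (k := k) t)) (rightMap e t)
      (∑ j, e.dualBasis j ⊗ₜ[k] e j) = (∑ j, e.dualBasis j ⊗ₜ[k] e j) ⊗ₜ[k] 1 := by
  simp only [tensorCoactR_tmul, rightMap_basis,
    map_sum, LinearMap.sum_apply, mulCoR_tmul, antipodeTranspose, Matrix.of_apply]
  have h1 (m : ι) : (e.dualBasis m ⊗ₜ[k] e m) ⊗ₜ[k] (1 : B) =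
      ∑ l, (e.dualBasis m ⊗ₜ[k] e l) ⊗ₜ[k] (∑ j, t l j * 𝑺 (t j m)) := by
    simp [h.sum_mul_antipode e, Matrix.one_apply, apply_ite (algebraMap k B), tmul_ite]
  simp only [tmul_sum, h1, sum_tmul]
  rw [Finset.sum_comm]
  conv_lhs => enter [2, l]; rw [Finset.sum_comm]
  rw [Finset.sum_comm]

end Coaction

section YetterDrinfeld

variable (hS : Function.Bijective (HopfAlgebra.antipode k (A := B))) (a : B →ₐ[k] Module.End k V)

/-- The action `h f = f ∘ S⁻¹(h)` on the dual space. -/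
noncomputable def inverseDualAct : B →ₐ[k] Module.End k (Dual k V) :=
  dualSpaceAct a (antipodeInv hS) (antipodeInv_one hS) (antipodeInv_mul_antidistrib hS)

theorem antipodeInv_antipode (h : B) : antipodeInv hS (𝑺 h) = h :=
  (LinearEquiv.ofBijective 𝑺 hS).symm_apply_apply h

theorem coeff_inverseDualAct (i j : ι) (h : B) :
    coeff e.dualBasis (inverseDualAct hS a) i j (𝑺 h) = coeff e a j i h := by
  simp [coeff, inverseDualAct, dualSpaceAct_apply, antipodeInv_antipode]

/-- Evaluating at `S(h)` cancels the `S⁻¹` of the dual action, while the reversal of the coproduct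
by `S` turns a coefficient of the right leg into one of the left leg. -/
theorem coeffRight_inverseDualAct (h : B) :
    coeffRight e.dualBasis (inverseDualAct hS a) (Coalgebra.comul (R := k) (𝑺 h)) =
      antipodeTranspose (k := k) (coeffLeft e a (Coalgebra.comul (R := k) h)) := by
  ext i j
  rw [comul_antipode]
  simp only [coeffRight, coeffLeft, antipodeTranspose, Matrix.of_apply]
  induction Coalgebra.comul (R := k) h with
  | zero => simp
  | add z z' hz hz' => simp only [map_add, hz, hz']
  | tmul p q => simp [coeff_inverseDualAct]

theorem coeffLeft_inverseDualAct (h : B) :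
    coeffLeft e.dualBasis (inverseDualAct hS a) (Coalgebra.comul (R := k) (𝑺 h)) =
      antipodeTranspose (k := k) (coeffRight e a (Coalgebra.comul (R := k) h)) := by
  ext i j
  rw [comul_antipode]
  simp only [coeffRight, coeffLeft, antipodeTranspose, Matrix.of_apply]
  induction Coalgebra.comul (R := k) h with
  | zero => simp
  | add z z' hz hz' => simp only [map_add, hz, hz']
  | tmul p q => simp [coeff_inverseDualAct]

theorem antipodeTranspose_mul (t t' : Matrix ι ι B) :
    antipodeTranspose (k := k) (t * t') =
      antipodeTranspose (k := k) t' * antipodeTranspose (k := k) t := by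
  ext i j
  simp [antipodeTranspose, Matrix.mul_apply, HopfAlgebra.antipode_mul_antidistrib]

variable {a}

/-- The antimultiplicative map `t ↦ S(tᵀ)` sends the matrix equation for `h` to the dual equation
for `S(h)`; since `S` is surjective, these are all elements of `B`. -/
theorem IsYDLeftLeft.dual {t : Matrix ι ι B} (h : IsYDLeftLeft a (leftMap e t)) :
    IsYDLeftLeft (inverseDualAct hS a) (leftMap e.dualBasis (antipodeTranspose (k := k) t)) := by
  rw [isYDLeftLeft_leftMap] at h ⊢
  intro x
  obtain ⟨y, rfl⟩ := hS.surjective x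
  rw [coeffLeft_inverseDualAct, coeffRight_inverseDualAct, ← antipodeTranspose_mul, ← h,
    antipodeTranspose_mul]

theorem IsYDLeftRight.dual {t : Matrix ι ι B} (h : IsYDLeftRight a (rightMap e t)) :
    IsYDLeftRight (inverseDualAct hS a)
      (rightMap e.dualBasis (antipodeTranspose (k := k) t)) := by
  rw [isYDLeftRight_rightMap] at h ⊢
  intro x
  obtain ⟨y, rfl⟩ := hS.surjective x
  rw [coeffLeft_inverseDualAct, coeffRight_inverseDualAct, ← antipodeTranspose_mul, ← h,
    antipodeTranspose_mul]

end YetterDrinfeld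

end DualStructures

end BraidedDuality

namespace BraidedDuality

universe u v w

/-! ### Left duals of finite-dimensional objects -/

section Pairing

open scoped TensorProduct
open TensorProduct Module CategoryTheory MonoidalCategory

variable {k : Type u} [Field k] {V W : Type*} [AddCommGroup V] [Module k V] [AddCommGroup W]
  [Module k W] {ι : Type*} [Fintype ι] [DecidableEq ι] {e : Basis ι k V} {e' : Basis ι k W}

/-- One zigzag identity for dual bases, checked on the basis: the pairing picks the single matching
term of the sum. -/
theorem rTensor_sum_dual {f : W ⊗[k] V →ₗ[k] k}
    (hf : ∀ i j, f (e' i ⊗ₜ e j) = (1 : Matrix ι ι k) i j) (w : W) :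
    f.rTensor W ((TensorProduct.assoc k W V W).symm (w ⊗ₜ[k] ∑ i, e i ⊗ₜ[k] e' i)) = 1 ⊗ₜ[k] w := by
  refine LinearMap.congr_fun (f := f.rTensor W ∘ₗ (TensorProduct.assoc k W V W).symm.toLinearMap ∘ₗ
    (TensorProduct.mk k W (V ⊗[k] W)).flip (∑ i, e i ⊗ₜ[k] e' i)) (g := TensorProduct.mk k k W 1)
    (e'.ext fun j => ?_) w
  simp [hf, Matrix.one_apply, ite_tmul]

theorem lTensor_sum_dual {f : W ⊗[k] V →ₗ[k] k}
    (hf : ∀ i j, f (e' i ⊗ₜ e j) = (1 : Matrix ι ι k) i j) (v : V) :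
    f.lTensor V (TensorProduct.assoc k V W V ((∑ i, e i ⊗ₜ[k] e' i) ⊗ₜ[k] v)) = v ⊗ₜ[k] 1 := by
  refine LinearMap.congr_fun (f := f.lTensor V ∘ₗ (TensorProduct.assoc k V W V).toLinearMap ∘ₗ
    TensorProduct.mk k (V ⊗[k] W) V (∑ i, e i ⊗ₜ[k] e' i)) (g := (TensorProduct.mk k V k).flip 1)
    (e.ext fun j => ?_) v
  simp [hf, Matrix.one_apply, tmul_ite]

namespace BraidedKind

variable {D : BraidedKind.{u, w} k}

/-- Morphisms that pair dual bases form an exact pairing. -/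
@[reducible]
def exactPairingOfBasis {X Y : D.Obj} (e : Basis ι k X.carrier) (e' : Basis ι k Y.carrier)
    (ev : Y ⊗ X ⟶ 𝟙_ D.Obj) (coev : 𝟙_ D.Obj ⟶ X ⊗ Y)
    (hev : ∀ i j, ev.lin (e' i ⊗ₜ[k] e j) = (1 : Matrix ι ι k) i j)
    (hcoev : coev.lin (1 : k) = ∑ i, e i ⊗ₜ[k] e' i) : ExactPairing X Y where
  evaluation' := ev
  coevaluation' := coev
  coevaluation_evaluation' := Hom.ext <| TensorProduct.ext <| LinearMap.ext fun y =>
    LinearMap.ext_ring <| by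
      refine Eq.trans ?_ ((rTensor_sum_dual (e := e) (e' := e') (f := ev.lin) hev y).trans
        (congrArg ((1 : k) ⊗ₜ[k] ·) (one_smul k y).symm))
      exact congrArg (fun z => LinearMap.rTensor Y.carrier ev.lin
        ((TensorProduct.assoc k Y.carrier X.carrier Y.carrier).symm (y ⊗ₜ[k] z))) hcoev
  evaluation_coevaluation' := Hom.ext <| TensorProduct.ext <| LinearMap.ext_ring <|
    LinearMap.ext fun x => by
      refine Eq.trans ?_ ((lTensor_sum_dual (e := e) (e' := e') (f := ev.lin) hev x).trans
        (congrArg (· ⊗ₜ[k] (1 : k)) (one_smul k x).symm))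
      exact congrArg (fun z => LinearMap.lTensor X.carrier ev.lin
        (TensorProduct.assoc k X.carrier Y.carrier X.carrier (z ⊗ₜ[k] x))) hcoev

/-- A structure on the dual space, such that the evaluation and the coevaluation are morphisms,
gives a left dual. -/
theorem exists_leftDual {X : D.Obj} (e : Basis ι k X.carrier) (s : D.Str (Dual k X.carrier))
    (hev : D.IsHom (D.tensor s X.str) D.unit (contractLeft k X.carrier))
    (hcoev : D.IsHom D.unit (D.tensor X.str s)
      (LinearMap.toSpanSingleton k _ (∑ i, e i ⊗ₜ[k] e.dualBasis i))) :
    ∃ Xd : D.Obj, Nonempty (ExactPairing X Xd) := by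
  let Y : D.Obj := ⟨_, s⟩
  refine ⟨Y, ⟨exactPairingOfBasis (Y := Y) e e.dualBasis ⟨_, hev⟩ ⟨_, hcoev⟩ (fun i j => ?_)
    (one_smul k _)⟩⟩
  exact (e.dualBasis_apply_self i j).trans (by simp [Matrix.one_apply, eq_comm])

/-- A structure on the dual space, such that the reversed evaluation and coevaluation are morphisms,
gives a left dual. -/
theorem exists_leftDual_of_right {X : D.Obj} (e : Basis ι k X.carrier)
    (s : D.Str (Dual k X.carrier))
    (hev : D.IsHom (D.tensor X.str s) D.unit (contractRight k X.carrier))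
    (hcoev : D.IsHom D.unit (D.tensor s X.str)
      (LinearMap.toSpanSingleton k _ (∑ i, e.dualBasis i ⊗ₜ[k] e i))) :
    ∃ Xd : D.Obj, Nonempty (ExactPairing X Xd) := by
  let Y : D.Obj := ⟨_, s⟩
  have : ExactPairing Y X :=
    exactPairingOfBasis (X := Y) e.dualBasis e ⟨_, hev⟩ ⟨_, hcoev⟩ (fun i j =>
      (e.dualBasis_apply_self j i).trans (by simp [Matrix.one_apply])) (one_smul k _)
  -- So far `X` is a left dual of `Y`; in a braided category the braiding turns this into a left
  -- dual of `X`.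
  exact ⟨Y, ⟨BraidedCategory.exactPairing_swap Y X⟩⟩

end BraidedKind

variable {k : Type u} [Field k] {B : Type v} [Ring B] [HopfAlgebra k B]
variable {V : Type u} [AddCommGroup V] [Module k V]
variable {ι : Type*} [Fintype ι] [DecidableEq ι] (e : Basis ι k V)
  (a : B →ₐ[k] Module.End k V)

variable (k V) in
/-- The action `h f = f ∘ S(h)` on the dual space. -/
noncomputable def antipodeDualAct : B →ₐ[k] Module.End k (Dual k V) :=
  dualSpaceAct a (HopfAlgebra.antipode k) HopfAlgebra.antipode_one
    HopfAlgebra.antipode_mul_antidistrib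

/-- `S(h₁) h₂ = ε(h)`. -/
theorem contractLeft_tensorAct (h : B) (x : Dual k V ⊗[k] V) :
    contractLeft k V (tensorAct (antipodeDualAct k V a) a h x) =
      trivAct k B h (contractLeft k V x) := by
  induction x with
  | zero => simp
  | add x y hx hy => simp only [map_add, hx, hy]
  | tmul f x =>
    refine (contractLeft_twoAct a _ _ _ (Coalgebra.comul h) f x).trans ?_
    rw [HopfAlgebra.mul_antipode_rTensor_comul_apply, AlgHom.commutes, trivAct_apply,
      Module.algebraMap_end_apply, map_smul, contractLeft_apply, smul_eq_mul]

theorem tensorAct_sum_dualBasis (h : B) :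
    tensorAct a (antipodeDualAct k V a) h (∑ i, e i ⊗ₜ[k] e.dualBasis i) =
      Coalgebra.counit (R := k) h • ∑ i, e i ⊗ₜ[k] e.dualBasis i := by
  simp only [Basis.coe_dualBasis]
  refine (twoAct_sum_tmul_coord e a _ _ _ (Coalgebra.comul h)).trans ?_
  rw [HopfAlgebra.mul_antipode_lTensor_comul_apply, AlgHom.commutes]
  simp only [Module.algebraMap_end_apply, Finset.smul_sum, smul_tmul']

variable (hS : Function.Bijective (HopfAlgebra.antipode k (A := B)))

/-- `S⁻¹(h₂) h₁ = ε(h)`. -/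
theorem contractRight_tensorAct (h : B) (x : V ⊗[k] Dual k V) :
    contractRight k V (tensorAct a (inverseDualAct hS a) h x) =
      trivAct k B h (contractRight k V x) := by
  induction x with
  | zero => simp
  | add x y hx hy => simp only [map_add, hx, hy]
  | tmul x f =>
    refine (contractRight_twoAct a _ _ _ (Coalgebra.comul h) f x).trans ?_
    rw [antipodeInv_mul, AlgHom.commutes, trivAct_apply,
      Module.algebraMap_end_apply, map_smul, contractRight_apply, smul_eq_mul]

theorem tensorAct_sum_dualBasis_tmul (h : B) :
    tensorAct (inverseDualAct hS a) a h (∑ i, e.dualBasis i ⊗ₜ[k] e i) =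
      Coalgebra.counit (R := k) h • ∑ i, e.dualBasis i ⊗ₜ[k] e i := by
  simp only [Basis.coe_dualBasis]
  refine (twoAct_sum_coord_tmul e a _ _ _ (Coalgebra.comul h)).trans ?_
  rw [mul_antipodeInv, AlgHom.commutes]
  simp only [Module.algebraMap_end_apply, Finset.smul_sum, tmul_smul]

variable {M : Type u} [AddCommGroup M] [Module k M]

/-- A coevaluation is determined by its value `x` at `1`, and it is a morphism when `x` is
invariant, respectively coinvariant in the two statements that follow. -/
theorem toSpanSingleton_trivAct {b : B →ₐ[k] Module.End k M} {x : M}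
    (hx : ∀ h, b h x = Coalgebra.counit (R := k) h • x) (h : B) (c : k) :
    LinearMap.toSpanSingleton k M x (trivAct k B h c) =
      b h (LinearMap.toSpanSingleton k M x c) := by
  simp [trivAct_apply, hx, mul_smul, smul_comm c]

theorem toSpanSingleton_trivCoact {ρ : M →ₗ[k] B ⊗[k] M} {x : M} (hx : ρ x = 1 ⊗ₜ[k] x) (c : k) :
    (LinearMap.toSpanSingleton k M x).lTensor B (trivCoact k B c) =
      ρ (LinearMap.toSpanSingleton k M x c) := by
  simp [hx]

theorem toSpanSingleton_trivCoactR {ρ : M →ₗ[k] M ⊗[k] B} {x : M} (hx : ρ x = x ⊗ₜ[k] 1) (c : k) :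
    (LinearMap.toSpanSingleton k M x).rTensor B (trivCoactR k B c) =
      ρ (LinearMap.toSpanSingleton k M x c) := by
  simp [hx, smul_tmul']

namespace BraidedKind

theorem finiteHaveLeftDuals_moduleKind (Q : QuasiTriangular k B) :
    FiniteHaveLeftDuals (moduleKind Q) := fun X _ =>
  exists_leftDual (Module.finBasis k X.carrier) (antipodeDualAct k X.carrier X.str)
    (contractLeft_tensorAct X.str) (toSpanSingleton_trivAct (tensorAct_sum_dualBasis _ X.str))

/-- The dual coaction uses `S` and no inverse, so bijectivity of the antipode is not required. -/
theorem finiteHaveLeftDuals_comoduleKind (r : CoquasiTriangular k B) :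
    FiniteHaveLeftDuals (comoduleKind r) := by
  intro X _
  let e := Module.finBasis k X.carrier
  have hρ : IsLeftCoaction X.str.1 := X.str.2
  obtain ⟨t, ht⟩ := exists_leftMap e X.str.1
  rw [ht] at hρ
  have h1 := hρ.contractRight e
  have h2 := hρ.tensorCoact_sum e
  rw [← ht] at h1 h2
  exact exists_leftDual_of_right e ⟨_, hρ.dual e⟩ h1 (toSpanSingleton_trivCoact h2)

/-- The coaction is dualised by `S`, which makes the pairing on `V ⊗ V*` colinear; linearity in the
same order, and compatibility with the coaction, force `S⁻¹` in the dual action. -/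
theorem finiteHaveLeftDuals_yetterDrinfeldLeftLeftKind :
    FiniteHaveLeftDuals (yetterDrinfeldLeftLeftKind hS) := by
  intro X _
  let e := Module.finBasis k X.carrier
  have hρ : IsLeftCoaction X.str.1.2 := X.str.2.1
  have ha : IsYDLeftLeft X.str.1.1 X.str.1.2 := X.str.2.2
  obtain ⟨t, ht⟩ := exists_leftMap e X.str.1.2
  rw [ht] at hρ ha
  have h1 := hρ.contractRight e
  have h2 := hρ.tensorCoact_sum e
  rw [← ht] at h1 h2
  exact exists_leftDual_of_right e ⟨(_, _), hρ.dual e, ha.dual e hS⟩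
    ⟨contractRight_tensorAct _ hS, h1⟩
    ⟨toSpanSingleton_trivAct (tensorAct_sum_dualBasis_tmul e _ hS), toSpanSingleton_trivCoact h2⟩

/-- Here bijectivity of the antipode serves only the dual action; the braiding of this category is
inverted by `S` itself. -/
theorem finiteHaveLeftDuals_yetterDrinfeldLeftRightKind
    (hS : Function.Bijective (HopfAlgebra.antipode k (A := B))) :
    FiniteHaveLeftDuals (yetterDrinfeldLeftRightKind k B) := by
  intro X _
  let e := Module.finBasis k X.carrier
  have hρ : IsRightCoaction X.str.1.2 := X.str.2.1
  have ha : IsYDLeftRight X.str.1.1 X.str.1.2 := X.str.2.2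
  obtain ⟨t, ht⟩ := exists_rightMap e X.str.1.2
  rw [ht] at hρ ha
  have h1 := hρ.contractRight e
  have h2 := hρ.tensorCoactR_sum e
  rw [← ht] at h1 h2
  exact exists_leftDual_of_right e ⟨(_, _), hρ.dual e, ha.dual e hS⟩
    ⟨contractRight_tensorAct _ hS, h1⟩
    ⟨toSpanSingleton_trivAct (tensorAct_sum_dualBasis_tmul e _ hS), toSpanSingleton_trivCoactR h2⟩

end BraidedKind

end Pairing

end BraidedDuality

open BraidedDuality BraidedDuality.BraidedKind

/-- The duality theorem in the category of modules over a quasi-triangular Hopf algebra `B`, of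
comodules over a coquasi-triangular Hopf algebra `B`, and of left-left and left-right
Yetter-Drinfeld modules over a Hopf algebra `B`. -/
theorem corollary4p5 {k : Type*} [Field k] {B : Type*} [Ring B] [HopfAlgebra k B] :
    (∀ Q : QuasiTriangular k B,
      FiniteHaveLeftDuals (moduleKind Q) ∧ DualityTheorem (moduleKind Q)) ∧
    (∀ r : CoquasiTriangular k B,
      FiniteHaveLeftDuals (comoduleKind r) ∧ DualityTheorem (comoduleKind r)) ∧
    (∀ hS : Function.Bijective (HopfAlgebra.antipode k (A := B)),
      FiniteHaveLeftDuals (yetterDrinfeldLeftLeftKind hS) ∧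
        DualityTheorem (yetterDrinfeldLeftLeftKind hS)) ∧
    ((Function.Bijective (HopfAlgebra.antipode k (A := B)) →
        FiniteHaveLeftDuals (yetterDrinfeldLeftRightKind k B)) ∧
      DualityTheorem (yetterDrinfeldLeftRightKind k B)) :=
  ⟨fun Q => ⟨finiteHaveLeftDuals_moduleKind Q, Transports.dualityTheorem (transports_moduleKind Q)⟩,
    fun r => ⟨finiteHaveLeftDuals_comoduleKind r,
      Transports.dualityTheorem (transports_comoduleKind r)⟩,
    fun hS => ⟨finiteHaveLeftDuals_yetterDrinfeldLeftLeftKind hS,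
      Transports.dualityTheorem (transports_yetterDrinfeldLeftLeftKind hS)⟩,
    finiteHaveLeftDuals_yetterDrinfeldLeftRightKind,
    Transports.dualityTheorem transports_yetterDrinfeldLeftRightKind⟩
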